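/- Let $M$ be a closed (compact, without boundary) smooth manifold with a Riemannian metric. Write points of $T^*M$ as $(q,p)$, let $\lambda=p\,dq$ be the Liouville form, $\omega=dp\wedge dq$, $r=|p|$, and $\alpha=p\,dq/|p|$ on the complement of the zero section $M\subset T^*M$. For $v\in T_qM$ let $v^\flat=\langle v,\cdot\rangle\in T_q^*M$. Let $S^1=\mathbb R/\mathbb Z$. Let $\rho:[0,\infty)\to(0,\infty)$ be smooth and nondecreasing with $\rho(r)=1$ near $r=0$ and $\rho(r)=r$ for large $r$, and let $J$ be the almost complex structure on $T^*M$ which, in the canonical coordinates $(q_i,p_i)$ induced by geodesic normal coordinates at $q$, is given at the points $(q,p)$ of the fibre over $q$ by $$J:\ \frac{\partial}{\partial q_i}\mapsto-\rho(|p|)\frac{\partial}{\partial p_i},\qquad \rho(|p|)\frac{\partial}{\partial p_i}\mapsto\frac{\partial}{\partial q_i}.$$ Let $\mu,\delta>0$ and let $h:[0,\infty)\to[0,\infty)$ be smooth with $h=0$ on $[0,1]$, $h'$ strictly increasing on $(1,1+\delta)$, and $h'=\mu$ on $[1+\delta,\infty)$. Put $H=h(|p|):T^*M\to\mathbb R$,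 let $X_H$ be its Hamiltonian vector field, $\omega(X_H,\cdot)=-dH$, and $A_H(x)=\int_0^1\bigl(x^*\lambda-H(x)\,dt\bigr)$ for loops $x:S^1\to T^*M$. Let $x:S^1\to T^*M$ be a nonconstant $1$-periodic orbit of $X_H$, and let $u:[0,\infty)\times S^1\to T^*M$ be a smooth map with $$\partial_su+J(u)\bigl(\partial_tu-X_H(u)\bigr)=0,\qquad \lim_{s\to\infty}u(s,\cdot)=x\ \text{ uniformly},\qquad u(0,\cdot)\subset M.$$ Let $q=u(0,\cdot):S^1\to M$ and $\ell(q)=\int_0^1|\dot q|\,dt$. Then $$\ell(q)\le\int_x\alpha\le A_H(x).$$ Moreover, $\ell(q)=\int_x\alpha$ if and only if $q$ is a (nonconstant) closed geodesic, $\nabla_t\dot q=0$, and $u$ is contained in the half-cylinder $\{(q(\tau),\,r\,\dot q(\tau)^\flat)\mid \tau\in S^1,\ r\ge0\}$ over $q$. In this case $x$ is the lift of the geodesic $q$: there is $c>0$ with $x(t)=(q(t),\,c\,\dot q(t)^\flat)$ for all $t$. -/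

import Mathlib

open Set Filter
open scoped Manifold ContDiff Topology

noncomputable section

namespace CotangentFloer

/-- The model space `ℝⁿ`. -/
abbrev Model (n : ℕ) : Type := EuclideanSpace ℝ (Fin n)

/-- The dual `(ℝⁿ)*` of the model space. -/
abbrev DualModel (n : ℕ) : Type := Model n →L[ℝ] ℝ

/-- The model of the `2n`-dimensional manifold `T^*M`. -/
abbrev cotModel (n : ℕ) :
    ModelWithCorners ℝ (Model n × DualModel n) (ModelProd (Model n) (DualModel n)) :=
  (𝓡 n).prod 𝓘(ℝ, DualModel n)

/-! ### Radial profiles and Christoffel symbols -/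

/-- The function `ρ : [0, ∞) → (0, ∞)` used to rescale the canonical almost complex structure:
smooth, nondecreasing, equal to `1` near `0` and to `r` for large `r`.
Values at negative arguments are irrelevant. -/
structure IsCylindricalProfile (ρ : ℝ → ℝ) : Prop where
  smooth : ContDiffOn ℝ ∞ ρ (Ici 0)
  pos : ∀ r, 0 ≤ r → 0 < ρ r
  mono : MonotoneOn ρ (Ici 0)
  eq_one_near_zero : ∃ η > 0, ∀ r, 0 ≤ r → r ≤ η → ρ r = 1
  eq_self_at_infinity : ∃ R : ℝ, ∀ r, R ≤ r → ρ r = r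

/-- The function `h : [0, ∞) → [0, ∞)` defining the Hamiltonian `H = h(|p|)`: smooth, zero on
`[0, 1]`, strictly convex (in the form that `h'` is strictly increasing) on `(1, 1 + δ)`, and
linear of slope `μ > 0` on `[1 + δ, ∞)`. Values at negative arguments are irrelevant. -/
structure IsLinearProfile (μ δ : ℝ) (h : ℝ → ℝ) : Prop where
  slope_pos : 0 < μ
  width_pos : 0 < δ
  smooth : ContDiffOn ℝ ∞ h (Ici 0)
  nonneg : ∀ r, 0 ≤ r → 0 ≤ h r
  eq_zero : ∀ r, 0 ≤ r → r ≤ 1 → h r = 0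
  deriv_strictMono : StrictMonoOn (deriv h) (Ioo 1 (1 + δ))
  deriv_eq_slope : ∀ r, 1 + δ ≤ r → deriv h r = μ

/-- The Christoffel symbols of the first kind of a metric `g` on (an open subset of) `ℝⁿ` at `y`:
`w ↦ [a w, P] = ½ (∂_a g(w, P) + ∂_w g(a, P) - ∂_P g(a, w))`. -/
def christoffelFirst {n : ℕ} (g : Model n → Model n →L[ℝ] Model n →L[ℝ] ℝ) (y P a : Model n) :
    DualModel n :=
  let D : Model n →L[ℝ] Model n →L[ℝ] Model n →L[ℝ] ℝ := fderiv ℝ g y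
  (1 / 2 : ℝ) • ((D a).flip P + (D.flip a).flip P - D P a)

section Manifold

open Bundle

variable {n : ℕ} {M : Type*} [TopologicalSpace M] [ChartedSpace (Model n) M]
  [IsManifold (𝓡 n) ∞ M]

/-! ### The cotangent bundle and its canonical symplectic geometry

A point of `T^*M` is a pair `z = ⟨q, p⟩` with `p : T_q M → ℝ` linear. Mathlib identifies
`T_z (T^*M)` with `ℝⁿ × (ℝⁿ)*` through the preferred chart of `T^*M` at `z`, which is the chart by
the canonical coordinates `(q_i, p_i)` induced by the preferred chart of `M` at `q`. So a tangent
vector is a pair `(a, b) = ∑ a_i ∂/∂q_i + ∑ b_i ∂/∂p_i`. In the same way `T_q M` is identified with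
`ℝⁿ` through the preferred chart of `M` at `q`. -/

variable (n M) in
/-- The cotangent bundle `T^*M`, with the smooth structure of the bundle of continuous linear maps
from the tangent bundle to the trivial line bundle. -/
abbrev Cotangent : Type _ :=
  TotalSpace (DualModel n) (fun q : M => TangentSpace (𝓡 n) q →L[ℝ] Bundle.Trivial M ℝ q)

/-- The tangent vector `∑ a_i ∂/∂q_i + ∑ b_i ∂/∂p_i` in canonical coordinates. -/
def mkTangent (z : Cotangent n M) (a : TangentSpace (𝓡 n) z.1)
    (b : TangentSpace (𝓡 n) z.1 →L[ℝ] ℝ) : TangentSpace (cotModel n) z :=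
  ((a, b) : Model n × DualModel n)

/-- The `∂/∂q` coordinates of a tangent vector of `T^*M`. -/
def qPart {z : Cotangent n M} (V : TangentSpace (cotModel n) z) : TangentSpace (𝓡 n) z.1 :=
  Prod.fst (α := Model n) (β := DualModel n) V

/-- The `∂/∂p` coordinates of a tangent vector of `T^*M`. -/
def pPart {z : Cotangent n M} (V : TangentSpace (cotModel n) z) :
    TangentSpace (𝓡 n) z.1 →L[ℝ] ℝ :=
  Prod.snd (α := Model n) (β := DualModel n) V

/-- The Liouville form `λ = p dq`, i.e. `λ_{(q,p)} = p ∘ dπ` for the projection `π : T^*M → M`. -/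
def liouville (z : Cotangent n M) (V : TangentSpace (cotModel n) z) : ℝ :=
  z.2 (mfderiv (cotModel n) (𝓡 n) (fun w : Cotangent n M => w.1) z V)

/-- The Hamiltonian vector field `X_H = ∑ ∂H/∂p_i ∂/∂q_i - ∑ ∂H/∂q_i ∂/∂p_i`, characterized by
`ω(X_H, ·) = -dH` for `ω = dp ∧ dq`. -/
def hamiltonianVectorField (H : Cotangent n M → ℝ) (z : Cotangent n M) :
    TangentSpace (cotModel n) z :=
  let dH : Model n × DualModel n →L[ℝ] ℝ := mfderiv (cotModel n) 𝓘(ℝ, ℝ) H z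
  mkTangent z
    (∑ i, dH (0, EuclideanSpace.proj i) • EuclideanSpace.single i (1 : ℝ))
    (-(dH.comp (ContinuousLinearMap.inl ℝ (Model n) (DualModel n))))

/-- The Hamiltonian action `A_H(x) = ∫₀¹ (x^*λ - H(x) dt)` of a loop `x : ℝ/ℤ → T^*M`. -/
def hamiltonianAction (H : Cotangent n M → ℝ) (x : ℝ → Cotangent n M) : ℝ :=
  ∫ t in (0 : ℝ)..1, (liouville (x t) (mfderiv 𝓘(ℝ, ℝ) (cotModel n) x t (1 : ℝ)) - H (x t))

/-! ### Riemannian data -/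

variable [RiemannianBundle (fun q : M => TangentSpace (𝓡 n) q)]

/-- The covector `⟨v, ·⟩`. -/
def flat {q : M} (v : TangentSpace (𝓡 n) q) : TangentSpace (𝓡 n) q →L[ℝ] ℝ :=
  innerSL ℝ v

/-- The vector `p^♯` with `⟨p^♯, ·⟩ = p`. -/
def sharp {q : M} (p : TangentSpace (𝓡 n) q →L[ℝ] ℝ) : TangentSpace (𝓡 n) q :=
  haveI : FiniteDimensional ℝ (TangentSpace (𝓡 n) q) :=
    inferInstanceAs (FiniteDimensional ℝ (Model n))
  haveI : CompleteSpace (TangentSpace (𝓡 n) q) := FiniteDimensional.complete ℝ _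
  (InnerProductSpace.toDual ℝ (TangentSpace (𝓡 n) q)).symm p

/-- The Riemannian metric in the preferred chart at `q₀`, as a bilinear form depending on the
point `y` of the chart domain in `ℝⁿ`. -/
def chartMetric (q₀ : M) (y : Model n) : Model n →L[ℝ] Model n →L[ℝ] ℝ :=
  let A : Model n →L[ℝ] TangentSpace (𝓡 n) ((extChartAt (𝓡 n) q₀).symm y) :=
    mfderiv 𝓘(ℝ, Model n) (𝓡 n) (extChartAt (𝓡 n) q₀).symm y
  (innerSL ℝ).bilinearComp A A

/-- For `z = (q, p)` and `a ∈ T_q M`, the covector `w ↦ p(Γ(a, w)) = ∑ Γ^k_{ij} a_i w_j p_k`, where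
`Γ` are the Christoffel symbols of the Levi-Civita connection at `q` in the preferred chart at `q`.
It equals `w ↦ [a w, P]` with the Christoffel symbols of the first kind and `P = p^♯`. -/
def christoffelCovector (z : Cotangent n M) (a : TangentSpace (𝓡 n) z.1) :
    TangentSpace (𝓡 n) z.1 →L[ℝ] ℝ :=
  christoffelFirst (chartMetric z.1) (extChartAt (𝓡 n) z.1 z.1) (sharp z.2) a

/-- The vertical component of a tangent vector of `T^*M` with respect to the Levi-Civita
connection. For a curve `(q(t), p(t))` it maps the velocity to the covariant derivative
`∇_t p`, i.e. `ṗ_j - ∑ Γ^k_{ij} q̇_i p_k`. -/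
def connector {z : Cotangent n M} (V : TangentSpace (cotModel n) z) :
    TangentSpace (𝓡 n) z.1 →L[ℝ] ℝ :=
  pPart V - christoffelCovector z (qPart V)

/-- The tangent vector of `T^*M` at `z = (q, p)` with horizontal component the horizontal lift of
`a ∈ T_q M` and vertical component `b ∈ T_q^*M`. In canonical coordinates induced by geodesic normal
coordinates at `q`, this is `∑ a_i ∂/∂q_i + ∑ b_i ∂/∂p_i`. -/
def horizontalVertical (z : Cotangent n M) (a : TangentSpace (𝓡 n) z.1)
    (b : TangentSpace (𝓡 n) z.1 →L[ℝ] ℝ) : TangentSpace (cotModel n) z :=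
  mkTangent z a (b + christoffelCovector z a)

/-- The almost complex structure `J` with `∂/∂q_i ↦ -ρ(|p|) ∂/∂p_i` and
`ρ(|p|) ∂/∂p_i ↦ ∂/∂q_i` in geodesic normal coordinates; that is, it maps the horizontal lift of
`a` to the vertical vector `-ρ(|p|) a^♭`, and the vertical vector `ρ(|p|) b` to the horizontal lift
of `b^♯`. -/
def almostComplex (ρ : ℝ → ℝ) (z : Cotangent n M) (V : TangentSpace (cotModel n) z) :
    TangentSpace (cotModel n) z :=
  horizontalVertical z ((ρ ‖z.2‖)⁻¹ • sharp (connector V)) (-(ρ ‖z.2‖ • flat (qPart V)))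

/-- The Hamiltonian `H = h(|p|)`. -/
def radialHamiltonian (h : ℝ → ℝ) (z : Cotangent n M) : ℝ := h ‖z.2‖

/-- The integral `∫_x α` over the loop `x : ℝ/ℤ → T^*M` (avoiding the zero section) of the form
`α = p dq / |p|`. -/
def contactAction (x : ℝ → Cotangent n M) : ℝ :=
  ∫ t in (0 : ℝ)..1, liouville (x t) (mfderiv 𝓘(ℝ, ℝ) (cotModel n) x t (1 : ℝ)) / ‖(x t).2‖

/-! ### Loops in `M` and geodesics -/

/-- The velocity of a curve in `M`. -/
def velocity (q : ℝ → M) (t : ℝ) : TangentSpace (𝓡 n) (q t) :=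
  mfderiv 𝓘(ℝ, ℝ) (𝓡 n) q t (1 : ℝ)

/-- The length `∫₀¹ |q̇| dt` of a loop `q : ℝ/ℤ → M`. -/
def loopLength (q : ℝ → M) : ℝ :=
  ∫ t in (0 : ℝ)..1, ‖velocity (n := n) q t‖

/-- The curve `t ↦ (q(t), q̇(t)^♭)` in `T^*M`. -/
def velocityLift (q : ℝ → M) (t : ℝ) : Cotangent n M :=
  ⟨q t, flat (velocity q t)⟩

/-- A closed geodesic, parametrized as a `1`-periodic curve: smooth, nonconstant, with
`∇_t q̇ = 0` (written as `∇_t (q̇^♭) = 0`). -/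
structure IsClosedGeodesic (q : ℝ → M) : Prop where
  smooth : ContMDiff 𝓘(ℝ, ℝ) (𝓡 n) ∞ q
  periodic : ∀ t, q (t + 1) = q t
  nonconstant : ∃ t t', q t ≠ q t'
  geodesic : ∀ t,
    connector (mfderiv 𝓘(ℝ, ℝ) (cotModel n) (velocityLift (n := n) q) t (1 : ℝ)) = 0

/-- The half-cylinder `{(q(τ), r q̇(τ)^♭) | r ≥ 0, τ ∈ ℝ/ℤ}` over a loop `q` in `M`. -/
def halfCylinderOver (q : ℝ → M) : Set (Cotangent n M) :=
  {z | ∃ τ r : ℝ, 0 ≤ r ∧ z = ⟨q τ, r • flat (velocity q τ)⟩}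

/-! ### Floer half-cylinders -/

/-- The half-cylinder `[0, ∞) × ℝ/ℤ`, with maps on it written as maps that are `1`-periodic in the
second variable. -/
def halfStrip : Set (ℝ × ℝ) := Ici 0 ×ˢ univ

/-- `∂_s u`. -/
def dS (u : ℝ × ℝ → Cotangent n M) (z : ℝ × ℝ) : TangentSpace (cotModel n) (u z) :=
  mfderivWithin 𝓘(ℝ, ℝ × ℝ) (cotModel n) u halfStrip z ((1, 0) : ℝ × ℝ)

/-- `∂_t u`. -/
def dT (u : ℝ × ℝ → Cotangent n M) (z : ℝ × ℝ) : TangentSpace (cotModel n) (u z) :=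
  mfderivWithin 𝓘(ℝ, ℝ × ℝ) (cotModel n) u halfStrip z ((0, 1) : ℝ × ℝ)

/-- A nonconstant `1`-periodic orbit of the Hamiltonian vector field `X_H`. -/
structure IsNonconstantOrbit (H : Cotangent n M → ℝ) (x : ℝ → Cotangent n M) : Prop where
  integral : IsMIntegralCurve (I := cotModel n) x (hamiltonianVectorField H)
  periodic : ∀ t, x (t + 1) = x t
  nonconstant : ∃ t t', x t ≠ x t'

/-- A smooth map `u : [0, ∞) × ℝ/ℤ → T^*M` with `∂_s u + J(u) (∂_t u - X_H(u)) = 0`,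
`u(+∞, ·) = x` and `u(0, ·)` contained in the zero section. The asymptotic condition is uniform
convergence `u(s, ·) → x` as `s → ∞`; since `ℝ/ℤ` is compact and `x` is continuous, it is written
as convergence of `u(s, t)` to `x(t₀)` as `(s, t) → (∞, t₀)`, for every `t₀`. -/
structure IsFloerHalfCylinder (ρ : ℝ → ℝ) (H : Cotangent n M → ℝ) (x : ℝ → Cotangent n M)
    (u : ℝ × ℝ → Cotangent n M) : Prop where
  smooth : ContMDiffOn 𝓘(ℝ, ℝ × ℝ) (cotModel n) ∞ u halfStrip
  periodic : ∀ s t, 0 ≤ s → u (s, t + 1) = u (s, t)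
  floer : ∀ z ∈ halfStrip,
    dS u z + almostComplex ρ (u z) (dT u z - hamiltonianVectorField H (u z)) = 0
  asymptotic : ∀ t₀ : ℝ, Tendsto u (atTop ×ˢ 𝓝 t₀) (𝓝 (x t₀))
  boundary : ∀ t, (u (0, t)).2 = 0

/-- The boundary loop `q = u(0, ·)`, as a loop in `M`. -/
def boundaryLoop (u : ℝ × ℝ → Cotangent n M) (t : ℝ) : M := (u (0, t)).1

end Manifold

end CotangentFloer

end

open Set Filter
open scoped Manifold ContDiff Topology

set_option linter.unusedSectionVars false

noncomputable section

/-! Write u = (q, p), N = |p|², a = p(∂_t q), b = p(∂_s q), Q = |∂_t q|², S = |∂_s q|². Since X_H is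
horizontal, the Floer equation splits into ∂_s q = -ρ⁻¹ (∇_t p)^♯ and ∇_s p = ρ (∂_t q - h'(|p|)
p^♯/|p|)^♭. With a metric, torsion-free connection this gives first-order identities between the
five functions (`IsFloerScalars`), and nearly all the analysis is done with these alone.

Inequality. Where p ≠ 0, the s-derivative of ∫ a/|p| dt, the integral of α over u(s, ·), is ∫ ρ|p|⁻³
((NQ - a²) + (NS - b²)) dt. It is nonnegative by Cauchy-Schwarz, and h' drops out because α is
invariant under scaling of p. The integral starts at ℓ(q) and ends at h'(r), where r is the constant
value of |p| on x and h'(r) = ∫_x α. Zeros of p are handled by replacing 1/|p| with a C¹ function of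
|p|² that agrees with it for |p| ≥ ε; for ε ≤ 1 the modification lives where h' = 0
(`hasDerivAt_contactReg`). Near s = 0 the choice ε = s² recovers the length (`tendsto_contactReg`).
At infinity only uniform convergence of u is known, so the limit is extracted from the mean value
theorem applied to an averaged height function of |p| (`exists_contactReg_near`). The bound by the
action is convexity: A_H(x) = r h'(r) - h(r).

Equality. The Cauchy-Schwarz defects must vanish (`defect_eq_zero`), so ∂_t q and ∂_s q are parallel
to p where p ≠ 0. To exclude sliding of q along itself, u is compared with its rotations in t: an L¹
estimate for the difference of heights, of maximum-principle type, shows that two equality solutions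
with the same r have the same |p| (`N_eq_of_integral_eq`). Hence |p| does not depend on t, so b = 0
and S = 0, q does not depend on s, p is parallel along q, and a = h'(r)|p| (`rigidity`).

Converse. If u lies in the half-cylinder over a closed geodesic of speed ℓ, tangency makes both
defects vanish where p ≠ 0. There a/|p| - ℓ and -b/|p| solve a perturbed Cauchy-Riemann system with
zero boundary values, and a frequency function argument (`cauchyRiemann_unique_continuation`) makes
them vanish. This also prevents p from returning to zero (`N_pos_of_defect`), and comparing the
constant value of a/|p| with its limit at infinity gives ℓ = h'(r) (`deriv_eq_of_defect`). -/

namespace CotangentFloer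

/-! ### Canonical coordinates on the cotangent bundle and derivatives of maps into it. -/

section

open Bundle

variable {n : ℕ} {M : Type*} [TopologicalSpace M] [ChartedSpace (Model n) M]
  [IsManifold (𝓡 n) ∞ M]

/-- The coordinate frame of the preferred chart at `q₀`. -/
def frame (q₀ q : M) : Model n →L[ℝ] TangentSpace (𝓡 n) q :=
  (trivializationAt (Model n) (TangentSpace (𝓡 n)) q₀).symmL ℝ q

/-- The fibre coordinates of a covector in the preferred chart at `q₀`. -/
def fibreCoord (q₀ : M) (z : Cotangent n M) : DualModel n :=
  (show TangentSpace (𝓡 n) z.1 →L[ℝ] ℝ from z.2).comp (frame q₀ z.1)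

theorem frame_self (q₀ : M) (v : Model n) : frame q₀ q₀ v = v := by
  unfold frame
  rw [TangentBundle.symmL_trivializationAt (mem_chart_source _ _),
    mfderivWithin_range_extChartAt_symm]
  rfl

theorem frame_symm (q₀ : M) {y : Model n} (hy : y ∈ (extChartAt (𝓡 n) q₀).target) :
    frame q₀ ((extChartAt (𝓡 n) q₀).symm y) =
      mfderiv 𝓘(ℝ, Model n) (𝓡 n) (extChartAt (𝓡 n) q₀).symm y := by
  unfold frame
  have h : (extChartAt (𝓡 n) q₀).symm y ∈ (chartAt (Model n) q₀).source := by
    have := (extChartAt (𝓡 n) q₀).map_target hy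
    rwa [extChartAt_source] at this
  rw [TangentBundle.symmL_trivializationAt h, (extChartAt (𝓡 n) q₀).right_inv hy]
  rw [ModelWithCorners.range_eq_univ, mfderivWithin_univ]

theorem frame_surjective {q₀ q : M} (hq : q ∈ (chartAt (Model n) q₀).source) :
    Function.Surjective (frame (n := n) q₀ q) := by
  intro v
  have hb : q ∈ (trivializationAt (Model n) (TangentSpace (𝓡 n)) q₀).baseSet := hq
  exact ⟨(trivializationAt (Model n) (TangentSpace (𝓡 n)) q₀).continuousLinearMapAt ℝ q v,
    (trivializationAt (Model n) (TangentSpace (𝓡 n)) q₀).symmL_continuousLinearMapAt hb v⟩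

theorem frame_injective {q₀ q : M} (hq : q ∈ (chartAt (Model n) q₀).source) :
    Function.Injective (frame (n := n) q₀ q) := by
  have hb : q ∈ (trivializationAt (Model n) (TangentSpace (𝓡 n)) q₀).baseSet := hq
  exact Function.LeftInverse.injective
    (g := (trivializationAt (Model n) (TangentSpace (𝓡 n)) q₀).continuousLinearMapAt ℝ q)
    fun v => (trivializationAt (Model n) (TangentSpace (𝓡 n)) q₀).continuousLinearMapAt_symmL hb v

theorem fibreCoord_self (z : Cotangent n M) : fibreCoord z.1 z = z.2 := by
  ext v
  exact congrArg z.2 (frame_self z.1 v)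

/-- The trivialization of the cotangent bundle in terms of `fibreCoord`. -/
theorem inCoordinates_eq_fibreCoord (q₀ : M) (z : Cotangent n M) :
    ContinuousLinearMap.inCoordinates (Model n) (TangentSpace (𝓡 n)) ℝ (Bundle.Trivial M ℝ)
      q₀ z.1 q₀ z.1 z.2 = fibreCoord q₀ z := by
  ext v
  simp [ContinuousLinearMap.inCoordinates, fibreCoord, frame]

/-- Reduces calculus on T^*M to the chart of the base point together with the components of the
covector. -/
theorem extChartAt_cotangent (z₀ z : Cotangent n M) :
    extChartAt (cotModel n) z₀ z = (extChartAt (𝓡 n) z₀.1 z.1, fibreCoord z₀.1 z) := by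
  rw [← inCoordinates_eq_fibreCoord]
  rfl

section Maps

variable {E : Type*} [NormedAddCommGroup E] [NormedSpace ℝ E]

theorem contMDiffWithinAt_cotangent_iff {k : WithTop ℕ∞} {c : E → Cotangent n M} {s : Set E} {x₀ : E} :
    ContMDiffWithinAt 𝓘(ℝ, E) (cotModel n) k c s x₀ ↔
      ContMDiffWithinAt 𝓘(ℝ, E) (𝓡 n) k (fun x => (c x).1) s x₀ ∧
        ContDiffWithinAt ℝ k (fun x => fibreCoord (c x₀).1 (c x)) s x₀ := by
  rw [contMDiffWithinAt_hom_bundle, ← contMDiffWithinAt_iff_contDiffWithinAt]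
  simp only [inCoordinates_eq_fibreCoord]

theorem contDiffWithinAt_extChartAt_comp {k : WithTop ℕ∞} (hk : k ≤ ∞) {c : E → M} {s : Set E} {x₀ : E} {q₀ : M}
    (h : c x₀ ∈ (chartAt (Model n) q₀).source)
    (hc : ContMDiffWithinAt 𝓘(ℝ, E) (𝓡 n) k c s x₀) :
    ContDiffWithinAt ℝ k (fun x => extChartAt (𝓡 n) q₀ (c x)) s x₀ := by
  rw [← contMDiffWithinAt_iff_contDiffWithinAt]
  have h1 : ContMDiffAt (𝓡 n) 𝓘(ℝ, Model n) ∞ (extChartAt (𝓡 n) q₀) (c x₀) :=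
    contMDiffAt_extChartAt' h
  exact (h1.of_le hk).comp_contMDiffWithinAt x₀ hc

/-- The velocity of a map into `M`, in the frame of a chart. -/
theorem mfderivWithin_base {c : E → M} {s : Set E} {x : E} {q₀ : M}
    (h : c x ∈ (chartAt (Model n) q₀).source)
    (hc : MDifferentiableWithinAt 𝓘(ℝ, E) (𝓡 n) c s x) (hs : UniqueDiffWithinAt ℝ s x) (v : E) :
    mfderivWithin 𝓘(ℝ, E) (𝓡 n) c s x v =
      frame q₀ (c x) (fderivWithin ℝ (fun x => extChartAt (𝓡 n) q₀ (c x)) s x v) := by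
  have h1 : MDifferentiableAt (𝓡 n) 𝓘(ℝ, Model n) (extChartAt (𝓡 n) q₀) (c x) :=
    mdifferentiableAt_extChartAt h
  have h2 : fderivWithin ℝ (fun x => extChartAt (𝓡 n) q₀ (c x)) s x =
      (mfderiv (𝓡 n) 𝓘(ℝ, Model n) (extChartAt (𝓡 n) q₀) (c x)).comp
        (mfderivWithin 𝓘(ℝ, E) (𝓡 n) c s x) := by
    rw [← mfderivWithin_eq_fderivWithin]
    exact mfderiv_comp_mfderivWithin x h1 hc hs.uniqueMDiffWithinAt
  have h3 := mfderivWithin_extChartAt_symm_comp_mfderiv_extChartAt' (I := 𝓡 n) (x := q₀)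
    (y := c x) (by rwa [extChartAt_source])
  unfold frame
  rw [TangentBundle.symmL_trivializationAt h, h2]
  exact (DFunLike.congr_fun h3 (mfderivWithin 𝓘(ℝ, E) (𝓡 n) c s x v)).symm

theorem mdifferentiableWithinAt_cotangent_iff {c : E → Cotangent n M} {s : Set E} {x₀ : E} :
    MDifferentiableWithinAt 𝓘(ℝ, E) (cotModel n) c s x₀ ↔
      MDifferentiableWithinAt 𝓘(ℝ, E) (𝓡 n) (fun x => (c x).1) s x₀ ∧
        DifferentiableWithinAt ℝ (fun x => fibreCoord (c x₀).1 (c x)) s x₀ := by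
  rw [mdifferentiableWithinAt_hom_bundle, ← mdifferentiableWithinAt_iff_differentiableWithinAt]
  simp only [inCoordinates_eq_fibreCoord]

theorem differentiableWithinAt_extChartAt_comp {c : E → M} {s : Set E} {x₀ : E} {q₀ : M}
    (h : c x₀ ∈ (chartAt (Model n) q₀).source)
    (hc : MDifferentiableWithinAt 𝓘(ℝ, E) (𝓡 n) c s x₀) :
    DifferentiableWithinAt ℝ (fun x => extChartAt (𝓡 n) q₀ (c x)) s x₀ := by
  rw [← mdifferentiableWithinAt_iff_differentiableWithinAt]
  have h1 : MDifferentiableAt (𝓡 n) 𝓘(ℝ, Model n) (extChartAt (𝓡 n) q₀) (c x₀) :=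
    mdifferentiableAt_extChartAt h
  exact h1.comp_mdifferentiableWithinAt x₀ hc

/-- Tangent vectors at c(x) are read in the preferred chart at c(x), so no coordinate change enters:
both components are plain derivatives. -/
theorem mfderivWithin_cotangent {c : E → Cotangent n M} {s : Set E} {x : E}
    (hc : MDifferentiableWithinAt 𝓘(ℝ, E) (cotModel n) c s x) (hs : UniqueDiffWithinAt ℝ s x) (v : E) :
    mfderivWithin 𝓘(ℝ, E) (cotModel n) c s x v =
      mkTangent (c x) (fderivWithin ℝ (fun x' => extChartAt (𝓡 n) (c x).1 (c x').1) s x v)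
        (fderivWithin ℝ (fun x' => fibreCoord (c x).1 (c x')) s x v) := by
  obtain ⟨h1, h2⟩ := mdifferentiableWithinAt_cotangent_iff.1 hc
  have h3 := differentiableWithinAt_extChartAt_comp (c := fun x => (c x).1)
    (mem_chart_source (Model n) (c x).1) h1
  have h4 : mfderivWithin 𝓘(ℝ, E) (cotModel n) c s x =
      fderivWithin ℝ (fun x' => (extChartAt (𝓡 n) (c x).1 (c x').1, fibreCoord (c x).1 (c x')))
        s x := by
    refine hc.mfderivWithin.trans ?_
    have : writtenInExtChartAt 𝓘(ℝ, E) (cotModel n) x c =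
        fun x' => (extChartAt (𝓡 n) (c x).1 (c x').1, fibreCoord (c x).1 (c x')) := by
      funext x'
      simp only [writtenInExtChartAt, Function.comp_apply]
      rw [extChartAt_cotangent]
      rfl
    rw [this, extChartAt_model_space_eq_id]
    simp only [PartialEquiv.refl_symm, PartialEquiv.refl_coe, preimage_id,
      ModelWithCorners.range_eq_univ, inter_univ, id_eq]
    rfl
  rw [h4, DifferentiableWithinAt.fderivWithin_prodMk h3 h2 hs]
  rfl

end Maps

end

/-! ### Musical isomorphisms and the metric in a chart. -/

section

open Bundle

section Musical

variable {n : ℕ} {M : Type*} [TopologicalSpace M] [ChartedSpace (Model n) M]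
  [RiemannianBundle (fun q : M => TangentSpace (𝓡 n) q)]

instance (q : M) : FiniteDimensional ℝ (TangentSpace (𝓡 n) q) :=
  inferInstanceAs (FiniteDimensional ℝ (Model n))

instance (q : M) : CompleteSpace (TangentSpace (𝓡 n) q) := FiniteDimensional.complete ℝ _

theorem flat_apply {q : M} (v w : TangentSpace (𝓡 n) q) : flat v w = inner ℝ v w := rfl

theorem inner_sharp {q : M} (p : TangentSpace (𝓡 n) q →L[ℝ] ℝ) (v : TangentSpace (𝓡 n) q) :
    inner ℝ (sharp p) v = p v := InnerProductSpace.toDual_symm_apply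

theorem flat_sharp {q : M} (p : TangentSpace (𝓡 n) q →L[ℝ] ℝ) : flat (sharp p) = p := by
  ext v
  exact inner_sharp p v

theorem sharp_flat {q : M} (v : TangentSpace (𝓡 n) q) : sharp (flat v) = v :=
  (InnerProductSpace.toDual ℝ (TangentSpace (𝓡 n) q)).symm_apply_apply v

theorem norm_sharp {q : M} (p : TangentSpace (𝓡 n) q →L[ℝ] ℝ) : ‖sharp p‖ = ‖p‖ :=
  (InnerProductSpace.toDual ℝ (TangentSpace (𝓡 n) q)).symm.norm_map p

theorem sharp_smul {q : M} (c : ℝ) (p : TangentSpace (𝓡 n) q →L[ℝ] ℝ) :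
    sharp (c • p) = c • sharp p :=
  (InnerProductSpace.toDual ℝ (TangentSpace (𝓡 n) q)).symm.map_smul c p

end Musical

variable {n : ℕ} {M : Type*} [TopologicalSpace M] [ChartedSpace (Model n) M]
  [IsManifold (𝓡 n) ∞ M]
  [RiemannianBundle (fun q : M => TangentSpace (𝓡 n) q)]

theorem chartMetric_apply {q₀ q : M} (hq : q ∈ (chartAt (Model n) q₀).source) (v w : Model n) :
    chartMetric q₀ (extChartAt (𝓡 n) q₀ q) v w = inner ℝ (frame q₀ q v) (frame q₀ q w) := by
  obtain ⟨y, hy, rfl⟩ : ∃ y ∈ (extChartAt (𝓡 n) q₀).target, q = (extChartAt (𝓡 n) q₀).symm y := by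
    rw [← extChartAt_source (𝓡 n)] at hq
    exact ⟨_, (extChartAt (𝓡 n) q₀).map_source hq, ((extChartAt (𝓡 n) q₀).left_inv hq).symm⟩
  rw [(extChartAt (𝓡 n) q₀).right_inv hy, frame_symm q₀ hy]
  rfl

variable [IsContMDiffRiemannianBundle (𝓡 n) ∞ (Model n) (fun q : M => TangentSpace (𝓡 n) q)]

theorem contDiffOn_chartMetric (q₀ : M) :
    ContDiffOn ℝ ∞ (chartMetric q₀) (extChartAt (𝓡 n) q₀).target := by
  have key : ∀ v : Model n, ContMDiffOn 𝓘(ℝ, Model n) ((𝓡 n).prod 𝓘(ℝ, Model n)) ∞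
      (fun y => (⟨(extChartAt (𝓡 n) q₀).symm y, frame q₀ ((extChartAt (𝓡 n) q₀).symm y) v⟩ :
        TotalSpace (Model n) (fun q : M => TangentSpace (𝓡 n) q)))
        (extChartAt (𝓡 n) q₀).target := by
    intro v
    have hsrc : ∀ y ∈ (extChartAt (𝓡 n) q₀).target, (extChartAt (𝓡 n) q₀).symm y ∈
        (trivializationAt (Model n) (TangentSpace (𝓡 n)) q₀).baseSet := fun y hy => by
      have := (extChartAt (𝓡 n) q₀).map_target hy
      rwa [extChartAt_source] at this
    have h1 : ContMDiffOn 𝓘(ℝ, Model n) ((𝓡 n).prod 𝓘(ℝ, Model n)) ∞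
        (fun y => ((extChartAt (𝓡 n) q₀).symm y, v)) (extChartAt (𝓡 n) q₀).target :=
      (contMDiffOn_extChartAt_symm q₀).prodMk contMDiffOn_const
    refine ((Trivialization.contMDiffOn_symm (IB := 𝓡 n) (n := ∞)
      (trivializationAt (Model n) (TangentSpace (𝓡 n)) q₀)).comp h1 ?_).congr ?_
    · intro y hy
      rw [mem_preimage, Trivialization.mem_target]
      exact hsrc y hy
    · intro y hy
      rw [frame, Trivialization.symmL_apply _ (hsrc y hy)]
      exact Trivialization.mk_symm _ (hsrc y hy) v
  rw [contDiffOn_clm_apply]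
  intro v
  rw [contDiffOn_clm_apply]
  intro w
  rw [← contMDiffOn_iff_contDiffOn]
  refine (ContMDiffOn.inner_bundle (key v) (key w)).congr ?_
  intro y hy
  rw [frame_symm q₀ hy]
  rfl

end

section

open Bundle

variable {n : ℕ} {M : Type*} [TopologicalSpace M] [ChartedSpace (Model n) M]
  [IsManifold (𝓡 n) ∞ M]
  [RiemannianBundle (fun q : M => TangentSpace (𝓡 n) q)]


/-- Positive definiteness gives injectivity, and the model space and its dual have equal dimension.
-/
theorem isInvertible_chartMetric {q₀ q : M} (hq : q ∈ (chartAt (Model n) q₀).source) :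
    (chartMetric q₀ (extChartAt (𝓡 n) q₀ q)).IsInvertible := by
  have hinj : Function.Injective (chartMetric q₀ (extChartAt (𝓡 n) q₀ q)) := by
    rw [injective_iff_map_eq_zero]
    intro v hv
    have h1 : chartMetric q₀ (extChartAt (𝓡 n) q₀ q) v v = 0 := by rw [hv]; rfl
    rw [chartMetric_apply hq, inner_self_eq_zero] at h1
    exact frame_injective hq (h1.trans (map_zero _).symm)
  have hdim : Module.finrank ℝ (Model n) = Module.finrank ℝ (DualModel n) := by
    rw [← (LinearMap.toContinuousLinearMap (𝕜 := ℝ) (E := Model n) (F' := ℝ)).finrank_eq]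
    exact (Subspace.dual_finrank_eq (K := ℝ) (V := Model n)).symm
  exact ⟨(LinearEquiv.ofInjectiveOfFinrankEq (chartMetric q₀ (extChartAt (𝓡 n) q₀ q)).toLinearMap
    hinj hdim).toContinuousLinearEquiv, rfl⟩

/-- The inverse of the metric in a chart raises indices. -/
theorem frame_inverse_chartMetric {q₀ : M} {z : Cotangent n M}
    (hq : z.1 ∈ (chartAt (Model n) q₀).source) :
    frame q₀ z.1 ((chartMetric q₀ (extChartAt (𝓡 n) q₀ z.1)).inverse (fibreCoord q₀ z)) =
      sharp z.2 := by
  set G := chartMetric q₀ (extChartAt (𝓡 n) q₀ z.1) with hG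
  have h1 : G (G.inverse (fibreCoord q₀ z)) = fibreCoord q₀ z :=
    (isInvertible_chartMetric hq).self_apply_inverse _
  refine ext_inner_right ℝ fun w => ?_
  obtain ⟨w, rfl⟩ := frame_surjective hq w
  rw [← chartMetric_apply hq, ← hG, h1]
  exact (inner_sharp z.2 _).symm

/-- The coordinate formula η(g⁻¹η) for |p|², through which its smoothness and differential are
obtained. -/
theorem normSq_eq {q₀ : M} {z : Cotangent n M} (hq : z.1 ∈ (chartAt (Model n) q₀).source) :
    ‖z.2‖ ^ 2 = fibreCoord q₀ z
      ((chartMetric q₀ (extChartAt (𝓡 n) q₀ z.1)).inverse (fibreCoord q₀ z)) := by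
  have h1 : ‖z.2‖ = ‖sharp z.2‖ := (norm_sharp z.2).symm
  rw [h1, ← real_inner_self_eq_norm_sq]
  refine (inner_sharp z.2 _).trans ?_
  exact congrArg z.2 (frame_inverse_chartMetric hq).symm

variable [IsContMDiffRiemannianBundle (𝓡 n) ∞ (Model n) (fun q : M => TangentSpace (𝓡 n) q)]

theorem contDiffAt_chartMetric {q₀ q : M} (hq : q ∈ (chartAt (Model n) q₀).source) :
    ContDiffAt ℝ ∞ (chartMetric q₀) (extChartAt (𝓡 n) q₀ q) :=
  (contDiffOn_chartMetric q₀).contDiffAt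
    ((isOpen_extChartAt_target q₀).mem_nhds
      ((extChartAt (𝓡 n) q₀).map_source (by rwa [extChartAt_source])))

end

/-! ### The Levi-Civita connection and the differential of |p|². -/

section

section Coordinates

variable {n : ℕ}

theorem christoffelFirst_apply (g : Model n → Model n →L[ℝ] Model n →L[ℝ] ℝ) (y P a w : Model n) :
    christoffelFirst g y P a w =
      1 / 2 * (fderiv ℝ g y a w P + fderiv ℝ g y w a P - fderiv ℝ g y P a w) := rfl

theorem fderiv_apply_apply {g : Model n → Model n →L[ℝ] Model n →L[ℝ] ℝ} {y : Model n}
    (hg : DifferentiableAt ℝ g y) (v w : Model n) :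
    HasFDerivAt (fun y => g y v w) (((fderiv ℝ g y).flip v).flip w) y := by
  have h1 := hg.hasFDerivAt.clm_apply (hasFDerivAt_const v y)
  have h2 := h1.clm_apply (hasFDerivAt_const w y)
  simp only [ContinuousLinearMap.comp_zero, zero_add] at h2
  exact h2

/-- The first two terms of the symbol are exchanged; only ∂_P g(v, w) needs the symmetry of g. -/
theorem christoffelFirst_symm {g : Model n → Model n →L[ℝ] Model n →L[ℝ] ℝ} {y : Model n}
    (hg : DifferentiableAt ℝ g y) (hs : ∀ y v w, g y v w = g y w v) (P v w : Model n) :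
    christoffelFirst g y P v w = christoffelFirst g y P w v := by
  have h1 := fderiv_apply_apply hg v w
  simp_rw [fun y => hs y v w] at h1
  have h2 : fderiv ℝ g y P v w = fderiv ℝ g y P w v :=
    DFunLike.congr_fun (h1.unique (fderiv_apply_apply hg w v)) P
  rw [christoffelFirst_apply, christoffelFirst_apply, h2]
  ring

/-- The differential at `(y, η)`, with `P = η^♯`, of the squared norm of covectors. -/
def normSqCoordDeriv (g : Model n → Model n →L[ℝ] Model n →L[ℝ] ℝ) (y P : Model n) :
    Model n × DualModel n →L[ℝ] ℝ :=
  (2 : ℝ) • ((ContinuousLinearMap.apply ℝ ℝ P).comp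
      (ContinuousLinearMap.snd ℝ (Model n) (DualModel n))) -
    (((fderiv ℝ g y).flip P).flip P).comp (ContinuousLinearMap.fst ℝ (Model n) (DualModel n))

/-- Metric compatibility: evaluated on P, the symbol [V P, P] collapses to ½ ∂_V g(P, P). -/
theorem normSqCoordDeriv_apply (g : Model n → Model n →L[ℝ] Model n →L[ℝ] ℝ) (y P : Model n)
    (V : Model n × DualModel n) :
    normSqCoordDeriv g y P V = 2 * (V.2 - christoffelFirst g y P V.1) P := by
  have h : (V.2 - christoffelFirst g y P V.1) P = V.2 P - christoffelFirst g y P V.1 P := rfl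
  have h' : normSqCoordDeriv g y P V = 2 * V.2 P - fderiv ℝ g y V.1 P P := rfl
  rw [h, h', christoffelFirst_apply]
  ring

theorem contDiffAt_dualNormSq {g : Model n → Model n →L[ℝ] Model n →L[ℝ] ℝ} {y₀ : Model n}
    (hg : ContDiffAt ℝ ∞ g y₀) (hi : (g y₀).IsInvertible) (η : DualModel n) :
    ContDiffAt ℝ ∞ (fun w : Model n × DualModel n => w.2 ((g w.1).inverse w.2)) (y₀, η) := by
  obtain ⟨e, he⟩ := hi
  have h1 : ContDiffAt ℝ ∞ ContinuousLinearMap.inverse (g y₀) := by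
    rw [← he]
    exact contDiffAt_map_inverse e
  have h2 : ContDiffAt ℝ ∞ (fun w : Model n × DualModel n => (g w.1).inverse) (y₀, η) :=
    ContDiffAt.comp (y₀, η) (ContDiffAt.comp y₀ h1 hg) contDiffAt_fst
  exact contDiffAt_snd.clm_apply (h2.clm_apply contDiffAt_snd)

/-- An envelope argument that avoids differentiating g⁻¹: η(g⁻¹η) is the maximum over P of 2η(P) -
g(P, P). With P frozen at the maximizer of the base point, the difference of the two functions has a
local minimum there, so their differentials agree. -/
theorem hasFDerivAt_dualNormSq {g : Model n → Model n →L[ℝ] Model n →L[ℝ] ℝ} {y₀ : Model n}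
    (hg : ContDiffAt ℝ ∞ g y₀) (hs : ∀ y v w, g y v w = g y w v)
    (hi : ∀ᶠ y in 𝓝 y₀, (g y).IsInvertible) (hpos : ∀ y v, 0 ≤ g y v v) (η : DualModel n) :
    HasFDerivAt (fun w : Model n × DualModel n => w.2 ((g w.1).inverse w.2))
      (normSqCoordDeriv g y₀ ((g y₀).inverse η)) (y₀, η) := by
  set P := (g y₀).inverse η with hP
  set F : Model n × DualModel n → ℝ := fun w => w.2 ((g w.1).inverse w.2) with hF
  have hFd : DifferentiableAt ℝ F (y₀, η) :=
    (contDiffAt_dualNormSq hg hi.self_of_nhds η).differentiableAt (by simp)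
  have hG : HasFDerivAt (fun w : Model n × DualModel n => 2 * w.2 P - g w.1 P P)
      (normSqCoordDeriv g y₀ P) (y₀, η) := by
    have h1 : HasFDerivAt (fun w : Model n × DualModel n => w.2 P)
        ((ContinuousLinearMap.apply ℝ ℝ P).comp
          (ContinuousLinearMap.snd ℝ (Model n) (DualModel n))) (y₀, η) :=
      ((ContinuousLinearMap.apply ℝ ℝ P).comp
          (ContinuousLinearMap.snd ℝ (Model n) (DualModel n))).hasFDerivAt
    have h2 : HasFDerivAt (fun y => g y P P) (((fderiv ℝ g y₀).flip P).flip P) (y₀, η).1 :=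
      fderiv_apply_apply (hg.differentiableAt (by simp)) P P
    have h3 := h2.comp (y₀, η) (hasFDerivAt_fst (𝕜 := ℝ) (E := Model n) (F := DualModel n))
    exact (h1.const_mul 2).sub h3
  have key : ∀ w : Model n × DualModel n, (g w.1).IsInvertible →
      F w - (2 * w.2 P - g w.1 P P) =
        g w.1 ((g w.1).inverse w.2 - P) ((g w.1).inverse w.2 - P) := by
    intro w hw
    have h1 : g w.1 ((g w.1).inverse w.2) = w.2 := hw.self_apply_inverse _
    have h3 := hs w.1 P ((g w.1).inverse w.2)
    simp only [map_sub, sub_apply, h1] at h3 ⊢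
    rw [h3]
    ring
  have hmin : IsLocalMin (fun w => F w - (2 * w.2 P - g w.1 P P)) (y₀, η) := by
    filter_upwards [continuousAt_fst.eventually hi] with w hw
    rw [key w hw, key (y₀, η) hi.self_of_nhds]
    rw [← hP, sub_self, map_zero]
    exact hpos _ _
  have := hmin.hasFDerivAt_eq_zero (hFd.hasFDerivAt.sub hG)
  rw [sub_eq_zero] at this
  rw [← this]
  exact hFd.hasFDerivAt

end Coordinates

open Bundle

variable {n : ℕ} {M : Type*} [TopologicalSpace M] [ChartedSpace (Model n) M]
  [IsManifold (𝓡 n) ∞ M]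
  [RiemannianBundle (fun q : M => TangentSpace (𝓡 n) q)]

theorem chartMetric_symm (q₀ : M) (y v w : Model n) : chartMetric q₀ y v w = chartMetric q₀ y w v :=
  real_inner_comm (F := TangentSpace (𝓡 n) ((extChartAt (𝓡 n) q₀).symm y)) _ _

theorem chartMetric_nonneg (q₀ : M) (y v : Model n) : 0 ≤ chartMetric q₀ y v v :=
  real_inner_self_nonneg (F := TangentSpace (𝓡 n) ((extChartAt (𝓡 n) q₀).symm y))

theorem eventually_isInvertible_chartMetric (q : M) :
    ∀ᶠ y in 𝓝 (extChartAt (𝓡 n) q q), (chartMetric q y).IsInvertible := by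
  filter_upwards [(isOpen_extChartAt_target (I := 𝓡 n) q).mem_nhds (mem_extChartAt_target q)]
    with y hy
  have h1 := (extChartAt (𝓡 n) q).map_target hy
  rw [extChartAt_source] at h1
  have h2 := isInvertible_chartMetric (n := n) h1
  rwa [(extChartAt (𝓡 n) q).right_inv hy] at h2

theorem inverse_chartMetric_self (z : Cotangent n M) :
    (chartMetric z.1 (extChartAt (𝓡 n) z.1 z.1)).inverse (fibreCoord z.1 z) = sharp z.2 :=
  (frame_self z.1 _).symm.trans (frame_inverse_chartMetric (mem_chart_source _ _))

theorem eventually_mem_chart_source (z : Cotangent n M) :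
    ∀ᶠ w : Cotangent n M in 𝓝 z, w.1 ∈ (chartAt (Model n) z.1).source :=
  (FiberBundle.continuous_proj _ _).continuousAt.eventually (chart_source_mem_nhds _ _)

/-- The differential of `(q, p) ↦ |p|²` on `T^*M`. -/
def normSqDeriv (z : Cotangent n M) : Model n × DualModel n →L[ℝ] ℝ :=
  normSqCoordDeriv (chartMetric z.1) (extChartAt (𝓡 n) z.1 z.1) (sharp z.2)

theorem normSqDeriv_apply (z : Cotangent n M) (V : TangentSpace (cotModel n) z) :
    normSqDeriv z V = 2 * connector V (sharp z.2) :=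
  normSqCoordDeriv_apply _ _ _ _

variable [IsContMDiffRiemannianBundle (𝓡 n) ∞ (Model n) (fun q : M => TangentSpace (𝓡 n) q)]

/-- The Levi-Civita connection is torsion free. -/
theorem christoffelCovector_symm (z : Cotangent n M) (v w : TangentSpace (𝓡 n) z.1) :
    christoffelCovector z v w = christoffelCovector z w v :=
  christoffelFirst_symm
    ((contDiffAt_chartMetric (mem_chart_source (Model n) z.1)).differentiableAt (by simp))
    (chartMetric_symm z.1) _ _ _

/-- The function `|p|²` on `T^*M` is differentiable. -/
theorem hasMFDerivAt_normSq (z : Cotangent n M) :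
    HasMFDerivAt (cotModel n) 𝓘(ℝ, ℝ) (fun w : Cotangent n M => ‖w.2‖ ^ 2) z (normSqDeriv z) := by
  have h1 : HasMFDerivAt (cotModel n) 𝓘(ℝ, Model n × DualModel n) (extChartAt (cotModel n) z) z
      (ContinuousLinearMap.id ℝ (Model n × DualModel n)) := by
    have := (mdifferentiableAt_extChartAt (I := cotModel n) (mem_chart_source _ z)).hasMFDerivAt
    rwa [mfderiv_extChartAt_self] at this
  have h2 := (hasFDerivAt_dualNormSq (contDiffAt_chartMetric (mem_chart_source (Model n) z.1))
    (chartMetric_symm z.1) (eventually_isInvertible_chartMetric z.1) (chartMetric_nonneg z.1)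
    (fibreCoord z.1 z)).hasMFDerivAt
  rw [← extChartAt_cotangent, inverse_chartMetric_self] at h2
  refine (HasMFDerivAt.comp z h2 h1).congr_of_eventuallyEq ?_
  filter_upwards [eventually_mem_chart_source z] with w hw
  rw [normSq_eq hw, Function.comp_apply, extChartAt_cotangent]

theorem contMDiff_normSq :
    ContMDiff (cotModel n) 𝓘(ℝ, ℝ) ∞ (fun w : Cotangent n M => ‖w.2‖ ^ 2) := by
  intro z
  have h1 : ContMDiffAt (cotModel n) 𝓘(ℝ, Model n × DualModel n) ∞ (extChartAt (cotModel n) z) z :=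
    contMDiffAt_extChartAt
  have hz := mem_chart_source (Model n) z.1
  have h2 := contDiffAt_dualNormSq (contDiffAt_chartMetric hz) (isInvertible_chartMetric hz)
    (fibreCoord z.1 z)
  rw [← extChartAt_cotangent] at h2
  refine (h2.contMDiffAt.comp z h1).congr_of_eventuallyEq ?_
  filter_upwards [eventually_mem_chart_source z] with w hw
  rw [normSq_eq hw, Function.comp_apply, extChartAt_cotangent]

end

/-! ### The Hamiltonian vector field of h(|p|). -/

section

section Profile

theorem IsLinearProfile.hasDerivAt {μ δ : ℝ} {h : ℝ → ℝ} (hh : IsLinearProfile μ δ h) {r : ℝ}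
    (hr : 0 < r) : HasDerivAt h (deriv h r) r :=
  ((hh.smooth.contDiffAt (Ici_mem_nhds hr)).differentiableAt (by simp)).hasDerivAt

/-- As a function of |p|² the Hamiltonian is differentiable across the zero section, because h
vanishes on [0, 1]. At y = 0 the quotient in the statement is 0 by the convention for division by
zero, which is the correct value. -/
theorem IsLinearProfile.hasDerivAt_comp_sqrt {μ δ : ℝ} {h : ℝ → ℝ} (hh : IsLinearProfile μ δ h)
    {y : ℝ} (hy : 0 ≤ y) :
    HasDerivAt (fun y => h √y) (deriv h √y / √y / 2) y := by
  rcases hy.eq_or_lt with rfl | hy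
  · have h1 : (fun y => h √y) =ᶠ[𝓝 0] fun _ => 0 := by
      filter_upwards [Iio_mem_nhds one_pos] with y hy
      exact hh.eq_zero _ (Real.sqrt_nonneg y) (Real.sqrt_le_one.2 (le_of_lt hy))
    simpa using (hasDerivAt_const (0 : ℝ) (0 : ℝ)).congr_of_eventuallyEq h1
  · have h2 := (hh.hasDerivAt (Real.sqrt_pos.2 hy)).comp y (Real.hasDerivAt_sqrt hy.ne')
    refine h2.congr_deriv ?_
    field_simp

end Profile

section Coordinates

variable {n : ℕ}

theorem christoffelFirst_smul (g : Model n → Model n →L[ℝ] Model n →L[ℝ] ℝ) (y P a : Model n)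
    (c : ℝ) : christoffelFirst g y P (c • a) = c • christoffelFirst g y P a := by
  ext w
  have h : (c • christoffelFirst g y P a) w = c * christoffelFirst g y P a w := rfl
  rw [h, christoffelFirst_apply, christoffelFirst_apply]
  simp only [map_smul, smul_apply, smul_eq_mul]
  ring

theorem christoffelFirst_add (g : Model n → Model n →L[ℝ] Model n →L[ℝ] ℝ) (y P a b : Model n) :
    christoffelFirst g y P (a + b) = christoffelFirst g y P a + christoffelFirst g y P b := by
  ext w
  have h : (christoffelFirst g y P a + christoffelFirst g y P b) w =
    christoffelFirst g y P a w + christoffelFirst g y P b w := rfl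
  rw [h, christoffelFirst_apply, christoffelFirst_apply, christoffelFirst_apply]
  simp only [map_add, add_apply]
  ring

theorem christoffelFirst_smul_left (g : Model n → Model n →L[ℝ] Model n →L[ℝ] ℝ) (y P a : Model n)
    (c : ℝ) : christoffelFirst g y (c • P) a = c • christoffelFirst g y P a := by
  ext w
  have h : (c • christoffelFirst g y P a) w = c * christoffelFirst g y P a w := rfl
  rw [h, christoffelFirst_apply, christoffelFirst_apply]
  simp only [map_smul, smul_apply, smul_eq_mul]
  ring

theorem sum_apply_proj (P : Model n) :
    ∑ i, (EuclideanSpace.proj i : DualModel n) P • EuclideanSpace.single i (1 : ℝ) = P := by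
  ext j
  simp [Pi.single_apply]

end Coordinates

open Bundle

variable {n : ℕ} {M : Type*} [TopologicalSpace M] [ChartedSpace (Model n) M]
  [IsManifold (𝓡 n) ∞ M]
  [RiemannianBundle (fun q : M => TangentSpace (𝓡 n) q)]


theorem connector_smul {z : Cotangent n M} (c : ℝ) (V : TangentSpace (cotModel n) z) :
    connector (c • V) = c • connector V := by
  have h := christoffelFirst_smul (chartMetric z.1) (extChartAt (𝓡 n) z.1 z.1) (sharp z.2) (qPart V) c
  have h1 : connector (c • V) = c • pPart V - christoffelCovector z (c • qPart V) := rfl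
  have h2 : christoffelCovector z (c • qPart V) = c • christoffelCovector z (qPart V) := h
  rw [h1, h2, connector, smul_sub]

theorem connector_add {z : Cotangent n M} (V W : TangentSpace (cotModel n) z) :
    connector (V + W) = connector V + connector W := by
  have h := christoffelFirst_add (chartMetric z.1) (extChartAt (𝓡 n) z.1 z.1) (sharp z.2)
    (qPart V) (qPart W)
  have h1 : connector (V + W) = pPart V + pPart W - christoffelCovector z (qPart V + qPart W) := rfl
  have h2 : christoffelCovector z (qPart V + qPart W) =
    christoffelCovector z (qPart V) + christoffelCovector z (qPart W) := h
  rw [h1, h2, connector, connector]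
  abel

theorem qPart_horizontalVertical (z : Cotangent n M) (a : TangentSpace (𝓡 n) z.1)
    (b : TangentSpace (𝓡 n) z.1 →L[ℝ] ℝ) : qPart (horizontalVertical z a b) = a := rfl

theorem connector_horizontalVertical (z : Cotangent n M) (a : TangentSpace (𝓡 n) z.1)
    (b : TangentSpace (𝓡 n) z.1 →L[ℝ] ℝ) : connector (horizontalVertical z a b) = b := by
  have : connector (horizontalVertical z a b) =
    b + christoffelCovector z a - christoffelCovector z a := rfl
  rw [this, add_sub_cancel_right]

variable [IsContMDiffRiemannianBundle (𝓡 n) ∞ (Model n) (fun q : M => TangentSpace (𝓡 n) q)]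

section Hamiltonian

variable {μ δ : ℝ} {h : ℝ → ℝ}

theorem mfderiv_radialHamiltonian (hh : IsLinearProfile μ δ h) (z : Cotangent n M) :
    mfderiv (cotModel n) 𝓘(ℝ, ℝ) (radialHamiltonian h) z =
      (deriv h ‖z.2‖ / ‖z.2‖ / 2) • normSqDeriv z := by
  have h0 := hh.hasDerivAt_comp_sqrt (sq_nonneg ‖z.2‖)
  rw [Real.sqrt_sq (norm_nonneg z.2)] at h0
  have h1 := h0.hasFDerivAt.hasMFDerivAt
  have h2 := HasMFDerivAt.comp z h1 (hasMFDerivAt_normSq z)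
  have h3 : (fun y => h √y) ∘ (fun w : Cotangent n M => ‖w.2‖ ^ 2) = radialHamiltonian h := by
    funext w
    exact congrArg h (Real.sqrt_sq (norm_nonneg w.2))
  rw [h3] at h2
  rw [h2.mfderiv]
  refine ContinuousLinearMap.ext fun V => ?_
  exact mul_comm (normSqDeriv z V) (deriv h ‖z.2‖ / ‖z.2‖ / 2)

theorem qPart_hamiltonianVectorField (hh : IsLinearProfile μ δ h) (z : Cotangent n M) :
    qPart (hamiltonianVectorField (radialHamiltonian h) z) =
      (deriv h ‖z.2‖ / ‖z.2‖) • sharp z.2 := by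
  set k := deriv h ‖z.2‖ / ‖z.2‖ with hk
  have h1 : ∀ b : DualModel n, ((k / 2) • normSqDeriv z) ((0 : Model n), b) = k * b (sharp z.2) := by
    intro b
    have h2 := normSqCoordDeriv_apply (chartMetric z.1) (extChartAt (𝓡 n) z.1 z.1) (sharp z.2) (0, b)
    have h3 := christoffelFirst_smul (chartMetric z.1) (extChartAt (𝓡 n) z.1 z.1) (sharp z.2) 0 0
    rw [smul_zero, zero_smul] at h3
    rw [h3, sub_zero] at h2
    have h4 : ((k / 2) • normSqDeriv z) ((0 : Model n), b) = k / 2 * (2 * b (sharp z.2)) := by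
      rw [← h2]; rfl
    rw [h4]; ring
  have h5 : qPart (hamiltonianVectorField (radialHamiltonian h) z) =
      (∑ i, (k * (EuclideanSpace.proj i : DualModel n) (sharp z.2)) •
        EuclideanSpace.single i (1 : ℝ) : Model n) := by
    have : qPart (hamiltonianVectorField (radialHamiltonian h) z) =
      (∑ i, (show Model n × DualModel n →L[ℝ] ℝ from
        mfderiv (cotModel n) 𝓘(ℝ, ℝ) (radialHamiltonian h) z) (0, EuclideanSpace.proj i) •
        EuclideanSpace.single i (1 : ℝ) : Model n) := rfl
    rw [this, mfderiv_radialHamiltonian hh]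
    exact Finset.sum_congr rfl fun i _ => congrArg (· • _) (h1 _)
  rw [h5]
  simp_rw [mul_smul]
  rw [← Finset.smul_sum]
  exact congrArg (k • ·) (sum_apply_proj _)

/-- The function |p| is invariant under parallel transport, so dH annihilates horizontal vectors. In
coordinates, -∂H/∂q and the connection term of the ∂/∂q component cancel because the connection is
torsion free. -/
theorem connector_hamiltonianVectorField (hh : IsLinearProfile μ δ h) (z : Cotangent n M) :
    connector (hamiltonianVectorField (radialHamiltonian h) z) = 0 := by
  set k := deriv h ‖z.2‖ / ‖z.2‖ with hk
  ext w
  have h1 : pPart (hamiltonianVectorField (radialHamiltonian h) z) w =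
      - (show Model n × DualModel n →L[ℝ] ℝ from
        mfderiv (cotModel n) 𝓘(ℝ, ℝ) (radialHamiltonian h) z) (w, 0) := rfl
  have h2 : ((k / 2) • normSqDeriv z) ((w : Model n), (0 : DualModel n)) =
      - (k * christoffelCovector z w (sharp z.2)) := by
    have h3 := normSqCoordDeriv_apply (chartMetric z.1) (extChartAt (𝓡 n) z.1 z.1) (sharp z.2)
      ((w : Model n), (0 : DualModel n))
    have h4 : ((k / 2) • normSqDeriv z) ((w : Model n), (0 : DualModel n)) =
        k / 2 * (2 * (0 - christoffelCovector z w (sharp z.2))) := congrArg (k / 2 * ·) h3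
    rw [h4]; ring
  have h5 : christoffelCovector z (k • sharp z.2) = k • christoffelCovector z (sharp z.2) :=
    christoffelFirst_smul (chartMetric z.1) (extChartAt (𝓡 n) z.1 z.1) (sharp z.2) (sharp z.2) k
  have h6 : connector (hamiltonianVectorField (radialHamiltonian h) z) w =
      pPart (hamiltonianVectorField (radialHamiltonian h) z) w -
        christoffelCovector z (qPart (hamiltonianVectorField (radialHamiltonian h) z)) w := rfl
  rw [h6, h1, mfderiv_radialHamiltonian hh, qPart_hamiltonianVectorField hh, ← hk]
  refine (congrArg₂ (fun a b => -a - b) h2 (DFunLike.congr_fun h5 w)).trans ?_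
  have h7 : (k • christoffelCovector z (sharp z.2)) w = k * christoffelCovector z (sharp z.2) w := rfl
  rw [h7, christoffelCovector_symm z w]
  simp

end Hamiltonian

end

/-! ### The pullback of the Liouville form and of ω under a map to T^*M. -/

section

section Coordinates

variable {n : ℕ} {E : Type*} [NormedAddCommGroup E] [NormedSpace ℝ E]

/-- The pullback of `d(p dq)` in coordinates. -/
theorem fderivWithin_pairing_sub {Y : E → Model n} {η : E → DualModel n} {s : Set E} {z : E}
    (hY : ContDiffWithinAt ℝ ∞ Y s z) (hη : DifferentiableWithinAt ℝ η s z)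
    (hs : UniqueDiffOn ℝ s) (hz : z ∈ s) (hz' : z ∈ closure (interior s)) (e e' : E) :
    fderivWithin ℝ (fun w => η w (fderivWithin ℝ Y s w e')) s z e -
      fderivWithin ℝ (fun w => η w (fderivWithin ℝ Y s w e)) s z e' =
    fderivWithin ℝ η s z e (fderivWithin ℝ Y s z e') -
      fderivWithin ℝ η s z e' (fderivWithin ℝ Y s z e) := by
  have hD : DifferentiableWithinAt ℝ (fderivWithin ℝ Y s) s z :=
    (hY.fderivWithin_right (m := 1) hs (by norm_num; exact ENat.LEInfty.out) hz).differentiableWithinAt (by simp)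
  have key : ∀ e e' : E, fderivWithin ℝ (fun w => η w (fderivWithin ℝ Y s w e')) s z e =
      η z (fderivWithin ℝ (fderivWithin ℝ Y s) s z e e') +
        fderivWithin ℝ η s z e (fderivWithin ℝ Y s z e') := by
    intro e e'
    have h1 : HasFDerivWithinAt (fun w => fderivWithin ℝ Y s w e')
        ((fderivWithin ℝ (fderivWithin ℝ Y s) s z).flip e') s z := by
      have := hD.hasFDerivWithinAt.clm_apply (hasFDerivWithinAt_const e' z s)
      simp only [ContinuousLinearMap.comp_zero, zero_add] at this
      exact this
    have h2 := hη.hasFDerivWithinAt.clm_apply h1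
    rw [h2.fderivWithin (hs z hz)]
    rfl
  -- Second derivatives of Y are symmetric, also at boundary points of s, since these are limits of
  -- interior points.
  have hsymm := hY.isSymmSndFDerivWithinAt (by simpa using ENat.LEInfty.out) hs hz' hz e e'
  rw [key, key, hsymm]
  abel

end Coordinates

open Bundle

variable {n : ℕ} {M : Type*} [TopologicalSpace M] [ChartedSpace (Model n) M]
  [IsManifold (𝓡 n) ∞ M]
  [RiemannianBundle (fun q : M => TangentSpace (𝓡 n) q)]


section Maps

variable {E : Type*} [NormedAddCommGroup E] [NormedSpace ℝ E] {u : E → Cotangent n M} {s : Set E}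

theorem contMDiffWithinAt_base {k : WithTop ℕ∞} {z : E}
    (hu : ContMDiffWithinAt 𝓘(ℝ, E) (cotModel n) k u s z) :
    ContMDiffWithinAt 𝓘(ℝ, E) (𝓡 n) k (fun w => (u w).1) s z :=
  (contMDiffWithinAt_cotangent_iff.1 hu).1

theorem qPart_mfderivWithin {z : E} (hu : MDifferentiableWithinAt 𝓘(ℝ, E) (cotModel n) u s z)
    (hs : UniqueDiffWithinAt ℝ s z) (e : E) :
    qPart (mfderivWithin 𝓘(ℝ, E) (cotModel n) u s z e) =
      mfderivWithin 𝓘(ℝ, E) (𝓡 n) (fun w => (u w).1) s z e := by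
  rw [mfderivWithin_cotangent hu hs, mfderivWithin_base (c := fun w => (u w).1)
    (mem_chart_source (Model n) (u z).1) (mdifferentiableWithinAt_cotangent_iff.1 hu).1 hs e,
    frame_self]
  rfl

/-- The components of the velocity in the frame of a fixed chart, near a point. -/
theorem eventually_qPart_eq_frame (hu : ContMDiffOn 𝓘(ℝ, E) (cotModel n) ∞ u s)
    (hs : UniqueDiffOn ℝ s) {z : E} (hz : z ∈ s) (e : E) :
    ∀ᶠ w in 𝓝[s] z, (u w).1 ∈ (chartAt (Model n) (u z).1).source ∧
      qPart (mfderivWithin 𝓘(ℝ, E) (cotModel n) u s w e) = frame (u z).1 (u w).1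
        (fderivWithin ℝ (fun w => extChartAt (𝓡 n) (u z).1 (u w).1) s w e) := by
  have h1 := (hu z hz).continuousWithinAt.eventually (eventually_mem_chart_source (u z))
  filter_upwards [h1, self_mem_nhdsWithin] with w hw hws
  have hd := (hu w hws).mdifferentiableWithinAt (by simp)
  exact ⟨hw, (qPart_mfderivWithin hd (hs w hws) e).trans
    (mfderivWithin_base (c := fun w => (u w).1) hw
      (mdifferentiableWithinAt_cotangent_iff.1 hd).1 (hs w hws) e)⟩

theorem contDiffWithinAt_fderivWithin_base (hu : ContMDiffOn 𝓘(ℝ, E) (cotModel n) ∞ u s)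
    (hs : UniqueDiffOn ℝ s) {z : E} (hz : z ∈ s) (e : E) :
    ContDiffWithinAt ℝ ∞
      (fun w => fderivWithin ℝ (fun w => extChartAt (𝓡 n) (u z).1 (u w).1) s w e) s z :=
  ((contDiffWithinAt_extChartAt_comp (c := fun w => (u w).1) le_rfl (mem_chart_source (Model n) _)
    (contMDiffWithinAt_base (hu z hz))).fderivWithin_right hs (by simp) hz).clm_apply
      contDiffWithinAt_const

theorem eventually_liouville_eq (hu : ContMDiffOn 𝓘(ℝ, E) (cotModel n) ∞ u s)
    (hs : UniqueDiffOn ℝ s) {z : E} (hz : z ∈ s) (e : E) :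
    (fun w => (u w).2 (qPart (mfderivWithin 𝓘(ℝ, E) (cotModel n) u s w e))) =ᶠ[𝓝[s] z]
      fun w => fibreCoord (u z).1 (u w)
        (fderivWithin ℝ (fun w => extChartAt (𝓡 n) (u z).1 (u w).1) s w e) := by
  filter_upwards [eventually_qPart_eq_frame hu hs hz e] with w hw
  rw [hw.2]
  rfl

theorem contDiffOn_pairing (hu : ContMDiffOn 𝓘(ℝ, E) (cotModel n) ∞ u s)
    (hs : UniqueDiffOn ℝ s) (e : E) :
    ContDiffOn ℝ ∞ (fun w => (u w).2 (qPart (mfderivWithin 𝓘(ℝ, E) (cotModel n) u s w e)) :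
      E → ℝ) s := by
  intro z hz
  refine ContDiffWithinAt.congr_of_eventuallyEq_of_mem ?_ (eventually_liouville_eq hu hs hz e) hz
  exact (contMDiffWithinAt_cotangent_iff.1 (hu z hz)).2.clm_apply
    (contDiffWithinAt_fderivWithin_base hu hs hz e)

theorem qPart_mfderivWithin_eq_fderivWithin {z : E}
    (hu : MDifferentiableWithinAt 𝓘(ℝ, E) (cotModel n) u s z) (hs : UniqueDiffWithinAt ℝ s z) (e : E) :
    qPart (mfderivWithin 𝓘(ℝ, E) (cotModel n) u s z e) =
      (show TangentSpace (𝓡 n) (u z).1 from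
        fderivWithin ℝ (fun w => extChartAt (𝓡 n) (u z).1 (u w).1) s z e) := by
  rw [mfderivWithin_cotangent hu hs]
  rfl

theorem pPart_mfderivWithin {z : E}
    (hu : MDifferentiableWithinAt 𝓘(ℝ, E) (cotModel n) u s z) (hs : UniqueDiffWithinAt ℝ s z) (e : E) :
    pPart (mfderivWithin 𝓘(ℝ, E) (cotModel n) u s z e) =
      (show TangentSpace (𝓡 n) (u z).1 →L[ℝ] ℝ from
        fderivWithin ℝ (fun w => fibreCoord (u z).1 (u w)) s z e) := by
  rw [mfderivWithin_cotangent hu hs]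
  rfl

variable [IsContMDiffRiemannianBundle (𝓡 n) ∞ (Model n) (fun q : M => TangentSpace (𝓡 n) q)]

/-- This is d(u^*λ) = u^*ω with coordinate derivatives of p replaced by covariant ones; the two
Christoffel corrections cancel by torsion-freeness. -/
theorem fderivWithin_pairing (hu : ContMDiffOn 𝓘(ℝ, E) (cotModel n) ∞ u s)
    (hs : UniqueDiffOn ℝ s) {z : E} (hz : z ∈ s) (hz' : z ∈ closure (interior s)) (e e' : E) :
    fderivWithin ℝ (fun w => (u w).2 (qPart (mfderivWithin 𝓘(ℝ, E) (cotModel n) u s w e')) :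
      E → ℝ) s z e -
    fderivWithin ℝ (fun w => (u w).2 (qPart (mfderivWithin 𝓘(ℝ, E) (cotModel n) u s w e)) :
      E → ℝ) s z e' =
    connector (mfderivWithin 𝓘(ℝ, E) (cotModel n) u s z e)
        (qPart (mfderivWithin 𝓘(ℝ, E) (cotModel n) u s z e')) -
      connector (mfderivWithin 𝓘(ℝ, E) (cotModel n) u s z e')
        (qPart (mfderivWithin 𝓘(ℝ, E) (cotModel n) u s z e)) := by
  have hd := (hu z hz).mdifferentiableWithinAt (by simp)
  have h1 : ∀ e, (fun w => (u w).2 (qPart (mfderivWithin 𝓘(ℝ, E) (cotModel n) u s w e)) : E → ℝ)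
      =ᶠ[𝓝[s] z] fun w => fibreCoord (u z).1 (u w)
        (fderivWithin ℝ (fun w => extChartAt (𝓡 n) (u z).1 (u w).1) s w e) :=
    fun e => eventually_liouville_eq hu hs hz e
  rw [(h1 e).fderivWithin_eq_of_mem hz, (h1 e').fderivWithin_eq_of_mem hz,
    fderivWithin_pairing_sub
      (contDiffWithinAt_extChartAt_comp (c := fun w => (u w).1) le_rfl
        (mem_chart_source (Model n) _) (contMDiffWithinAt_base (hu z hz)))
      (mdifferentiableWithinAt_cotangent_iff.1 hd).2 hs hz hz', connector,
    connector]
  have h2 := christoffelCovector_symm (u z) (qPart (mfderivWithin 𝓘(ℝ, E) (cotModel n) u s z e))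
    (qPart (mfderivWithin 𝓘(ℝ, E) (cotModel n) u s z e'))
  simp only [sub_apply]
  rw [h2, pPart_mfderivWithin hd (hs z hz), pPart_mfderivWithin hd (hs z hz),
    qPart_mfderivWithin_eq_fderivWithin hd (hs z hz),
    qPart_mfderivWithin_eq_fderivWithin hd (hs z hz)]
  exact (sub_sub_sub_cancel_right _ _ _).symm

theorem contDiffOn_normSq_comp (hu : ContMDiffOn 𝓘(ℝ, E) (cotModel n) ∞ u s) :
    ContDiffOn ℝ ∞ (fun w => ‖(u w).2‖ ^ 2) s := by
  rw [← contMDiffOn_iff_contDiffOn]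
  exact contMDiff_normSq.comp_contMDiffOn hu

theorem hasFDerivWithinAt_normSq_comp {z : E}
    (hu : MDifferentiableWithinAt 𝓘(ℝ, E) (cotModel n) u s z) :
    HasFDerivWithinAt (fun w => ‖(u w).2‖ ^ 2)
      ((normSqDeriv (u z)).comp (show E →L[ℝ] Model n × DualModel n from
        mfderivWithin 𝓘(ℝ, E) (cotModel n) u s z)) s z :=
  ((hasMFDerivAt_normSq (u z)).comp_hasMFDerivWithinAt z hu.hasMFDerivWithinAt).hasFDerivWithinAt

theorem fderivWithin_normSq_comp {z : E} (hs : UniqueDiffWithinAt ℝ s z)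
    (hu : MDifferentiableWithinAt 𝓘(ℝ, E) (cotModel n) u s z) (e : E) :
    fderivWithin ℝ (fun w => ‖(u w).2‖ ^ 2) s z e =
      2 * connector (mfderivWithin 𝓘(ℝ, E) (cotModel n) u s z e) (sharp (u z).2) := by
  rw [(hasFDerivWithinAt_normSq_comp hu).fderivWithin hs]
  exact normSqDeriv_apply (u z) (mfderivWithin 𝓘(ℝ, E) (cotModel n) u s z e)

theorem continuousOn_normSq_qPart (hu : ContMDiffOn 𝓘(ℝ, E) (cotModel n) ∞ u s)
    (hs : UniqueDiffOn ℝ s) (e : E) :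
    ContinuousOn (fun w => ‖qPart (mfderivWithin 𝓘(ℝ, E) (cotModel n) u s w e)‖ ^ 2) s := by
  intro z hz
  have h1 : (fun w => ‖qPart (mfderivWithin 𝓘(ℝ, E) (cotModel n) u s w e)‖ ^ 2) =ᶠ[𝓝[s] z]
      fun w => chartMetric (u z).1 (extChartAt (𝓡 n) (u z).1 (u w).1)
        (fderivWithin ℝ (fun w => extChartAt (𝓡 n) (u z).1 (u w).1) s w e)
        (fderivWithin ℝ (fun w => extChartAt (𝓡 n) (u z).1 (u w).1) s w e) := by
    filter_upwards [eventually_qPart_eq_frame hu hs hz e] with w hw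
    rw [hw.2, ← real_inner_self_eq_norm_sq, chartMetric_apply hw.1]
  refine ContinuousWithinAt.congr_of_eventuallyEq_of_mem ?_ h1 hz
  have h2 := (contDiffWithinAt_fderivWithin_base hu hs hz e).continuousWithinAt
  have h3 := (contDiffWithinAt_extChartAt_comp (c := fun w => (u w).1) le_rfl
    (mem_chart_source (Model n) _) (contMDiffWithinAt_base (hu z hz))).continuousWithinAt
  have h4 : ContinuousWithinAt
      (fun w => chartMetric (u z).1 (extChartAt (𝓡 n) (u z).1 (u w).1)) s z :=
    ContinuousAt.comp_continuousWithinAt (g := chartMetric (u z).1)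
      (contDiffAt_chartMetric (mem_chart_source (Model n) (u z).1)).continuousAt h3
  exact (h4.clm_apply h2).clm_apply h2

end Maps

end

/-! ### The scalar system satisfied by a Floer half-cylinder. -/

section

section HalfStrip

variable {F : Type*} [NormedAddCommGroup F] [NormedSpace ℝ F]

theorem mem_halfStrip {s t : ℝ} : (s, t) ∈ halfStrip ↔ 0 ≤ s := by
  simp [halfStrip]

theorem interior_halfStrip : interior halfStrip = Ioi 0 ×ˢ univ := by
  rw [halfStrip, interior_prod_eq, interior_Ici, interior_univ]

theorem uniqueDiffOn_halfStrip : UniqueDiffOn ℝ halfStrip :=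
  (uniqueDiffOn_Ici 0).prod uniqueDiffOn_univ

theorem subset_closure_interior_halfStrip : halfStrip ⊆ closure (interior halfStrip) := by
  rw [interior_halfStrip, closure_prod_eq, closure_Ioi, closure_univ]
  rfl

theorem hasDerivAt_halfStrip_snd {f : ℝ × ℝ → F} {s t : ℝ}
    (hf : DifferentiableWithinAt ℝ f halfStrip (s, t)) (hs : 0 ≤ s) :
    HasDerivAt (fun t => f (s, t)) (fderivWithin ℝ f halfStrip (s, t) (0, 1)) t := by
  have h1 : HasDerivWithinAt (fun t : ℝ => (s, t)) (0, 1) univ t :=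
    ((hasDerivAt_const t s).prodMk (hasDerivAt_id t)).hasDerivWithinAt
  have h2 := hf.hasFDerivWithinAt.comp_hasDerivWithinAt t h1
    (fun t' _ => mem_halfStrip.2 hs)
  exact hasDerivWithinAt_univ.1 h2

theorem hasDerivWithinAt_halfStrip_fst {f : ℝ × ℝ → F} {s t : ℝ}
    (hf : DifferentiableWithinAt ℝ f halfStrip (s, t)) :
    HasDerivWithinAt (fun s => f (s, t)) (fderivWithin ℝ f halfStrip (s, t) (1, 0)) (Ici 0) s := by
  have h1 : HasDerivWithinAt (fun s : ℝ => (s, t)) (1, 0) (Ici 0) s :=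
    ((hasDerivAt_id s).prodMk (hasDerivAt_const s t)).hasDerivWithinAt
  exact hf.hasFDerivWithinAt.comp_hasDerivWithinAt s h1 (fun s' hs' => mem_halfStrip.2 hs')

open scoped Pointwise in
theorem fderivWithin_halfStrip_periodic {f : ℝ × ℝ → F}
    (hf : ∀ s t, 0 ≤ s → f (s, t + 1) = f (s, t)) {s t : ℝ} (hs : 0 ≤ s) :
    fderivWithin ℝ f halfStrip (s, t + 1) = fderivWithin ℝ f halfStrip (s, t) := by
  have h1 := fderivWithin_comp_add_right (𝕜 := ℝ) (f := f) (s := halfStrip) (x := (s, t)) ((0, 1) : ℝ × ℝ)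
  have h2 : ((0, 1) : ℝ × ℝ) +ᵥ halfStrip = halfStrip := by
    ext ⟨x, y⟩
    simp [mem_vadd_set_iff_neg_vadd_mem, halfStrip]
  have h3 : fderivWithin ℝ (fun x => f (x + (0, 1))) halfStrip (s, t) =
      fderivWithin ℝ f halfStrip (s, t) := by
    refine fderivWithin_congr' ?_ (mem_halfStrip.2 hs)
    rintro ⟨x, y⟩ hx
    simpa using hf x y (mem_halfStrip.1 hx)
  rw [h2, h3] at h1
  simpa using h1.symm

end HalfStrip

/-- The scalar quantities attached to a Floer half-cylinder `u = (q, p)`: `N = |p|²`,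
`a = p(∂_t q)`, `b = p(∂_s q)`, `Q = |∂_t q|²`, `S = |∂_s q|²`. -/
structure IsFloerScalars (ρ h : ℝ → ℝ) (N a b Q S : ℝ × ℝ → ℝ) : Prop where
  smooth_N : ContDiffOn ℝ ∞ N halfStrip
  smooth_a : ContDiffOn ℝ ∞ a halfStrip
  smooth_b : ContDiffOn ℝ ∞ b halfStrip
  cont_Q : ContinuousOn Q halfStrip
  cont_S : ContinuousOn S halfStrip
  periodic_N : ∀ s t, 0 ≤ s → N (s, t + 1) = N (s, t)
  periodic_a : ∀ s t, 0 ≤ s → a (s, t + 1) = a (s, t)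
  periodic_b : ∀ s t, 0 ≤ s → b (s, t + 1) = b (s, t)
  N_nonneg : ∀ z, 0 ≤ N z
  Q_nonneg : ∀ z, 0 ≤ Q z
  S_nonneg : ∀ z, 0 ≤ S z
  a_sq_le : ∀ z, a z ^ 2 ≤ N z * Q z
  b_sq_le : ∀ z, b z ^ 2 ≤ N z * S z
  ds_N : ∀ z ∈ halfStrip, fderivWithin ℝ N halfStrip z (1, 0) =
    2 * ρ √(N z) * (a z - deriv h √(N z) / √(N z) * N z)
  dt_N : ∀ z ∈ halfStrip, fderivWithin ℝ N halfStrip z (0, 1) = -(2 * ρ √(N z) * b z)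
  curl : ∀ z ∈ halfStrip, fderivWithin ℝ a halfStrip z (1, 0) - fderivWithin ℝ b halfStrip z (0, 1) =
    ρ √(N z) * (Q z - deriv h √(N z) / √(N z) * a z + S z)
  N_zero : ∀ t, N (0, t) = 0
  S_zero : ∀ t, S (0, t) = 0

open Bundle

variable {n : ℕ} {M : Type*} [TopologicalSpace M] [ChartedSpace (Model n) M]
  [IsManifold (𝓡 n) ∞ M]
  [RiemannianBundle (fun q : M => TangentSpace (𝓡 n) q)]


/-- `|p|²` along a map to `T^*M`. -/
def normSqAlong (u : ℝ × ℝ → Cotangent n M) (z : ℝ × ℝ) : ℝ := ‖(u z).2‖ ^ 2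

/-- `p(∂_e q)` along a map `(q, p)` to `T^*M`. -/
def pairingAlong (u : ℝ × ℝ → Cotangent n M) (e z : ℝ × ℝ) : ℝ :=
  (u z).2 (qPart (mfderivWithin 𝓘(ℝ, ℝ × ℝ) (cotModel n) u halfStrip z e))

/-- `|∂_e q|²` along a map `(q, p)` to `T^*M`. -/
def speedSqAlong (u : ℝ × ℝ → Cotangent n M) (e z : ℝ × ℝ) : ℝ :=
  ‖qPart (mfderivWithin 𝓘(ℝ, ℝ × ℝ) (cotModel n) u halfStrip z e)‖ ^ 2

theorem qPart_add {z : Cotangent n M} (V W : TangentSpace (cotModel n) z) :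
    qPart (V + W) = qPart V + qPart W := rfl

theorem qPart_sub {z : Cotangent n M} (V W : TangentSpace (cotModel n) z) :
    qPart (V - W) = qPart V - qPart W := rfl

theorem connector_sub {z : Cotangent n M} (V W : TangentSpace (cotModel n) z) :
    connector (V - W) = connector V - connector W := by
  rw [sub_eq_add_neg, ← neg_one_smul ℝ W, connector_add, connector_smul]
  exact (congrArg (connector V + ·) (neg_one_smul ℝ (connector W))).trans
    (sub_eq_add_neg _ _).symm

variable {ρ h : ℝ → ℝ} {μ δ : ℝ} {x : ℝ → Cotangent n M} {u : ℝ × ℝ → Cotangent n M}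

/-- Along the zero section the components of p are constantly 0 and the Christoffel term is linear
in p. This makes ∂_s q vanish on the boundary. -/
theorem connector_of_snd_eq_zero
    (hu : ContMDiffOn 𝓘(ℝ, ℝ × ℝ) (cotModel n) ∞ u halfStrip)
    (h0 : ∀ t, (u (0, t)).2 = 0) (t : ℝ) : connector (dT u (0, t)) = 0 := by
  have hz : ((0, t) : ℝ × ℝ) ∈ halfStrip := mem_halfStrip.2 le_rfl
  have hd := (hu _ hz).mdifferentiableWithinAt (by simp)
  have h1 := hasDerivAt_halfStrip_snd (mdifferentiableWithinAt_cotangent_iff.1 hd).2 le_rfl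
  have h2 : (fun t' => fibreCoord (u (0, t)).1 (u (0, t'))) = fun _ => 0 := by
    funext t'
    ext v
    exact DFunLike.congr_fun (h0 t') _
  rw [h2] at h1
  have h3 := h1.unique (hasDerivAt_const t (0 : DualModel n))
  have h4 : pPart (dT u (0, t)) = 0 :=
    (pPart_mfderivWithin hd (uniqueDiffOn_halfStrip _ hz) (0, 1)).trans h3
  have h5 : ∀ v, christoffelCovector (u (0, t)) v = 0 := by
    intro v
    have h6 := christoffelFirst_smul_left (chartMetric (u (0, t)).1)
      (extChartAt (𝓡 n) (u (0, t)).1 (u (0, t)).1) 0 v 0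
    rw [smul_zero, zero_smul] at h6
    have h7 : sharp (u (0, t)).2 = 0 := by
      rw [h0 t]
      exact map_zero (InnerProductSpace.toDual ℝ (TangentSpace (𝓡 n) (u (0, t)).1)).symm
    rw [christoffelCovector, h7]
    exact h6
  rw [connector, h4, h5, sub_zero]

theorem pairingAlong_eq (hu : ContMDiffOn 𝓘(ℝ, ℝ × ℝ) (cotModel n) ∞ u halfStrip) {z : ℝ × ℝ}
    (hz : z ∈ halfStrip) {q₀ : M} (hq : (u z).1 ∈ (chartAt (Model n) q₀).source) (e : ℝ × ℝ) :
    pairingAlong u e z = fibreCoord q₀ (u z)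
      (fderivWithin ℝ (fun w => extChartAt (𝓡 n) q₀ (u w).1) halfStrip z e) := by
  have hd := (hu z hz).mdifferentiableWithinAt (by simp)
  rw [pairingAlong, qPart_mfderivWithin hd (uniqueDiffOn_halfStrip z hz),
    mfderivWithin_base (c := fun w => (u w).1) hq (mdifferentiableWithinAt_cotangent_iff.1 hd).1
      (uniqueDiffOn_halfStrip z hz)]
  rfl

/-- The points u(s, t + 1) and u(s, t) agree, but the tangent spaces are only propositionally equal;
expressing both values in one fixed chart avoids transport. -/
theorem pairingAlong_periodic (hu : ContMDiffOn 𝓘(ℝ, ℝ × ℝ) (cotModel n) ∞ u halfStrip)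
    (hp : ∀ s t, 0 ≤ s → u (s, t + 1) = u (s, t)) (e : ℝ × ℝ) (s t : ℝ) (hs : 0 ≤ s) :
    pairingAlong u e (s, t + 1) = pairingAlong u e (s, t) := by
  rw [pairingAlong_eq hu (mem_halfStrip.2 hs) (q₀ := (u (s, t)).1)
      (by rw [hp s t hs]; exact mem_chart_source _ _),
    pairingAlong_eq hu (mem_halfStrip.2 hs) (q₀ := (u (s, t)).1) (mem_chart_source _ _),
    hp s t hs, fderivWithin_halfStrip_periodic _ hs]
  intro s' t' hs'
  rw [hp s' t' hs']

variable [IsContMDiffRiemannianBundle (𝓡 n) ∞ (Model n) (fun q : M => TangentSpace (𝓡 n) q)]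

/-- The horizontal part of the Floer equation: `∂_s q = - ρ⁻¹ (∇_t p)^♯`. -/
theorem IsFloerHalfCylinder.qPart_dS (hh : IsLinearProfile μ δ h)
    (hu : IsFloerHalfCylinder ρ (radialHamiltonian h) x u) {z : ℝ × ℝ} (hz : z ∈ halfStrip) :
    qPart (dS u z) = -((ρ ‖(u z).2‖)⁻¹ • sharp (connector (dT u z))) := by
  have h1 := congrArg qPart (hu.floer z hz)
  rw [qPart_add, almostComplex, qPart_horizontalVertical, connector_sub,
    connector_hamiltonianVectorField hh, sub_zero] at h1
  exact eq_neg_of_add_eq_zero_left h1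

/-- The vertical part of the Floer equation: `∇_s p = ρ (∂_t q - h'(|p|) p^♯ / |p|)^♭`. -/
theorem IsFloerHalfCylinder.connector_dS (hh : IsLinearProfile μ δ h)
    (hu : IsFloerHalfCylinder ρ (radialHamiltonian h) x u) {z : ℝ × ℝ} (hz : z ∈ halfStrip) :
    connector (dS u z) = ρ ‖(u z).2‖ •
      flat (qPart (dT u z) - (deriv h ‖(u z).2‖ / ‖(u z).2‖) • sharp (u z).2) := by
  have h1 := congrArg connector (hu.floer z hz)
  have h0 : connector (0 : TangentSpace (cotModel n) (u z)) = 0 := by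
    have := connector_smul (0 : ℝ) (0 : TangentSpace (cotModel n) (u z))
    rwa [zero_smul, zero_smul] at this
  rw [h0, connector_add, almostComplex, connector_horizontalVertical, qPart_sub,
    qPart_hamiltonianVectorField hh] at h1
  exact add_neg_eq_zero.1 h1

/-- The passage from geometry to analysis. Differentiating |p|² uses metric compatibility, the curl
identity is d(u^*λ) = u^*ω, and the two halves of the Floer equation eliminate all covariant
derivatives of p. -/
theorem IsFloerHalfCylinder.isFloerScalars (hρ : IsCylindricalProfile ρ)
    (hh : IsLinearProfile μ δ h) (hu : IsFloerHalfCylinder ρ (radialHamiltonian h) x u) :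
    IsFloerScalars ρ h (normSqAlong u) (pairingAlong u (0, 1)) (pairingAlong u (1, 0))
      (speedSqAlong u (0, 1)) (speedSqAlong u (1, 0)) := by
  have hsqrt : ∀ z, √(normSqAlong u z) = ‖(u z).2‖ := fun z => Real.sqrt_sq (norm_nonneg (u z).2)
  have hcs : ∀ e z, pairingAlong u e z ^ 2 ≤ normSqAlong u z * speedSqAlong u e z := by
    intro e z
    have h1 : |pairingAlong u e z| ≤ ‖(u z).2‖ *
        ‖qPart (mfderivWithin 𝓘(ℝ, ℝ × ℝ) (cotModel n) u halfStrip z e)‖ :=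
      ContinuousLinearMap.le_opNorm (show TangentSpace (𝓡 n) (u z).1 →L[ℝ] ℝ from (u z).2) _
    calc _ = |pairingAlong u e z| ^ 2 := (sq_abs _).symm
      _ ≤ _ := pow_le_pow_left₀ (abs_nonneg _) h1 2
      _ = _ := mul_pow _ _ 2
  have hρpos : ∀ z, 0 < ρ ‖(u z).2‖ := fun z => hρ.pos _ (norm_nonneg (u z).2)
  have hds : ∀ z, mfderivWithin 𝓘(ℝ, ℝ × ℝ) (cotModel n) u halfStrip z ((1, 0) : ℝ × ℝ) = dS u z :=
    fun _ => rfl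
  have hdt : ∀ z, mfderivWithin 𝓘(ℝ, ℝ × ℝ) (cotModel n) u halfStrip z ((0, 1) : ℝ × ℝ) = dT u z :=
    fun _ => rfl
  have hd : ∀ z ∈ halfStrip, MDifferentiableWithinAt 𝓘(ℝ, ℝ × ℝ) (cotModel n) u halfStrip z :=
    fun z hz => (hu.smooth z hz).mdifferentiableWithinAt (by simp)
  have hpa : ∀ z (v : TangentSpace (𝓡 n) (u z).1), inner ℝ v (sharp (u z).2) = (u z).2 v := by
    intro z v
    rw [real_inner_comm]
    exact inner_sharp (u z).2 v
  have hPP : ∀ z, inner ℝ (sharp (u z).2) (sharp (u z).2) = normSqAlong u z := by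
    intro z
    rw [real_inner_self_eq_norm_sq]
    exact congrArg (· ^ 2) (norm_sharp (u z).2)
  have hct : ∀ z ∈ halfStrip, ∀ v, connector (dT u z) v =
      -(ρ ‖(u z).2‖ * inner ℝ (qPart (dS u z)) v) := by
    intro z hz v
    rw [hu.qPart_dS hh hz, inner_neg_left, real_inner_smul_left, inner_sharp]
    field_simp [(hρpos z).ne']
  exact
  { smooth_N := contDiffOn_normSq_comp hu.smooth
    smooth_a := contDiffOn_pairing hu.smooth uniqueDiffOn_halfStrip _
    smooth_b := contDiffOn_pairing hu.smooth uniqueDiffOn_halfStrip _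
    cont_Q := continuousOn_normSq_qPart hu.smooth uniqueDiffOn_halfStrip _
    cont_S := continuousOn_normSq_qPart hu.smooth uniqueDiffOn_halfStrip _
    periodic_N := fun s t hs => by rw [normSqAlong, hu.periodic s t hs]; rfl
    periodic_a := pairingAlong_periodic hu.smooth hu.periodic _
    periodic_b := pairingAlong_periodic hu.smooth hu.periodic _
    N_nonneg := fun z => sq_nonneg _
    Q_nonneg := fun z => sq_nonneg _
    S_nonneg := fun z => sq_nonneg _
    a_sq_le := hcs _
    b_sq_le := hcs _
    ds_N := fun z hz => by
      have h1 := fderivWithin_normSq_comp (uniqueDiffOn_halfStrip z hz) (hd z hz) (1, 0)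
      refine h1.trans ?_
      rw [hds, hu.connector_dS hh hz, hsqrt, smul_apply, flat_apply, inner_sub_left,
        real_inner_smul_left, hPP, hpa]
      simp only [smul_eq_mul, mul_assoc]
      rfl
    dt_N := fun z hz => by
      have h1 := fderivWithin_normSq_comp (uniqueDiffOn_halfStrip z hz) (hd z hz) (0, 1)
      refine h1.trans ?_
      rw [hdt, hct z hz, hsqrt, hpa, mul_neg, mul_assoc]
      rfl
    curl := fun z hz => by
      have h1 := fderivWithin_pairing hu.smooth uniqueDiffOn_halfStrip hz
        (subset_closure_interior_halfStrip hz) (1, 0) (0, 1)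
      refine h1.trans ?_
      rw [hdt, hds, hct z hz, hu.connector_dS hh hz, hsqrt, smul_apply, flat_apply, inner_sub_left,
        real_inner_smul_left, real_inner_self_eq_norm_sq, real_inner_self_eq_norm_sq, inner_sharp]
      have h2 : (u z).2 (qPart (dT u z)) = pairingAlong u (0, 1) z := rfl
      have h3 : ‖qPart (dT u z)‖ ^ 2 = speedSqAlong u (0, 1) z := rfl
      have h4 : ‖qPart (dS u z)‖ ^ 2 = speedSqAlong u (1, 0) z := rfl
      rw [h2, h3, h4, smul_eq_mul]
      ring
    N_zero := fun t => by
      rw [normSqAlong, hu.boundary t]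
      have h1 : ‖(0 : TangentSpace (𝓡 n) (u (0, t)).1 →L[ℝ] ℝ)‖ = 0 :=
        ContinuousLinearMap.opNorm_zero
      exact (congrArg (· ^ 2) h1).trans (zero_pow two_ne_zero)
    S_zero := fun t => by
      have h1 := hu.qPart_dS hh (mem_halfStrip.2 le_rfl : ((0 : ℝ), t) ∈ halfStrip)
      rw [connector_of_snd_eq_zero hu.smooth hu.boundary] at h1
      have h2 : sharp (0 : TangentSpace (𝓡 n) (u (0, t)).1 →L[ℝ] ℝ) = 0 :=
        map_zero (InnerProductSpace.toDual ℝ (TangentSpace (𝓡 n) (u (0, t)).1)).symm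
      rw [h2, smul_zero, neg_zero] at h1
      rw [speedSqAlong, hds, h1]
      simp }

end

/-! ### The profiles h and ρ, and the regularization of 1/|p|. -/

section

section Profile

variable {μ δ : ℝ} {h ρ : ℝ → ℝ}

theorem IsLinearProfile.contDiffAt_deriv (hh : IsLinearProfile μ δ h) {r : ℝ} (hr : 0 < r) :
    ContDiffAt ℝ ∞ (deriv h) r := by
  have h1 : ContDiffAt ℝ ∞ h r := hh.smooth.contDiffAt (Ici_mem_nhds hr)
  exact (h1.fderiv_right (m := ∞) (by simp)).clm_apply contDiffAt_const

theorem IsLinearProfile.deriv_eq_zero (hh : IsLinearProfile μ δ h) {r : ℝ} (hr : 0 ≤ r)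
    (hr1 : r ≤ 1) : deriv h r = 0 := by
  rcases hr.eq_or_lt with rfl | hr
  -- The values of h at negative arguments are arbitrary; if h is not differentiable at 0, `deriv`
  -- has the default value 0.
  · by_cases hd : DifferentiableAt ℝ h 0
    · have h1 := hd.hasDerivAt.hasDerivWithinAt (s := Icc 0 1)
      have h2 : HasDerivWithinAt h 0 (Icc 0 1) 0 :=
        (hasDerivWithinAt_const (0 : ℝ) (Icc 0 1) (0 : ℝ)).congr
          (fun y hy => hh.eq_zero y hy.1 hy.2) (hh.eq_zero 0 le_rfl zero_le_one)
      exact (uniqueDiffOn_Icc_zero_one 0 (by simp)).eq_deriv _ h1 h2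
    · exact deriv_zero_of_not_differentiableAt hd
  · have h1 := (hh.hasDerivAt hr).hasDerivWithinAt (s := Icc 0 1)
    have h2 : HasDerivWithinAt h 0 (Icc 0 1) r :=
      (hasDerivWithinAt_const r (Icc 0 1) (0 : ℝ)).congr
        (fun y hy => hh.eq_zero y hy.1 hy.2) (hh.eq_zero r hr.le hr1)
    exact (uniqueDiffOn_Icc_zero_one r ⟨hr.le, hr1⟩).eq_deriv _ h1 h2

theorem IsLinearProfile.continuous_deriv_sqrt (hh : IsLinearProfile μ δ h) :
    Continuous fun y => deriv h √y := by
  rw [continuous_iff_continuousAt]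
  intro y
  rcases lt_or_ge y 1 with hy | hy
  · have h1 : (fun y => deriv h √y) =ᶠ[𝓝 y] fun _ => 0 := by
      filter_upwards [Iio_mem_nhds hy] with z hz
      exact hh.deriv_eq_zero (Real.sqrt_nonneg z) (Real.sqrt_le_one.2 (le_of_lt hz))
    exact continuousAt_const.congr h1.symm
  · have h1 : ContinuousAt (deriv h) √y :=
      (hh.contDiffAt_deriv (Real.sqrt_pos.2 (by linarith))).continuousAt
    exact ContinuousAt.comp (f := Real.sqrt) h1 Real.continuous_sqrt.continuousAt

theorem IsLinearProfile.continuousOn_deriv (hh : IsLinearProfile μ δ h) :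
    ContinuousOn (deriv h) (Ici 0) := by
  have h1 : Continuous fun r : ℝ => deriv h √(r ^ 2) :=
    hh.continuous_deriv_sqrt.comp (continuous_pow 2)
  refine h1.continuousOn.congr fun r hr => ?_
  simp only [Real.sqrt_sq (show (0 : ℝ) ≤ r from hr)]

/-- Monotonicity on the open interval (1, 1 + δ) extends to its closure by continuity of h', and h'
is constant on the two remaining pieces. -/
theorem IsLinearProfile.monotoneOn_deriv (hh : IsLinearProfile μ δ h) :
    MonotoneOn (deriv h) (Ici 0) := by
  have hδ := hh.width_pos
  have h1 : MonotoneOn (deriv h) (Icc 0 1) := fun a ha b hb _ => by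
    rw [hh.deriv_eq_zero ha.1 ha.2, hh.deriv_eq_zero hb.1 hb.2]
  have h2 : MonotoneOn (deriv h) (Icc 1 (1 + δ)) := by
    have h3 : ∀ y ∈ Ioo 1 (1 + δ), (0 : ℝ) < y := fun y hy => zero_lt_one.trans hy.1
    refine monotoneOn_of_deriv_nonneg (convex_Icc _ _)
      (hh.continuousOn_deriv.mono fun y hy => le_trans zero_le_one hy.1) ?_ ?_
    · rw [interior_Icc]
      exact fun y hy => ((hh.contDiffAt_deriv (h3 y hy)).differentiableAt
        (by simp)).differentiableWithinAt
    · rw [interior_Icc]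
      intro y hy
      rw [← derivWithin_of_mem_nhds (Ioo_mem_nhds hy.1 hy.2)]
      exact hh.deriv_strictMono.monotoneOn.derivWithin_nonneg
  have h4 : MonotoneOn (deriv h) (Ici (1 + δ)) := fun a ha b hb _ => by
    rw [hh.deriv_eq_slope a ha, hh.deriv_eq_slope b hb]
  have h5 := h1.union_right h2 (isGreatest_Icc zero_le_one) (isLeast_Icc (by linarith))
  rw [Icc_union_Icc_eq_Icc zero_le_one (by linarith)] at h5
  have h6 := h5.union_right h4 (isGreatest_Icc (by linarith)) isLeast_Ici
  rwa [Icc_union_Ici_eq_Ici (by linarith)] at h6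

theorem IsLinearProfile.deriv_nonneg (hh : IsLinearProfile μ δ h) {r : ℝ} (hr : 0 ≤ r) :
    0 ≤ deriv h r := by
  have := hh.monotoneOn_deriv (mem_Ici.2 le_rfl) hr hr
  rwa [hh.deriv_eq_zero le_rfl zero_le_one] at this

/-- Convexity and h(1) = 0, by the mean value theorem on [1, r]. It gives r h'(r) - h(r) ≥ h'(r),
the comparison with the action. -/
theorem IsLinearProfile.le_sub_one_mul_deriv (hh : IsLinearProfile μ δ h) {r : ℝ} (hr : 1 < r) :
    h r ≤ (r - 1) * deriv h r := by
  obtain ⟨ξ, hξ, h1⟩ := exists_deriv_eq_slope h hr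
    (hh.smooth.continuousOn.mono fun y hy => le_trans zero_le_one hy.1)
    (fun y hy => (hh.hasDerivAt (lt_trans zero_lt_one hy.1)).differentiableAt.differentiableWithinAt)
  rw [hh.eq_zero 1 zero_le_one le_rfl, sub_zero, eq_div_iff (by linarith)] at h1
  rw [← h1, mul_comm]
  refine mul_le_mul_of_nonneg_left (hh.monotoneOn_deriv ?_ ?_ hξ.2.le) (by linarith)
  · exact mem_Ici.2 (by linarith [hξ.1])
  · exact mem_Ici.2 (by linarith)

theorem IsLinearProfile.deriv_deriv_nonneg (hh : IsLinearProfile μ δ h) {r : ℝ} (hr : 0 < r) :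
    0 ≤ deriv (deriv h) r := by
  have h1 := hh.monotoneOn_deriv.derivWithin_nonneg (x := r)
  rwa [derivWithin_of_mem_nhds (Ici_mem_nhds hr)] at h1

theorem IsLinearProfile.deriv_deriv_eq_zero (hh : IsLinearProfile μ δ h) {r : ℝ}
    (hr : r < 1 ∧ 0 < r ∨ 1 + δ < r) : deriv (deriv h) r = 0 := by
  rcases hr with ⟨h1, h0⟩ | h1
  · have h2 : deriv h =ᶠ[𝓝 r] fun _ => 0 := by
      filter_upwards [Ioo_mem_nhds h0 h1] with y hy using hh.deriv_eq_zero hy.1.le hy.2.le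
    rw [h2.deriv_eq, deriv_const]
  · have h2 : deriv h =ᶠ[𝓝 r] fun _ => μ := by
      filter_upwards [Ioi_mem_nhds h1] with y hy using hh.deriv_eq_slope y (le_of_lt hy)
    rw [h2.deriv_eq, deriv_const]

theorem IsCylindricalProfile.one_le (hρ : IsCylindricalProfile ρ) {r : ℝ} (hr : 0 ≤ r) :
    1 ≤ ρ r := by
  obtain ⟨η, hη, h1⟩ := hρ.eq_one_near_zero
  rw [← h1 0 le_rfl hη.le]
  exact hρ.mono (mem_Ici.2 le_rfl) hr hr

theorem IsCylindricalProfile.continuous_sqrt (hρ : IsCylindricalProfile ρ) :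
    Continuous fun y => ρ √y :=
  hρ.smooth.continuousOn.comp_continuous Real.continuous_sqrt Real.sqrt_nonneg

/-- For positive r, h'' vanishes outside the compact interval [1, 1 + δ]. The constant bounds the
zeroth-order coefficient in both the height comparison and the Cauchy-Riemann system. -/
theorem IsLinearProfile.exists_bound (hh : IsLinearProfile μ δ h) (hρ : IsCylindricalProfile ρ) :
    ∃ C, 0 ≤ C ∧ ∀ r, 0 < r → deriv (deriv h) r * ρ r ≤ C := by
  have h1 : ContinuousOn (fun r => deriv (deriv h) r * ρ r) (Icc 1 (1 + δ)) := by
    intro r hr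
    have h2 : (0 : ℝ) < r := lt_of_lt_of_le zero_lt_one hr.1
    have h3 : ContDiffAt ℝ ∞ (deriv (deriv h)) r :=
      ((hh.contDiffAt_deriv h2).fderiv_right (m := ∞) (by simp)).clm_apply contDiffAt_const
    exact (h3.continuousAt.mul
      ((hρ.smooth.contDiffAt (Ici_mem_nhds h2)).continuousAt)).continuousWithinAt
  obtain ⟨C, hC⟩ := isCompact_Icc.bddAbove_image h1
  refine ⟨max C 0, le_max_right _ _, fun r hr => ?_⟩
  by_cases h2 : 1 ≤ r ∧ r ≤ 1 + δ
  · exact (hC (mem_image_of_mem _ h2)).trans (le_max_left _ _)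
  · rw [hh.deriv_deriv_eq_zero, zero_mul]
    · exact le_max_right _ _
    · rw [not_and_or, not_le, not_le] at h2
      exact h2.imp (fun h3 => ⟨h3, hr⟩) id

end Profile

section Regularization

/-- A `C¹` function of `y ∈ ℝ` that is `1 / √y` for `y ≥ ε²`, continued by its tangent. -/
def invSqrtReg (ε y : ℝ) : ℝ := if y ≤ ε ^ 2 then 3 / (2 * ε) - y / (2 * ε ^ 3) else (√y)⁻¹

/-- The derivative of `invSqrtReg ε`. -/
def invSqrtRegDeriv (ε y : ℝ) : ℝ := -((√(max y (ε ^ 2))) ^ 3)⁻¹ / 2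

variable {ε y : ℝ}

theorem invSqrtReg_of_le (hε : 0 < ε) (hy : ε ^ 2 ≤ y) : invSqrtReg ε y = (√y)⁻¹ := by
  rcases hy.eq_or_lt with rfl | hy
  · rw [invSqrtReg, if_pos le_rfl, Real.sqrt_sq hε.le]
    field_simp
    norm_num
  · rw [invSqrtReg, if_neg (not_le.2 hy)]

theorem invSqrtRegDeriv_of_le (hy : ε ^ 2 ≤ y) : invSqrtRegDeriv ε y = -((√y) ^ 3)⁻¹ / 2 := by
  rw [invSqrtRegDeriv, max_eq_left hy]

theorem invSqrtRegDeriv_of_ge (hε : 0 < ε) (hy : y ≤ ε ^ 2) :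
    invSqrtRegDeriv ε y = -(ε ^ 3)⁻¹ / 2 := by
  rw [invSqrtRegDeriv, max_eq_right hy, Real.sqrt_sq hε.le]

theorem hasDerivAt_invSqrtReg (hε : 0 < ε) (y : ℝ) :
    HasDerivAt (invSqrtReg ε) (invSqrtRegDeriv ε y) y := by
  have hl : ∀ z, HasDerivAt (fun y => 3 / (2 * ε) - y / (2 * ε ^ 3)) (-(ε ^ 3)⁻¹ / 2) z := by
    intro z
    refine (((hasDerivAt_id z).div_const (2 * ε ^ 3)).const_sub (3 / (2 * ε))).congr_deriv ?_
    field_simp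
  have hr : ∀ z, 0 < z → HasDerivAt (fun y => (√y)⁻¹) (-((√z) ^ 3)⁻¹ / 2) z := by
    intro z hz
    have h1 := Real.sqrt_pos.2 hz
    refine ((Real.hasDerivAt_sqrt hz.ne').inv h1.ne').congr_deriv ?_
    field_simp
  have h0 : 0 < ε ^ 2 := by positivity
  rcases lt_trichotomy y (ε ^ 2) with hy | hy | hy
  · rw [invSqrtRegDeriv_of_ge hε hy.le]
    refine (hl y).congr_of_eventuallyEq ?_
    filter_upwards [Iio_mem_nhds hy] with z hz
    rw [invSqrtReg, if_pos (le_of_lt hz)]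
  · have h1 : HasDerivWithinAt (invSqrtReg ε) (invSqrtRegDeriv ε y) (Iic (ε ^ 2)) y := by
      rw [invSqrtRegDeriv_of_ge hε hy.le]
      exact (hl y).hasDerivWithinAt.congr (fun z hz => if_pos hz) (if_pos hy.le)
    have h2 : HasDerivWithinAt (invSqrtReg ε) (invSqrtRegDeriv ε y) (Ici (ε ^ 2)) y := by
      rw [invSqrtRegDeriv_of_le hy.ge]
      exact (hr y (hy ▸ h0)).hasDerivWithinAt.congr (fun z hz => invSqrtReg_of_le hε hz)
        (invSqrtReg_of_le hε hy.ge)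
    have h3 := h1.union h2
    rwa [Iic_union_Ici, hasDerivWithinAt_univ] at h3
  · rw [invSqrtRegDeriv_of_le hy.le]
    refine (hr y (h0.trans hy)).congr_of_eventuallyEq ?_
    filter_upwards [Ioi_mem_nhds hy] with z hz
    exact invSqrtReg_of_le hε (le_of_lt hz)

theorem continuous_invSqrtRegDeriv (hε : 0 < ε) : Continuous (invSqrtRegDeriv ε) := by
  have h0 : ∀ y : ℝ, √(max y (ε ^ 2)) ^ 3 ≠ 0 := fun y =>
    (pow_pos (Real.sqrt_pos.2 (lt_of_lt_of_le (by positivity) (le_max_right _ _))) 3).ne'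
  unfold invSqrtRegDeriv
  fun_prop (disch := exact h0)

theorem contDiff_invSqrtReg (hε : 0 < ε) : ContDiff ℝ 1 (invSqrtReg ε) := by
  rw [contDiff_one_iff_deriv]
  refine ⟨fun y => (hasDerivAt_invSqrtReg hε y).differentiableAt, ?_⟩
  rw [show deriv (invSqrtReg ε) = invSqrtRegDeriv ε from
    funext fun y => (hasDerivAt_invSqrtReg hε y).deriv]
  exact continuous_invSqrtRegDeriv hε

/-- The tangent line of a convex function lies below its graph. -/
theorem invSqrtReg_le (hε : 0 < ε) (hy : 0 < y) : invSqrtReg ε y ≤ (√y)⁻¹ := by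
  rcases le_total y (ε ^ 2) with h1 | h1
  · rw [invSqrtReg, if_pos h1]
    obtain ⟨m, hm, rfl⟩ : ∃ m, 0 < m ∧ y = m ^ 2 :=
      ⟨√y, Real.sqrt_pos.2 hy, (Real.sq_sqrt hy.le).symm⟩
    rw [Real.sqrt_sq hm.le, div_sub_div _ _ (by positivity) (by positivity), inv_eq_one_div,
      div_le_div_iff₀ (by positivity) hm]
    -- With y = m² the claim is 2ε³ - 3ε²m + m³ = (ε - m)²(2ε + m) ≥ 0.
    nlinarith [mul_nonneg (mul_nonneg hε.le (sq_nonneg (ε - m))) (by positivity : 0 ≤ 2 * ε + m)]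
  · rw [invSqrtReg_of_le hε h1]

theorem inv_sqrt_max_le_invSqrtReg (hε : 0 < ε) (y : ℝ) :
    (√(max y (ε ^ 2)))⁻¹ ≤ invSqrtReg ε y := by
  rcases le_total y (ε ^ 2) with h1 | h1
  · rw [max_eq_right h1, Real.sqrt_sq hε.le, invSqrtReg, if_pos h1, le_sub_iff_add_le]
    rw [inv_eq_one_div, div_add_div _ _ hε.ne' (by positivity), div_le_div_iff₀ (by positivity) (by positivity)]
    nlinarith [mul_le_mul_of_nonneg_left h1 (by positivity : 0 ≤ ε ^ 2)]
  · rw [max_eq_left h1, invSqrtReg_of_le hε h1]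

theorem invSqrtReg_pos (hε : 0 < ε) (y : ℝ) : 0 < invSqrtReg ε y :=
  lt_of_lt_of_le (inv_pos.2 (Real.sqrt_pos.2 (lt_of_lt_of_le (by positivity) (le_max_right _ _))))
    (inv_sqrt_max_le_invSqrtReg hε y)

/-- For g = `invSqrtReg ε`, the quantity g + 2yg' is 2√y times the derivative of √y g(y), a function
that increases up to y = ε² and equals 1 afterwards. -/
theorem invSqrtReg_add_nonneg (hε : 0 < ε) (hy : 0 ≤ y) :
    0 ≤ invSqrtReg ε y + 2 * y * invSqrtRegDeriv ε y := by
  rcases le_total y (ε ^ 2) with h1 | h1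
  · rw [invSqrtRegDeriv_of_ge hε h1, invSqrtReg, if_pos h1]
    have : 3 / (2 * ε) - y / (2 * ε ^ 3) + 2 * y * (-(ε ^ 3)⁻¹ / 2) =
      3 / (2 * ε ^ 3) * (ε ^ 2 - y) := by field_simp; ring
    rw [this]
    exact mul_nonneg (by positivity) (by linarith)
  · have h2 : 0 < y := lt_of_lt_of_le (by positivity) h1
    rw [invSqrtRegDeriv_of_le h1, invSqrtReg_of_le hε h1]
    have h3 := Real.sqrt_pos.2 h2
    have : (√y)⁻¹ + 2 * y * (-(√y ^ 3)⁻¹ / 2) = (√y ^ 3)⁻¹ * (√y ^ 2 - y) := by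
      field_simp
      ring
    rw [this, Real.sq_sqrt hy, sub_self, mul_zero]

theorem invSqrtReg_add_eq_zero (hε : 0 < ε) (hy : ε ^ 2 ≤ y) :
    invSqrtReg ε y + 2 * y * invSqrtRegDeriv ε y = 0 := by
  have h2 : 0 < y := lt_of_lt_of_le (by positivity) hy
  rw [invSqrtRegDeriv_of_le hy, invSqrtReg_of_le hε hy]
  have h3 := Real.sqrt_pos.2 h2
  have : (√y)⁻¹ + 2 * y * (-(√y ^ 3)⁻¹ / 2) = (√y ^ 3)⁻¹ * (√y ^ 2 - y) := by
    field_simp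
    ring
  rw [this, Real.sq_sqrt h2.le, sub_self, mul_zero]

/-- The bound does not depend on ε; this is what survives when ε tends to 0 in the equality case. -/
theorem invSqrtRegDeriv_le (hε : 0 < ε) (hε1 : ε ≤ 1) (y : ℝ) :
    (√(max y 1) ^ 3)⁻¹ / 2 ≤ -invSqrtRegDeriv ε y := by
  have h1 : max y (ε ^ 2) ≤ max y 1 := max_le_max_left _ (by nlinarith)
  have h2 : 0 < √(max y (ε ^ 2)) :=
    Real.sqrt_pos.2 (lt_of_lt_of_le (by positivity) (le_max_right _ _))
  have h3 : (√(max y 1) ^ 3)⁻¹ ≤ (√(max y (ε ^ 2)) ^ 3)⁻¹ :=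
    inv_anti₀ (by positivity) (pow_le_pow_left₀ h2.le (Real.sqrt_le_sqrt h1) 3)
  rw [invSqrtRegDeriv]
  linarith

/-- The primitive of `g / (2 ρ(√y))` for `g = invSqrtReg ε`. -/
def heightReg (ρ : ℝ → ℝ) (ε y : ℝ) : ℝ := ∫ z in (0 : ℝ)..y, invSqrtReg ε z / (2 * ρ √z)

variable {ρ h : ℝ → ℝ} {μ δ : ℝ}

theorem continuous_heightReg_integrand (hρ : IsCylindricalProfile ρ) (hε : 0 < ε) :
    Continuous fun z => invSqrtReg ε z / (2 * ρ √z) := by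
  refine (contDiff_invSqrtReg hε).continuous.div (continuous_const.mul hρ.continuous_sqrt) ?_
  exact fun z => (mul_pos two_pos (hρ.pos _ (Real.sqrt_nonneg z))).ne'

theorem hasDerivAt_heightReg (hρ : IsCylindricalProfile ρ) (hε : 0 < ε) (y : ℝ) :
    HasDerivAt (heightReg ρ ε) (invSqrtReg ε y / (2 * ρ √y)) y :=
  (continuous_heightReg_integrand hρ hε).integral_hasStrictDerivAt 0 y |>.hasDerivAt

theorem contDiff_heightReg (hρ : IsCylindricalProfile ρ) (hε : 0 < ε) :
    ContDiff ℝ 1 (heightReg ρ ε) := by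
  rw [contDiff_one_iff_deriv]
  refine ⟨fun y => (hasDerivAt_heightReg hρ hε y).differentiableAt, ?_⟩
  rw [show deriv (heightReg ρ ε) = fun y => invSqrtReg ε y / (2 * ρ √y) from
    funext fun y => (hasDerivAt_heightReg hρ hε y).deriv]
  exact continuous_heightReg_integrand hρ hε

theorem heightReg_zero : heightReg ρ ε 0 = 0 := intervalIntegral.integral_same

theorem strictMono_heightReg (hρ : IsCylindricalProfile ρ) (hε : 0 < ε) :
    StrictMono (heightReg ρ ε) := by
  refine strictMono_of_hasDerivAt_pos (hasDerivAt_heightReg hρ hε) fun y => ?_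
  exact div_pos (invSqrtReg_pos hε y) (mul_pos two_pos (hρ.pos _ (Real.sqrt_nonneg y)))

/-- Both sides vanish at 0, and the derivatives compare since ρ ≥ 1 and the regularization lies
below 1/√y. -/
theorem heightReg_le_sqrt (hρ : IsCylindricalProfile ρ) (hε : 0 < ε) (hy : 0 ≤ y) :
    heightReg ρ ε y ≤ √y := by
  have h1 : MonotoneOn (fun y => √y - heightReg ρ ε y) (Ici 0) := by
    refine monotoneOn_of_deriv_nonneg (convex_Ici 0) ?_ ?_ ?_
    · exact (Real.continuous_sqrt.sub (contDiff_heightReg hρ hε).continuous).continuousOn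
    · intro z hz
      rw [interior_Ici] at hz
      exact ((Real.hasDerivAt_sqrt (ne_of_gt hz)).sub
        (hasDerivAt_heightReg hρ hε z)).differentiableAt.differentiableWithinAt
    · intro z hz
      rw [interior_Ici] at hz
      have hz : 0 < z := hz
      rw [HasDerivAt.deriv (f := fun y => √y - heightReg ρ ε y)
        ((Real.hasDerivAt_sqrt hz.ne').sub (hasDerivAt_heightReg hρ hε z)), sub_nonneg]
      have h2 := Real.sqrt_pos.2 hz
      have h3 := hρ.one_le h2.le
      calc invSqrtReg ε z / (2 * ρ √z) ≤ (√z)⁻¹ / (2 * 1) := by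
            gcongr
            exact invSqrtReg_le hε hz
        _ = 1 / (2 * √z) := by field_simp
  have h2 := h1 (mem_Ici.2 le_rfl) hy hy
  simp only [Real.sqrt_zero, heightReg_zero, sub_zero] at h2
  linarith

/-- A lower Lipschitz constant independent of ε on y ≤ R, used to recover a difference of |p|² from
a difference of heights. -/
theorem heightReg_sub_ge (hρ : IsCylindricalProfile ρ) (hε : 0 < ε) (hε1 : ε ≤ 1) {R y₁ y₂ : ℝ}
    (h1 : y₁ ≤ y₂) (hR : 1 ≤ R) (h2 : y₂ ≤ R) :
    (√R)⁻¹ / (2 * ρ √R) * (y₂ - y₁) ≤ heightReg ρ ε y₂ - heightReg ρ ε y₁ := by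
  refine Convex.mul_sub_le_image_sub_of_le_deriv (convex_Iic R) 
    (contDiff_heightReg hρ hε).continuous.continuousOn
    ((contDiff_heightReg hρ hε).differentiable one_ne_zero).differentiableOn ?_ y₁ (h1.trans h2)
    y₂ h2 h1
  intro z hz
  rw [interior_Iic] at hz
  rw [(hasDerivAt_heightReg hρ hε z).deriv]
  have h3 : (√R)⁻¹ ≤ invSqrtReg ε z := by
    refine le_trans ?_ (inv_sqrt_max_le_invSqrtReg hε z)
    refine inv_anti₀ (Real.sqrt_pos.2 (lt_of_lt_of_le (by positivity) (le_max_right _ _)))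
      (Real.sqrt_le_sqrt (max_le (le_of_lt hz) ?_))
    nlinarith
  have h4 : ρ √z ≤ ρ √R := hρ.mono (Real.sqrt_nonneg z) (Real.sqrt_nonneg R)
    (Real.sqrt_le_sqrt (le_of_lt hz))
  have h5 := hρ.pos _ (Real.sqrt_nonneg z)
  exact div_le_div₀ (invSqrtReg_pos hε z).le h3 (by linarith) (by linarith)

/-- Viewed as a function of the height, h' is C-Lipschitz uniformly in ε: its derivative is h''ρ for
y > 1, and h' = 0 for y ≤ 1, which contains the regularized range. -/
theorem deriv_sqrt_sub_le (hρ : IsCylindricalProfile ρ) (hh : IsLinearProfile μ δ h) (hε : 0 < ε)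
    (hε1 : ε ≤ 1) {C : ℝ} (hC0 : 0 ≤ C) (hC : ∀ r, 0 < r → deriv (deriv h) r * ρ r ≤ C) {y₁ y₂ : ℝ}
    (hy : y₁ ≤ y₂) :
    deriv h √y₂ - deriv h √y₁ ≤ C * (heightReg ρ ε y₂ - heightReg ρ ε y₁) := by
  have h0 : MonotoneOn (fun y => C * heightReg ρ ε y - deriv h √y) (Iic 1) := by
    intro z hz w hw hzw
    have h1 : ∀ z : ℝ, z ≤ 1 → deriv h √z = 0 := fun z hz =>
      hh.deriv_eq_zero (Real.sqrt_nonneg z) (Real.sqrt_le_one.2 hz)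
    simp only [h1 z hz, h1 w hw, sub_zero]
    exact mul_le_mul_of_nonneg_left ((strictMono_heightReg hρ hε).monotone hzw) hC0
  have h1 : MonotoneOn (fun y => C * heightReg ρ ε y - deriv h √y) (Ici 1) := by
    have h3 : ∀ z : ℝ, 1 < z → HasDerivAt (fun y => C * heightReg ρ ε y - deriv h √y)
        (C * (invSqrtReg ε z / (2 * ρ √z)) - deriv (deriv h) √z * (1 / (2 * √z))) z := by
      intro z hz
      have hz0 : 0 < z := by linarith
      have h4 := ((hh.contDiffAt_deriv (Real.sqrt_pos.2 hz0)).differentiableAt (by simp)).hasDerivAt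
      exact ((hasDerivAt_heightReg hρ hε z).const_mul C).sub
        (h4.comp z (Real.hasDerivAt_sqrt hz0.ne'))
    refine monotoneOn_of_deriv_nonneg (convex_Ici 1) ?_ ?_ ?_
    · exact ((continuous_const.mul (contDiff_heightReg hρ hε).continuous).sub
        hh.continuous_deriv_sqrt).continuousOn
    · intro z hz
      rw [interior_Ici] at hz
      exact (h3 z hz).differentiableAt.differentiableWithinAt
    · intro z hz
      rw [interior_Ici] at hz
      have hz : 1 < z := hz
      have hs : 0 < √z := Real.sqrt_pos.2 (by linarith)
      have h4 := hρ.pos _ hs.le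
      rw [(h3 z hz).deriv, sub_nonneg, invSqrtReg_of_le hε (by nlinarith)]
      calc deriv (deriv h) √z * (1 / (2 * √z)) =
            (deriv (deriv h) √z * ρ √z) * ((√z)⁻¹ / (2 * ρ √z)) := by field_simp
        _ ≤ _ := mul_le_mul_of_nonneg_right (hC _ hs) (by positivity)
  have h2 := h0.union_right h1 isGreatest_Iic isLeast_Ici
  rw [Iic_union_Ici] at h2
  have h3 := h2 (mem_univ y₁) (mem_univ y₂) hy
  simp only at h3
  linarith

end Regularization

end

/-! ### Monotonicity of the regularized integral of α. -/

section

section StripIntegral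

variable {I : Set ℝ} {F G : ℝ × ℝ → ℝ} {s : ℝ} {F₁ G₂ : ℝ → ℝ}

theorem continuous_slice (hF : ContinuousOn F (I ×ˢ univ)) (hs : s ∈ I) :
    Continuous fun t => F (s, t) :=
  hF.comp_continuous (by fun_prop) fun t => ⟨hs, mem_univ t⟩

theorem continuous_fderiv_slice (hI : IsOpen I) (hF : ContDiffOn ℝ 1 F (I ×ˢ univ)) (hs : s ∈ I)
    (e : ℝ × ℝ) : Continuous fun t => fderiv ℝ F (s, t) e :=
  continuous_slice (F := fun z => fderiv ℝ F z e)
    ((hF.continuousOn_fderiv_of_isOpen (hI.prod isOpen_univ) le_rfl).clm_apply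
      continuousOn_const) hs

theorem hasFDerivAt_strip (hI : IsOpen I) (hF : ContDiffOn ℝ 1 F (I ×ˢ univ)) (hs : s ∈ I) (t : ℝ) :
    HasFDerivAt F (fderiv ℝ F (s, t)) (s, t) :=
  ((hF.contDiffAt ((hI.prod isOpen_univ).mem_nhds ⟨hs, mem_univ t⟩)).differentiableAt
    one_ne_zero).hasFDerivAt

theorem hasDerivAt_strip_fst (hI : IsOpen I) (hF : ContDiffOn ℝ 1 F (I ×ˢ univ)) (hs : s ∈ I)
    (t : ℝ) : HasDerivAt (fun s => F (s, t)) (fderiv ℝ F (s, t) (1, 0)) s :=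
  (hasFDerivAt_strip hI hF hs t).comp_hasDerivAt (f := fun s => (s, t)) s
    ((hasDerivAt_id s).prodMk (hasDerivAt_const s t))

theorem hasDerivAt_strip_snd (hI : IsOpen I) (hF : ContDiffOn ℝ 1 F (I ×ˢ univ)) (hs : s ∈ I)
    (t : ℝ) : HasDerivAt (fun t => F (s, t)) (fderiv ℝ F (s, t) (0, 1)) t :=
  (hasFDerivAt_strip hI hF hs t).comp_hasDerivAt (f := fun t => (s, t)) t
    ((hasDerivAt_const t s).prodMk (hasDerivAt_id t))

theorem continuous_deriv_fst (hI : IsOpen I) (hF : ContDiffOn ℝ 1 F (I ×ˢ univ)) (hs : s ∈ I)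
    (hF₁ : ∀ t, HasDerivAt (fun s => F (s, t)) (F₁ t) s) : Continuous F₁ := by
  rw [show F₁ = fun t => fderiv ℝ F (s, t) (1, 0) from
    funext fun t => (hF₁ t).unique (hasDerivAt_strip_fst hI hF hs t)]
  exact continuous_fderiv_slice hI hF hs _

theorem continuous_deriv_snd (hI : IsOpen I) (hG : ContDiffOn ℝ 1 G (I ×ˢ univ)) (hs : s ∈ I)
    (hG₂ : ∀ t, HasDerivAt (fun t => G (s, t)) (G₂ t) t) : Continuous G₂ := by
  rw [show G₂ = fun t => fderiv ℝ G (s, t) (0, 1) from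
    funext fun t => (hG₂ t).unique (hasDerivAt_strip_snd hI hG hs t)]
  exact continuous_fderiv_slice hI hG hs _

/-- Differentiation under the integral sign on a strip. -/
theorem hasDerivAt_integral_strip (hI : IsOpen I) (hF : ContDiffOn ℝ 1 F (I ×ˢ univ)) (hs : s ∈ I)
    (hF₁ : ∀ t, HasDerivAt (fun s => F (s, t)) (F₁ t) s) :
    HasDerivAt (fun s => ∫ t in (0 : ℝ)..1, F (s, t)) (∫ t in (0 : ℝ)..1, F₁ t) s := by
  obtain ⟨r, hr, hrI⟩ := Metric.nhds_basis_closedBall.mem_iff.1 (hI.mem_nhds hs)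
  have hcont : ContinuousOn (fun z => fderiv ℝ F z (1, 0)) (I ×ˢ univ) :=
    (hF.continuousOn_fderiv_of_isOpen (hI.prod isOpen_univ) le_rfl).clm_apply continuousOn_const
  have hK : IsCompact (Metric.closedBall s r ×ˢ Icc (0 : ℝ) 1) :=
    (isCompact_closedBall s r).prod isCompact_Icc
  obtain ⟨C, hC⟩ := hK.exists_bound_of_continuousOn
    (hcont.mono (prod_mono hrI (subset_univ _)))
  rw [show F₁ = fun t => fderiv ℝ F (s, t) (1, 0) from
    funext fun t => (hF₁ t).unique (hasDerivAt_strip_fst hI hF hs t)]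
  refine (intervalIntegral.hasDerivAt_integral_of_dominated_loc_of_deriv_le
    (F := fun s t => F (s, t)) (F' := fun s t => fderiv ℝ F (s, t) (1, 0))
    (bound := fun _ => C) (Metric.closedBall_mem_nhds s hr) ?_ ?_ ?_ ?_ ?_ ?_).2
  · filter_upwards [hI.mem_nhds hs] with s' hs'
    exact (continuous_slice hF.continuousOn hs').aestronglyMeasurable
  · exact (continuous_slice hF.continuousOn hs).intervalIntegrable _ _
  · exact (continuous_fderiv_slice hI hF hs _).aestronglyMeasurable
  · refine Eventually.of_forall fun t ht s' hs' => hC (s', t) ⟨hs', ?_⟩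
    rw [uIoc_of_le zero_le_one] at ht
    exact ⟨ht.1.le, ht.2⟩
  · exact intervalIntegrable_const
  · exact Eventually.of_forall fun t _ y hy => hasDerivAt_strip_fst hI hF (hrI hy) t

/-- Differentiation under the integral sign on a strip, up to the `t`-derivative of a function
that is periodic in `t`. -/
theorem hasDerivAt_integral_strip_sub (hI : IsOpen I) (hF : ContDiffOn ℝ 1 F (I ×ˢ univ))
    (hG : ContDiffOn ℝ 1 G (I ×ˢ univ)) (hs : s ∈ I) (hper : G (s, 1) = G (s, 0))
    (hF₁ : ∀ t, HasDerivAt (fun s => F (s, t)) (F₁ t) s)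
    (hG₂ : ∀ t, HasDerivAt (fun t => G (s, t)) (G₂ t) t) :
    HasDerivAt (fun s => ∫ t in (0 : ℝ)..1, F (s, t)) (∫ t in (0 : ℝ)..1, (F₁ t - G₂ t)) s := by
  have h1 := hasDerivAt_integral_strip hI hF hs hF₁
  have c2 := (continuous_deriv_snd hI hG hs hG₂).intervalIntegrable 0 1 (μ := MeasureTheory.volume)
  -- A t-derivative of a periodic function may be subtracted for free; this is integration by parts
  -- on the circle.
  have h2 : ∫ t in (0 : ℝ)..1, G₂ t = 0 := by
    rw [intervalIntegral.integral_eq_sub_of_hasDerivAt (fun t _ => hG₂ t) c2, hper, sub_self]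
  rw [intervalIntegral.integral_sub ((continuous_deriv_fst hI hF hs hF₁).intervalIntegrable _ _) c2,
    h2, sub_zero]
  exact h1

end StripIntegral

section Shift

variable {E : Type*} [NormedAddCommGroup E] [NormedSpace ℝ E]

open scoped Pointwise in
theorem fderivWithin_halfStrip_shift (f : ℝ × ℝ → E) (c : ℝ) (z : ℝ × ℝ) :
    fderivWithin ℝ (fun z => f (z + (0, c))) halfStrip z =
      fderivWithin ℝ f halfStrip (z + (0, c)) := by
  have h1 := fderivWithin_comp_add_right (𝕜 := ℝ) (f := f) (s := halfStrip) (x := z)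
    ((0, c) : ℝ × ℝ)
  have h2 : ((0, c) : ℝ × ℝ) +ᵥ halfStrip = halfStrip := by
    ext ⟨x, y⟩
    simp [mem_vadd_set_iff_neg_vadd_mem, halfStrip]
  rw [h2] at h1
  exact h1

end Shift

namespace IsFloerScalars

variable {ρ h : ℝ → ℝ} {μ δ ε s t : ℝ} {N a b Q S : ℝ × ℝ → ℝ}

/-- The system is autonomous in t. The rotated solution is the competitor used to show that |p| does
not depend on t. -/
theorem shift (hS : IsFloerScalars ρ h N a b Q S) (c : ℝ) :
    IsFloerScalars ρ h (fun z => N (z + (0, c))) (fun z => a (z + (0, c)))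
      (fun z => b (z + (0, c))) (fun z => Q (z + (0, c))) (fun z => S (z + (0, c))) := by
  have hm : MapsTo (fun z : ℝ × ℝ => z + (0, c)) halfStrip halfStrip := by
    rintro ⟨s, t⟩ hz
    simpa [halfStrip] using hz
  have hc : ∀ {f : ℝ × ℝ → ℝ}, ContDiffOn ℝ ∞ f halfStrip →
      ContDiffOn ℝ ∞ (fun z => f (z + (0, c))) halfStrip := fun hf =>
    hf.comp (contDiff_id.add contDiff_const).contDiffOn hm
  have hp : ∀ {f : ℝ × ℝ → ℝ}, (∀ s t, 0 ≤ s → f (s, t + 1) = f (s, t)) →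
      ∀ s t, 0 ≤ s → f ((s, t + 1) + (0, c)) = f ((s, t) + (0, c)) := by
    intro f hf s t hs
    have := hf s (t + c) hs
    simp only [Prod.mk_add_mk, add_zero]
    rw [← this]
    congr 2
    ring
  exact
  { smooth_N := hc hS.smooth_N
    smooth_a := hc hS.smooth_a
    smooth_b := hc hS.smooth_b
    cont_Q := hS.cont_Q.comp (by fun_prop) hm
    cont_S := hS.cont_S.comp (by fun_prop) hm
    periodic_N := hp hS.periodic_N
    periodic_a := hp hS.periodic_a
    periodic_b := hp hS.periodic_b
    N_nonneg := fun z => hS.N_nonneg _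
    Q_nonneg := fun z => hS.Q_nonneg _
    S_nonneg := fun z => hS.S_nonneg _
    a_sq_le := fun z => hS.a_sq_le _
    b_sq_le := fun z => hS.b_sq_le _
    ds_N := fun z hz => by rw [fderivWithin_halfStrip_shift, hS.ds_N _ (hm hz)]
    dt_N := fun z hz => by rw [fderivWithin_halfStrip_shift, hS.dt_N _ (hm hz)]
    curl := fun z hz => by
      rw [fderivWithin_halfStrip_shift, fderivWithin_halfStrip_shift, hS.curl _ (hm hz)]
    N_zero := fun t => by simpa using hS.N_zero (t + c)
    S_zero := fun t => by simpa using hS.S_zero (t + c) }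

theorem open_subset_halfStrip : Ioi (0 : ℝ) ×ˢ (univ : Set ℝ) ⊆ halfStrip :=
  prod_mono Ioi_subset_Ici_self subset_rfl

theorem contDiffOn_N (hS : IsFloerScalars ρ h N a b Q S) :
    ContDiffOn ℝ 1 N (Ioi (0 : ℝ) ×ˢ univ) :=
  (hS.smooth_N.mono open_subset_halfStrip).of_le (by simp)

theorem contDiffOn_a (hS : IsFloerScalars ρ h N a b Q S) :
    ContDiffOn ℝ 1 a (Ioi (0 : ℝ) ×ˢ univ) :=
  (hS.smooth_a.mono open_subset_halfStrip).of_le (by simp)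

theorem contDiffOn_b (hS : IsFloerScalars ρ h N a b Q S) :
    ContDiffOn ℝ 1 b (Ioi (0 : ℝ) ×ˢ univ) :=
  (hS.smooth_b.mono open_subset_halfStrip).of_le (by simp)

theorem hasDerivWithinAt_fst {f : ℝ × ℝ → ℝ} (hf : ContDiffOn ℝ ∞ f halfStrip) (hs : 0 ≤ s) :
    HasDerivWithinAt (fun s => f (s, t)) (fderivWithin ℝ f halfStrip (s, t) (1, 0)) (Ici 0) s :=
  hasDerivWithinAt_halfStrip_fst ((hf (s, t) (mem_halfStrip.2 hs)).differentiableWithinAt (by simp))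

theorem hasDerivAt_fst {f : ℝ × ℝ → ℝ} (hf : ContDiffOn ℝ ∞ f halfStrip) (hs : 0 < s) :
    HasDerivAt (fun s => f (s, t)) (fderivWithin ℝ f halfStrip (s, t) (1, 0)) s :=
  (hasDerivWithinAt_fst hf hs.le).hasDerivAt (Ici_mem_nhds hs)

theorem hasDerivAt_snd {f : ℝ × ℝ → ℝ} (hf : ContDiffOn ℝ ∞ f halfStrip) (hs : 0 ≤ s) :
    HasDerivAt (fun t => f (s, t)) (fderivWithin ℝ f halfStrip (s, t) (0, 1)) t :=
  hasDerivAt_halfStrip_snd ((hf (s, t) (mem_halfStrip.2 hs)).differentiableWithinAt (by simp)) hs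

theorem hasDerivAt_N_fst (hS : IsFloerScalars ρ h N a b Q S) (hs : 0 < s) :
    HasDerivAt (fun s => N (s, t)) (2 * ρ √(N (s, t)) *
      (a (s, t) - deriv h √(N (s, t)) / √(N (s, t)) * N (s, t))) s := by
  rw [← hS.ds_N _ (mem_halfStrip.2 hs.le)]
  exact hasDerivAt_fst hS.smooth_N hs

theorem hasDerivAt_N_snd (hS : IsFloerScalars ρ h N a b Q S) (hs : 0 ≤ s) :
    HasDerivAt (fun t => N (s, t)) (-(2 * ρ √(N (s, t)) * b (s, t))) t := by
  rw [← hS.dt_N _ (mem_halfStrip.2 hs)]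
  exact hasDerivAt_snd hS.smooth_N hs

/-- The derivative of a weighted integral of `a = p(∂_t q)`. -/
theorem hasDerivAt_integral_weight (hS : IsFloerScalars ρ h N a b Q S) {w : ℝ × ℝ → ℝ}
    {w₁ w₂ : ℝ → ℝ} (hw : ContDiffOn ℝ 1 w (Ioi (0 : ℝ) ×ˢ univ)) (hs : 0 < s)
    (hper : w (s, 1) = w (s, 0)) (hw₁ : ∀ t, HasDerivAt (fun s => w (s, t)) (w₁ t) s)
    (hw₂ : ∀ t, HasDerivAt (fun t => w (s, t)) (w₂ t) t) :
    HasDerivAt (fun s => ∫ t in (0 : ℝ)..1, w (s, t) * a (s, t))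
      (∫ t in (0 : ℝ)..1, (w₁ t * a (s, t) - w₂ t * b (s, t) + w (s, t) * (ρ √(N (s, t)) *
        (Q (s, t) - deriv h √(N (s, t)) / √(N (s, t)) * a (s, t) + S (s, t))))) s := by
  have hb : b (s, 1) = b (s, 0) := by simpa using hS.periodic_b s 0 hs.le
  have h1 := hasDerivAt_integral_strip_sub isOpen_Ioi (hw.mul hS.contDiffOn_a)
    (hw.mul hS.contDiffOn_b) hs (by simp only [hper, hb])
    (fun t => (hw₁ t).mul (hasDerivAt_fst hS.smooth_a hs))
    (fun t => (hw₂ t).mul (hasDerivAt_snd hS.smooth_b hs.le))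
  refine h1.congr_deriv (intervalIntegral.integral_congr fun t _ => ?_)
  simp only [← hS.curl (s, t) (mem_halfStrip.2 hs.le)]
  ring

/-- The regularized integral of `p dq / |p|` over the loop `u(s, ·)`. -/
def contactReg (N a : ℝ × ℝ → ℝ) (ε s : ℝ) : ℝ :=
  ∫ t in (0 : ℝ)..1, invSqrtReg ε (N (s, t)) * a (s, t)

/-- The density of the derivative of `contactReg`. -/
def contactRegDensity (ρ : ℝ → ℝ) (N a b Q S : ℝ × ℝ → ℝ) (ε : ℝ) (z : ℝ × ℝ) : ℝ :=
  ρ √(N z) * (invSqrtReg ε (N z) * (Q z + S z) +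
    2 * invSqrtRegDeriv ε (N z) * (a z ^ 2 + b z ^ 2))

/-- The angular profile vanishes where `invSqrtReg` is not `1 / √y`. -/
theorem deriv_mul_reg_eq_zero (hh : IsLinearProfile μ δ h) (hε : 0 < ε) (hε1 : ε ≤ 1) {y : ℝ} :
    deriv h √y * (invSqrtReg ε y + 2 * y * invSqrtRegDeriv ε y) = 0 := by
  rcases le_total y 1 with hy | hy
  · rw [hh.deriv_eq_zero (Real.sqrt_nonneg y) (Real.sqrt_le_one.2 hy), zero_mul]
  · rw [invSqrtReg_add_eq_zero hε (by nlinarith), mul_zero]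

theorem deriv_mul_reg_mul_sqrt (hh : IsLinearProfile μ δ h) (hε : 0 < ε) (hε1 : ε ≤ 1) {y : ℝ} :
    deriv h √y / √y * y * invSqrtReg ε y = deriv h √y := by
  rcases le_total y 1 with hy | hy
  · rw [hh.deriv_eq_zero (Real.sqrt_nonneg y) (Real.sqrt_le_one.2 hy), zero_div, zero_mul, zero_mul]
  · rw [invSqrtReg_of_le hε (by nlinarith)]
    have h1 : 0 < √y := Real.sqrt_pos.2 (by linarith)
    nth_rewrite 3 [← Real.mul_self_sqrt (by linarith : 0 ≤ y)]
    field_simp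

theorem contDiffOn_reg (hS : IsFloerScalars ρ h N a b Q S) (hε : 0 < ε) :
    ContDiffOn ℝ 1 (fun z => invSqrtReg ε (N z)) (Ioi (0 : ℝ) ×ˢ univ) :=
  (contDiff_invSqrtReg hε).comp_contDiffOn hS.contDiffOn_N

/-- The weight g(N) contributes through ∂_s N and ∂_t N. The terms containing h' add up to a
multiple of h'(g + 2Ng'), which vanishes: h' = 0 for N ≤ 1, and g = 1/√N for N ≥ ε². -/
theorem hasDerivAt_contactReg (hS : IsFloerScalars ρ h N a b Q S) (hh : IsLinearProfile μ δ h)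
    (hε : 0 < ε) (hε1 : ε ≤ 1) (hs : 0 < s) :
    HasDerivAt (contactReg N a ε) (∫ t in (0 : ℝ)..1, contactRegDensity ρ N a b Q S ε (s, t)) s := by
  have hN : N (s, 1) = N (s, 0) := by simpa using hS.periodic_N s 0 hs.le
  have h1 := hS.hasDerivAt_integral_weight (hS.contDiffOn_reg hε) hs (by simp only [hN])
    (fun t => (hasDerivAt_invSqrtReg hε _).comp s (hS.hasDerivAt_N_fst hs))
    (fun t => (hasDerivAt_invSqrtReg hε _).comp t (hS.hasDerivAt_N_snd hs.le))
  refine h1.congr_deriv (intervalIntegral.integral_congr fun t _ => ?_)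
  have h2 := deriv_mul_reg_eq_zero hh hε hε1 (y := N (s, t))
  simp only [contactRegDensity]
  linear_combination (-(ρ √(N (s, t)) * a (s, t) / √(N (s, t)))) * h2

/-- The density equals ρ times (g + 2Ng')(Q + S) - 2g'((NQ - a²) + (NS - b²)). The first summand is
nonnegative, and -2g' has a bound free of ε. -/
theorem density_ge (hS : IsFloerScalars ρ h N a b Q S) (hρ : IsCylindricalProfile ρ)
    (hε : 0 < ε) (hε1 : ε ≤ 1) (z : ℝ × ℝ) :
    ρ √(N z) * ((√(max (N z) 1) ^ 3)⁻¹ * (N z * Q z - a z ^ 2 + (N z * S z - b z ^ 2))) ≤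
      contactRegDensity ρ N a b Q S ε z := by
  refine mul_le_mul_of_nonneg_left ?_ (hρ.pos _ (Real.sqrt_nonneg _)).le
  have h1 := mul_nonneg (invSqrtReg_add_nonneg hε (hS.N_nonneg z))
    (add_nonneg (hS.Q_nonneg z) (hS.S_nonneg z))
  have h2 := mul_le_mul_of_nonneg_right (invSqrtRegDeriv_le hε hε1 (N z))
    (add_nonneg (sub_nonneg.2 (hS.a_sq_le z)) (sub_nonneg.2 (hS.b_sq_le z)))
  linarith

theorem density_nonneg (hS : IsFloerScalars ρ h N a b Q S) (hρ : IsCylindricalProfile ρ)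
    (hε : 0 < ε) (hε1 : ε ≤ 1) (z : ℝ × ℝ) : 0 ≤ contactRegDensity ρ N a b Q S ε z := by
  refine le_trans ?_ (hS.density_ge hρ hε hε1 z)
  refine mul_nonneg (hρ.pos _ (Real.sqrt_nonneg _)).le (mul_nonneg (by positivity) ?_)
  exact add_nonneg (sub_nonneg.2 (hS.a_sq_le z)) (sub_nonneg.2 (hS.b_sq_le z))

theorem continuousOn_density (hS : IsFloerScalars ρ h N a b Q S) (hρ : IsCylindricalProfile ρ)
    (hε : 0 < ε) : ContinuousOn (contactRegDensity ρ N a b Q S ε) halfStrip := by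
  have hN := hS.smooth_N.continuousOn
  refine (hρ.continuous_sqrt.comp_continuousOn hN).mul (ContinuousOn.add ?_ ?_)
  · exact ((contDiff_invSqrtReg hε).continuous.comp_continuousOn hN).mul (hS.cont_Q.add hS.cont_S)
  · exact (continuousOn_const.mul ((continuous_invSqrtRegDeriv hε).comp_continuousOn hN)).mul
      ((hS.smooth_a.continuousOn.pow 2).add (hS.smooth_b.continuousOn.pow 2))

theorem monotoneOn_contactReg (hS : IsFloerScalars ρ h N a b Q S) (hρ : IsCylindricalProfile ρ)
    (hh : IsLinearProfile μ δ h) (hε : 0 < ε) (hε1 : ε ≤ 1) :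
    MonotoneOn (contactReg N a ε) (Ioi 0) := by
  refine monotoneOn_of_deriv_nonneg (convex_Ioi 0) (fun s hs =>
    (hS.hasDerivAt_contactReg hh hε hε1 hs).continuousAt.continuousWithinAt) ?_ ?_
  · rw [interior_Ioi]
    exact fun s hs =>
      (hS.hasDerivAt_contactReg hh hε hε1 hs).differentiableAt.differentiableWithinAt
  · rw [interior_Ioi]
    intro s hs
    rw [(hS.hasDerivAt_contactReg hh hε hε1 hs).deriv]
    exact intervalIntegral.integral_nonneg zero_le_one fun t _ => hS.density_nonneg hρ hε hε1 _

end IsFloerScalars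

end

/-! ### Limits at both ends and the length inequality. -/

section

/-- The function `√N` on the half-strip converges to `r` at infinity, uniformly in `t`. -/
def TendsToRadius (N : ℝ × ℝ → ℝ) (r : ℝ) : Prop :=
  ∀ η > 0, ∃ T, ∀ s ≥ T, ∀ t, |√(N (s, t)) - r| < η

namespace IsFloerScalars

variable {ρ h : ℝ → ℝ} {μ δ ε s t r : ℝ} {N a b Q S : ℝ × ℝ → ℝ}

/-- Large s is controlled by the limit radius, the rest by compactness of [0, T] × [0, 1] and
periodicity. -/
theorem exists_N_le (hS : IsFloerScalars ρ h N a b Q S) (hN : TendsToRadius N r) :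
    ∃ R, 1 ≤ R ∧ ∀ s t, 0 ≤ s → N (s, t) ≤ R := by
  obtain ⟨T, hT⟩ := hN 1 one_pos
  have hK : IsCompact (Icc 0 T ×ˢ Icc (0 : ℝ) 1) := isCompact_Icc.prod isCompact_Icc
  obtain ⟨C, hC⟩ := hK.bddAbove_image (f := N) (hS.smooth_N.continuousOn.mono fun z hz => hz.1.1
    |> fun h0 => (⟨h0, mem_univ _⟩ : z ∈ halfStrip))
  refine ⟨max (max C ((|r| + 1) ^ 2)) 1, le_max_right _ _, fun s t hs => ?_⟩
  rcases le_total T s with h1 | h1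
  · refine le_trans ?_ ((le_max_right _ _).trans (le_max_left _ _))
    rw [← Real.sq_sqrt (hS.N_nonneg (s, t))]
    have h2 := abs_lt.1 (hT s h1 t)
    exact pow_le_pow_left₀ (Real.sqrt_nonneg _) (by linarith [le_abs_self r]) 2
  · refine le_trans ?_ ((le_max_left _ _).trans (le_max_left _ _))
    have hp : Function.Periodic (fun t => N (s, t)) 1 := fun t => hS.periodic_N s t hs
    obtain ⟨t', ht', h2 : N (s, t) = N (s, t')⟩ := hp.exists_mem_Ico₀ one_pos t
    rw [h2]
    exact hC (mem_image_of_mem N (⟨⟨hs, h1⟩, ht'.1, ht'.2.le⟩ : (s, t') ∈ Icc 0 T ×ˢ Icc (0 : ℝ) 1))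

theorem exists_deriv_sub_lt (hh : IsLinearProfile μ δ h) (hN : TendsToRadius N r) (hr : 0 < r)
    {η : ℝ} (hη : 0 < η) : ∃ T, ∀ s ≥ T, ∀ t, |deriv h √(N (s, t)) - deriv h r| < η := by
  obtain ⟨d, hd, h1⟩ := Metric.continuousAt_iff.1 (hh.contDiffAt_deriv hr).continuousAt η hη
  obtain ⟨T, hT⟩ := hN d hd
  exact ⟨T, fun s hs t => h1 (hT s hs t)⟩

theorem continuous_N_slice (hS : IsFloerScalars ρ h N a b Q S) (hs : 0 ≤ s) :
    Continuous fun t => N (s, t) :=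
  continuous_slice (I := Ici 0) hS.smooth_N.continuousOn hs

theorem continuous_a_slice (hS : IsFloerScalars ρ h N a b Q S) (hs : 0 ≤ s) :
    Continuous fun t => a (s, t) :=
  continuous_slice (I := Ici 0) hS.smooth_a.continuousOn hs

/-- The height is defined so that the factor 2ρ in ∂_s N cancels; its s-derivative is the integrand
of `contactReg` minus h'. -/
theorem hasDerivAt_height_fst (hS : IsFloerScalars ρ h N a b Q S) (hρ : IsCylindricalProfile ρ)
    (hh : IsLinearProfile μ δ h) (hε : 0 < ε) (hε1 : ε ≤ 1) (hs : 0 < s) :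
    HasDerivAt (fun s => heightReg ρ ε (N (s, t)))
      (invSqrtReg ε (N (s, t)) * a (s, t) - deriv h √(N (s, t))) s := by
  refine ((hasDerivAt_heightReg hρ hε _).comp s (hS.hasDerivAt_N_fst hs)).congr_deriv ?_
  have h1 := (hρ.pos _ (Real.sqrt_nonneg (N (s, t)))).ne'
  have h2 := deriv_mul_reg_mul_sqrt hh hε hε1 (y := N (s, t))
  have h3 : invSqrtReg ε (N (s, t)) / (2 * ρ √(N (s, t))) * (2 * ρ √(N (s, t)) *
      (a (s, t) - deriv h √(N (s, t)) / √(N (s, t)) * N (s, t))) = invSqrtReg ε (N (s, t)) *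
      (a (s, t) - deriv h √(N (s, t)) / √(N (s, t)) * N (s, t)) := by
    rw [← mul_assoc, div_mul_cancel₀ _ (mul_ne_zero two_ne_zero h1)]
  rw [h3]
  linear_combination -h2

theorem hasDerivAt_height_snd (hS : IsFloerScalars ρ h N a b Q S) (hρ : IsCylindricalProfile ρ)
    (hε : 0 < ε) (hs : 0 ≤ s) :
    HasDerivAt (fun t => heightReg ρ ε (N (s, t))) (-(invSqrtReg ε (N (s, t)) * b (s, t))) t := by
  refine ((hasDerivAt_heightReg hρ hε _).comp t (hS.hasDerivAt_N_snd hs)).congr_deriv ?_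
  have h1 := (hρ.pos _ (Real.sqrt_nonneg (N (s, t)))).ne'
  field_simp

theorem contDiffOn_height (hS : IsFloerScalars ρ h N a b Q S) (hρ : IsCylindricalProfile ρ)
    (hε : 0 < ε) : ContDiffOn ℝ 1 (fun z => heightReg ρ ε (N z)) (Ioi (0 : ℝ) ×ˢ univ) :=
  (contDiff_heightReg hρ hε).comp_contDiffOn hS.contDiffOn_N

theorem height_mem (hS : IsFloerScalars ρ h N a b Q S) (hρ : IsCylindricalProfile ρ) (hε : 0 < ε)
    {R : ℝ} (hR : ∀ s t, 0 ≤ s → N (s, t) ≤ R) (hs : 0 ≤ s) :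
    0 ≤ heightReg ρ ε (N (s, t)) ∧ heightReg ρ ε (N (s, t)) ≤ √R := by
  constructor
  · rw [← heightReg_zero (ρ := ρ) (ε := ε)]
    exact (strictMono_heightReg hρ hε).monotone (hS.N_nonneg _)
  · exact (heightReg_le_sqrt hρ hε (hS.N_nonneg _)).trans (Real.sqrt_le_sqrt (hR s t hs))

/-- No convergence of ∂_t u is known as s tends to infinity. Instead the mean height over the circle
is bounded, so on [T, 2T] its derivative, `contactReg` minus the mean of h', is small somewhere; and
h' converges uniformly. -/
theorem exists_contactReg_near (hS : IsFloerScalars ρ h N a b Q S) (hρ : IsCylindricalProfile ρ)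
    (hh : IsLinearProfile μ δ h) (hN : TendsToRadius N r) (hr : 0 < r) (hε : 0 < ε) (hε1 : ε ≤ 1)
    {η : ℝ} (hη : 0 < η) :
    ∃ T₀, ∀ T ≥ T₀, ∃ s > T, |contactReg N a ε s - deriv h r| ≤ η := by
  obtain ⟨R, hR1, hR⟩ := hS.exists_N_le hN
  obtain ⟨T₁, hT₁⟩ := exists_deriv_sub_lt hh hN hr (half_pos hη)
  -- Mean heights lie in [0, √R], so a difference quotient over length T is at most √R/T ≤ η/2.
  refine ⟨max (max T₁ 1) (2 * √R / η), fun T hT => ?_⟩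
  have hT1 : T₁ ≤ T := ((le_max_left _ _).trans (le_max_left _ _)).trans hT
  have hT0 : 0 < T := lt_of_lt_of_le zero_lt_one
    (((le_max_right _ _).trans (le_max_left _ _)).trans hT)
  have hTR : 2 * √R / η ≤ T := (le_max_right _ _).trans hT
  have hd : ∀ s, 0 < s → HasDerivAt (fun s => ∫ t in (0 : ℝ)..1, heightReg ρ ε (N (s, t)))
      (∫ t in (0 : ℝ)..1, (invSqrtReg ε (N (s, t)) * a (s, t) - deriv h √(N (s, t)))) s := fun s hs =>
    hasDerivAt_integral_strip isOpen_Ioi (hS.contDiffOn_height hρ hε) hs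
      fun t => hS.hasDerivAt_height_fst hρ hh hε hε1 hs
  obtain ⟨s, hs, h1⟩ := exists_hasDerivAt_eq_slope _ _ (by linarith : T < 2 * T)
    (fun s hs => (hd s (lt_of_lt_of_le hT0 hs.1)).continuousAt.continuousWithinAt)
    (fun s hs => hd s (hT0.trans hs.1))
  have hs0 : 0 < s := hT0.trans hs.1
  refine ⟨s, hs.1, ?_⟩
  have hcY : ∀ s, 0 ≤ s → Continuous fun t => heightReg ρ ε (N (s, t)) := fun s hs =>
    (contDiff_heightReg hρ hε).continuous.comp (hS.continuous_N_slice hs)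
  have hY : ∀ s, 0 ≤ s → 0 ≤ (∫ t in (0 : ℝ)..1, heightReg ρ ε (N (s, t))) ∧
      (∫ t in (0 : ℝ)..1, heightReg ρ ε (N (s, t))) ≤ √R := by
    intro s hs
    refine ⟨intervalIntegral.integral_nonneg zero_le_one
      fun t _ => (hS.height_mem hρ hε hR hs).1, ?_⟩
    calc _ ≤ ∫ t in (0 : ℝ)..1, √R := intervalIntegral.integral_mono_on zero_le_one
          ((hcY s hs).intervalIntegrable _ _) intervalIntegrable_const
          fun t _ => (hS.height_mem hρ hε hR hs).2
      _ = √R := by simp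
  have hc1 : Continuous fun t => invSqrtReg ε (N (s, t)) * a (s, t) :=
    ((contDiff_invSqrtReg hε).continuous.comp (hS.continuous_N_slice hs0.le)).mul
      (hS.continuous_a_slice hs0.le)
  have hc2 : Continuous fun t => deriv h √(N (s, t)) :=
    hh.continuous_deriv_sqrt.comp (hS.continuous_N_slice hs0.le)
  rw [intervalIntegral.integral_sub (hc1.intervalIntegrable _ _) (hc2.intervalIntegrable _ _)] at h1
  have h2 : |(∫ t in (0 : ℝ)..1, deriv h √(N (s, t))) - deriv h r| ≤ η / 2 := by
    have h3 : (∫ t in (0 : ℝ)..1, deriv h √(N (s, t))) - deriv h r =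
        ∫ t in (0 : ℝ)..1, (deriv h √(N (s, t)) - deriv h r) := by
      rw [intervalIntegral.integral_sub (hc2.intervalIntegrable _ _) intervalIntegrable_const]
      simp
    rw [h3, ← Real.norm_eq_abs]
    refine (intervalIntegral.norm_integral_le_of_norm_le_const (C := η / 2) fun t _ => ?_).trans
      (by simp)
    exact (hT₁ s (hT1.trans hs.1.le) t).le
  have h4 : |contactReg N a ε s - ∫ t in (0 : ℝ)..1, deriv h √(N (s, t))| ≤ η / 2 := by
    rw [contactReg, h1, show 2 * T - T = T by ring, abs_div, abs_of_pos hT0, div_le_iff₀ hT0]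
    have h5 := hY (2 * T) (by linarith)
    have h6 := hY T hT0.le
    rw [div_le_iff₀ hη] at hTR
    rw [abs_le]
    constructor <;> linarith [h5.1, h5.2, h6.1, h6.2]
  calc _ = |(contactReg N a ε s - ∫ t in (0 : ℝ)..1, deriv h √(N (s, t))) +
        ((∫ t in (0 : ℝ)..1, deriv h √(N (s, t))) - deriv h r)| := by ring_nf
    _ ≤ _ := abs_add_le _ _
    _ ≤ η := by linarith

/-- By monotonicity it suffices to be near h'(r) at arbitrarily large times. -/
theorem contactReg_le (hS : IsFloerScalars ρ h N a b Q S) (hρ : IsCylindricalProfile ρ)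
    (hh : IsLinearProfile μ δ h) (hN : TendsToRadius N r) (hr : 0 < r) (hε : 0 < ε) (hε1 : ε ≤ 1)
    (hs : 0 < s) : contactReg N a ε s ≤ deriv h r := by
  refine le_of_forall_pos_le_add fun η hη => ?_
  obtain ⟨T₀, h1⟩ := hS.exists_contactReg_near hρ hh hN hr hε hε1 hη
  obtain ⟨s', hs', h2⟩ := h1 (max T₀ s) (le_max_left _ _)
  have h3 : s < s' := (le_max_right _ _).trans_lt hs'
  have h4 := hS.monotoneOn_contactReg hρ hh hε hε1 hs (hs.trans h3) h3.le
  linarith [(abs_le.1 h2).2]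

/-! #### Behaviour at the boundary -/

/-- Cauchy-Schwarz, uniformly in ε and valid at zeros of N; it provides the dominating function near
s = 0. -/
theorem abs_reg_mul_le (hS : IsFloerScalars ρ h N a b Q S) (hε : 0 < ε) (z : ℝ × ℝ) :
    |invSqrtReg ε (N z) * a z| ≤ √(Q z) := by
  have h1 : |a z| ≤ √(N z) * √(Q z) := by
    rw [← Real.sqrt_mul (hS.N_nonneg z)]
    exact Real.abs_le_sqrt (hS.a_sq_le z)
  rcases (hS.N_nonneg z).eq_or_lt with h0 | h0
  · rw [← h0, Real.sqrt_zero, zero_mul] at h1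
    rw [abs_eq_zero.1 (le_antisymm h1 (abs_nonneg _)), mul_zero, abs_zero]
    exact Real.sqrt_nonneg _
  · rw [abs_mul, abs_of_pos (invSqrtReg_pos hε _)]
    have h2 := Real.sqrt_pos.2 h0
    calc _ ≤ (√(N z))⁻¹ * (√(N z) * √(Q z)) :=
          mul_le_mul (invSqrtReg_le hε h0) h1 (abs_nonneg _) (by positivity)
      _ = √(Q z) := by field_simp

theorem a_zero (hS : IsFloerScalars ρ h N a b Q S) (t : ℝ) : a (0, t) = 0 := by
  have h1 := hS.a_sq_le (0, t)
  rw [hS.N_zero, zero_mul] at h1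
  exact pow_eq_zero_iff two_ne_zero |>.1 (le_antisymm h1 (sq_nonneg _))

theorem b_zero (hS : IsFloerScalars ρ h N a b Q S) (t : ℝ) : b (0, t) = 0 := by
  have h1 := hS.b_sq_le (0, t)
  rw [hS.N_zero, zero_mul] at h1
  exact pow_eq_zero_iff two_ne_zero |>.1 (le_antisymm h1 (sq_nonneg _))

/-- The curl identity at s = 0, where a, b, S vanish identically in t and ρ = 1. -/
theorem fderivWithin_a_zero (hS : IsFloerScalars ρ h N a b Q S) (hρ : IsCylindricalProfile ρ)
    (t : ℝ) : fderivWithin ℝ a halfStrip (0, t) (1, 0) = Q (0, t) := by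
  have h1 := hasDerivAt_snd hS.smooth_b (s := 0) (t := t) le_rfl
  have h2 : (fun t => b (0, t)) = fun _ => 0 := funext hS.b_zero
  rw [h2] at h1
  have h3 := h1.unique (hasDerivAt_const t 0)
  have h4 := hS.curl (0, t) (mem_halfStrip.2 le_rfl)
  obtain ⟨η, hη, h5⟩ := hρ.eq_one_near_zero
  rw [h3, hS.N_zero, hS.S_zero, hS.a_zero, Real.sqrt_zero, h5 0 le_rfl hη.le] at h4
  linarith

theorem tendsto_a_div (hS : IsFloerScalars ρ h N a b Q S) (hρ : IsCylindricalProfile ρ)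
    (t : ℝ) : Tendsto (fun s => a (s, t) / s) (𝓝[>] 0) (𝓝 (Q (0, t))) := by
  have h1 := hasDerivWithinAt_fst hS.smooth_a (s := 0) (t := t) le_rfl
  rw [hS.fderivWithin_a_zero hρ, hasDerivWithinAt_iff_tendsto_slope, Ici_sdiff_left] at h1
  refine h1.congr fun s => ?_
  rw [slope_def_field, hS.a_zero, sub_zero, sub_zero]

theorem tendsto_slice_zero {f : ℝ × ℝ → ℝ} (hf : ContinuousOn f halfStrip) (t : ℝ) :
    Tendsto (fun s => f (s, t)) (𝓝[>] 0) (𝓝 (f (0, t))) := by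
  have h1 : ContinuousWithinAt (fun s => f (s, t)) (Ici 0) 0 :=
    ContinuousWithinAt.comp (f := fun s : ℝ => (s, t)) (hf (0, t) (mem_halfStrip.2 le_rfl))
      (by fun_prop) fun s hs => mem_halfStrip.2 hs
  exact h1.mono_left (nhdsWithin_mono _ Ioi_subset_Ici_self)

/-- By l'Hôpital's rule: near the boundary h' = 0 and ρ tends to 1, so the quotient of derivatives
behaves like a/s. -/
theorem tendsto_N_div (hS : IsFloerScalars ρ h N a b Q S) (hρ : IsCylindricalProfile ρ)
    (hh : IsLinearProfile μ δ h) (t : ℝ) :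
    Tendsto (fun s => N (s, t) / s ^ 2) (𝓝[>] 0) (𝓝 (Q (0, t))) := by
  have hN0 := tendsto_slice_zero hS.smooth_N.continuousOn t
  rw [hS.N_zero] at hN0
  have hpos : ∀ᶠ s : ℝ in 𝓝[>] 0, 0 < s := self_mem_nhdsWithin
  refine HasDerivAt.lhopital_zero_nhdsGT (f' := fun s => 2 * ρ √(N (s, t)) *
      (a (s, t) - deriv h √(N (s, t)) / √(N (s, t)) * N (s, t))) (g' := fun s => 2 * s)
    ?_ ?_ ?_ hN0 ?_ ?_
  · filter_upwards [hpos] with s hs using hS.hasDerivAt_N_fst hs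
  · exact Eventually.of_forall fun s => by simpa using hasDerivAt_pow 2 s
  · filter_upwards [hpos] with s hs using by positivity
  · have : Continuous fun s : ℝ => s ^ 2 := by fun_prop
    exact (by simpa using this.tendsto 0 : Tendsto (fun s : ℝ => s ^ 2) (𝓝 0) (𝓝 0)).mono_left
      nhdsWithin_le_nhds
  · have h1 : Tendsto (fun s => ρ √(N (s, t))) (𝓝[>] 0) (𝓝 1) := by
      have h2 := (hρ.continuous_sqrt.tendsto 0).comp hN0
      obtain ⟨η, hη, h5⟩ := hρ.eq_one_near_zero
      rwa [Real.sqrt_zero, h5 0 le_rfl hη.le] at h2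
    have h3 := h1.mul (hS.tendsto_a_div hρ t)
    rw [one_mul] at h3
    refine h3.congr' ?_
    filter_upwards [hpos, hN0.eventually_lt_const one_pos] with s hs hs1
    rw [hh.deriv_eq_zero (Real.sqrt_nonneg _) (Real.sqrt_le_one.2 hs1.le)]
    field_simp
    ring

/-- If Q(0, t) > 0, then N is of order s², above the threshold ε² = s⁴, so the regularization is
inactive and a/√N = (a/s)/√(N/s²) tends to Q/√Q. If Q(0, t) = 0, the bound by √Q suffices. -/
theorem tendsto_reg_mul (hS : IsFloerScalars ρ h N a b Q S) (hρ : IsCylindricalProfile ρ)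
    (hh : IsLinearProfile μ δ h) (t : ℝ) :
    Tendsto (fun s => invSqrtReg (s ^ 2) (N (s, t)) * a (s, t)) (𝓝[>] 0) (𝓝 √(Q (0, t))) := by
  have hpos : ∀ᶠ s : ℝ in 𝓝[>] 0, 0 < s := self_mem_nhdsWithin
  rcases (hS.Q_nonneg (0, t)).eq_or_lt with h0 | h0
  · have h1 := (Real.continuous_sqrt.tendsto _).comp (tendsto_slice_zero hS.cont_Q t)
    rw [← h0, Real.sqrt_zero] at h1 ⊢
    refine squeeze_zero_norm' ?_ h1
    filter_upwards [hpos] with s hs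
    exact hS.abs_reg_mul_le (by positivity) (s, t)
  · have h1 := hS.tendsto_N_div hρ hh t
    have h2 := (hS.tendsto_a_div hρ t).div ((Real.continuous_sqrt.tendsto _).comp h1)
      (Real.sqrt_pos.2 h0).ne'
    rw [Real.div_sqrt] at h2
    refine h2.congr' ?_
    have h3 : Tendsto (fun s : ℝ => s ^ 2) (𝓝[>] 0) (𝓝 0) := by
      have : Continuous fun s : ℝ => s ^ 2 := by fun_prop
      exact (by simpa using this.tendsto 0 : Tendsto (fun s : ℝ => s ^ 2) (𝓝 0) (𝓝 0)).mono_left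
        nhdsWithin_le_nhds
    filter_upwards [hpos, h3.eventually_lt h1 h0] with s hs hs1
    have h4 : 0 < s ^ 2 := by positivity
    have h5 : (s ^ 2) ^ 2 ≤ N (s, t) := by
      rw [lt_div_iff₀ h4] at hs1
      nlinarith
    rw [invSqrtReg_of_le h4 h5]
    simp only [Pi.div_apply, Function.comp_apply]
    rw [Real.sqrt_div (hS.N_nonneg _), Real.sqrt_sq hs.le]
    have h6 := Real.sqrt_pos.2 (lt_of_lt_of_le (by positivity) h5)
    field_simp

theorem tendsto_contactReg (hS : IsFloerScalars ρ h N a b Q S) (hρ : IsCylindricalProfile ρ)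
    (hh : IsLinearProfile μ δ h) :
    Tendsto (fun s => contactReg N a (s ^ 2) s) (𝓝[>] 0) (𝓝 (∫ t in (0 : ℝ)..1, √(Q (0, t)))) := by
  have hpos : ∀ᶠ s : ℝ in 𝓝[>] 0, 0 < s := self_mem_nhdsWithin
  have hlt : ∀ᶠ s : ℝ in 𝓝[>] 0, s < 1 := nhdsWithin_le_nhds (Iio_mem_nhds one_pos)
  obtain ⟨C, hC⟩ := (isCompact_Icc.prod isCompact_Icc : IsCompact (Icc (0 : ℝ) 1 ×ˢ Icc (0 : ℝ) 1))
    |>.exists_bound_of_continuousOn (f := fun z => √(Q z))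
    ((Real.continuous_sqrt.comp_continuousOn hS.cont_Q).mono
      (prod_mono Icc_subset_Ici_self (subset_univ _)))
  refine intervalIntegral.tendsto_integral_filter_of_dominated_convergence (fun _ => C) ?_ ?_
    intervalIntegrable_const (Eventually.of_forall fun t _ => hS.tendsto_reg_mul hρ hh t)
  · filter_upwards [hpos] with s hs
    exact (((contDiff_invSqrtReg (by positivity)).continuous.comp
      (hS.continuous_N_slice hs.le)).mul (hS.continuous_a_slice hs.le)).aestronglyMeasurable
  · filter_upwards [hpos, hlt] with s hs hs1
    refine Eventually.of_forall fun t ht => ?_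
    rw [uIoc_of_le zero_le_one] at ht
    have h1 := hC (s, t) ⟨⟨hs.le, hs1.le⟩, ht.1.le, ht.2⟩
    rw [Real.norm_eq_abs, abs_of_nonneg (Real.sqrt_nonneg _)] at h1
    exact (hS.abs_reg_mul_le (by positivity) (s, t)).trans h1

theorem integral_sqrt_le (hS : IsFloerScalars ρ h N a b Q S) (hρ : IsCylindricalProfile ρ)
    (hh : IsLinearProfile μ δ h) (hN : TendsToRadius N r) (hr : 0 < r) :
    ∫ t in (0 : ℝ)..1, √(Q (0, t)) ≤ deriv h r := by
  have hpos : ∀ᶠ s : ℝ in 𝓝[>] 0, 0 < s := self_mem_nhdsWithin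
  have hlt : ∀ᶠ s : ℝ in 𝓝[>] 0, s < 1 := nhdsWithin_le_nhds (Iio_mem_nhds one_pos)
  refine le_of_tendsto (hS.tendsto_contactReg hρ hh) ?_
  filter_upwards [hpos, hlt] with s hs hs1
  exact hS.contactReg_le hρ hh hN hr (by positivity) (by nlinarith) hs

end IsFloerScalars

end

/-! ### The equality case: vanishing of the Cauchy-Schwarz defects, and a smoothed sign function. -/

section

namespace IsFloerScalars

variable {ρ h : ℝ → ℝ} {μ δ ε s t r : ℝ} {N a b Q S : ℝ × ℝ → ℝ}

theorem continuousOn_integral_slice {F : ℝ × ℝ → ℝ} (hF : ContinuousOn F halfStrip) :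
    ContinuousOn (fun s => ∫ t in (0 : ℝ)..1, F (s, t)) (Ici 0) := by
  have h1 : Continuous fun z : ℝ × ℝ => F (max z.1 0, z.2) :=
    hF.comp_continuous (by fun_prop) fun z => mem_halfStrip.2 (le_max_right _ _)
  have h2 : Continuous fun s => ∫ t in (0 : ℝ)..1, F (max s 0, t) :=
    intervalIntegral.continuous_parametric_intervalIntegral_of_continuous'
      (f := fun s t => F (max s 0, t)) h1 0 1
  refine h2.continuousOn.congr fun s hs => ?_
  simp only [max_eq_left (show (0 : ℝ) ≤ s from hs)]

theorem eq_zero_of_integral_eq_zero {f : ℝ → ℝ} (hf : Continuous f) (h0 : ∀ t, 0 ≤ f t)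
    (hp : Function.Periodic f 1) (hi : ∫ t in (0 : ℝ)..1, f t ≤ 0) (t : ℝ) : f t = 0 := by
  obtain ⟨t', ht', h1⟩ := hp.exists_mem_Ico₀ one_pos t
  rw [h1]
  by_contra h2
  exact absurd hi (not_le.2 (intervalIntegral.integral_pos one_pos hf.continuousOn
    (fun x _ => h0 x) ⟨t', ⟨ht'.1, ht'.2.le⟩, lt_of_le_of_ne (h0 t') (Ne.symm h2)⟩))

/-- With ε = σ², monotonicity squeezes the value at s between the value at σ, which tends to the
length, and h'(r). Under equality the two bounds agree. -/
theorem tendsto_contactReg_of_eq (hS : IsFloerScalars ρ h N a b Q S) (hρ : IsCylindricalProfile ρ)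
    (hh : IsLinearProfile μ δ h) (hN : TendsToRadius N r) (hr : 0 < r)
    (heq : ∫ t in (0 : ℝ)..1, √(Q (0, t)) = deriv h r) (hs : 0 < s) :
    Tendsto (fun σ => contactReg N a (σ ^ 2) s) (𝓝[>] 0) (𝓝 (deriv h r)) := by
  have hpos : ∀ᶠ s : ℝ in 𝓝[>] 0, 0 < s := self_mem_nhdsWithin
  have hlt : ∀ᶠ s : ℝ in 𝓝[>] 0, s < 1 := nhdsWithin_le_nhds (Iio_mem_nhds one_pos)
  have hlts : ∀ᶠ σ : ℝ in 𝓝[>] 0, σ < s := nhdsWithin_le_nhds (Iio_mem_nhds hs)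
  have h1 := hS.tendsto_contactReg hρ hh
  rw [heq] at h1
  refine tendsto_of_tendsto_of_tendsto_of_le_of_le' h1 tendsto_const_nhds ?_ ?_
  · filter_upwards [hpos, hlt, hlts] with σ h1 h2 h3
    exact hS.monotoneOn_contactReg hρ hh (by positivity) (by nlinarith) h1 hs h3.le
  · filter_upwards [hpos, hlt] with σ h1 h2
    exact hS.contactReg_le hρ hh hN hr (by positivity) (by nlinarith) hs

/-- Periodicity of Q and S separately is not part of `IsFloerScalars`; that of the sum follows from
the curl identity and is all that is needed. -/
theorem periodic_Q_add_S (hS : IsFloerScalars ρ h N a b Q S) (hρ : IsCylindricalProfile ρ)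
    (hs : 0 ≤ s) : Q (s, t + 1) + S (s, t + 1) = Q (s, t) + S (s, t) := by
  have h1 := hS.curl (s, t + 1) (mem_halfStrip.2 hs)
  have h2 := hS.curl (s, t) (mem_halfStrip.2 hs)
  rw [fderivWithin_halfStrip_periodic hS.periodic_a hs,
    fderivWithin_halfStrip_periodic hS.periodic_b hs, h2, hS.periodic_N s t hs,
    hS.periodic_a s t hs] at h1
  have h3 := mul_left_cancel₀ (hρ.pos _ (Real.sqrt_nonneg _)).ne' h1
  linarith

/-- The lower bound G for the density is continuous and independent of ε, while the increment of
`contactReg` between two times tends to 0 with ε. So G has integral zero over each circle, and it is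
nonnegative. -/
theorem defect_eq_zero (hS : IsFloerScalars ρ h N a b Q S) (hρ : IsCylindricalProfile ρ)
    (hh : IsLinearProfile μ δ h) (hN : TendsToRadius N r) (hr : 0 < r)
    (heq : ∫ t in (0 : ℝ)..1, √(Q (0, t)) = deriv h r) (hs : 0 < s) (t : ℝ) :
    N (s, t) * Q (s, t) = a (s, t) ^ 2 ∧ N (s, t) * S (s, t) = b (s, t) ^ 2 := by
  let G : ℝ × ℝ → ℝ := fun z => ρ √(N z) * ((√(max (N z) 1) ^ 3)⁻¹ *
    (N z * Q z - a z ^ 2 + (N z * S z - b z ^ 2)))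
  have hmax : ∀ y : ℝ, 0 < (√(max y 1) ^ 3)⁻¹ := fun y => by
    have := Real.sqrt_pos.2 (lt_of_lt_of_le one_pos (le_max_right y 1))
    positivity
  have hG0 : ∀ z, 0 ≤ G z := fun z => mul_nonneg (hρ.pos _ (Real.sqrt_nonneg _)).le
    (mul_nonneg (hmax _).le
      (add_nonneg (sub_nonneg.2 (hS.a_sq_le z)) (sub_nonneg.2 (hS.b_sq_le z))))
  have hGc : ContinuousOn G halfStrip := by
    have hNc := hS.smooth_N.continuousOn
    have h1 : Continuous fun y : ℝ => (√(max y 1) ^ 3)⁻¹ := by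
      have : ∀ y : ℝ, √(max y 1) ^ 3 ≠ 0 := fun y => (inv_pos.1 (hmax y)).ne'
      fun_prop (disch := exact this)
    exact (hρ.continuous_sqrt.comp_continuousOn hNc).mul ((h1.comp_continuousOn hNc).mul
      (((hNc.mul hS.cont_Q).sub (hS.smooth_a.continuousOn.pow 2)).add
        ((hNc.mul hS.cont_S).sub (hS.smooth_b.continuousOn.pow 2))))
  have hpos : ∀ᶠ s : ℝ in 𝓝[>] 0, 0 < s := self_mem_nhdsWithin
  have hlt : ∀ᶠ s : ℝ in 𝓝[>] 0, s < 1 := nhdsWithin_le_nhds (Iio_mem_nhds one_pos)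
  have key : ∫ t in (0 : ℝ)..1, G (s, t) ≤ 0 := by
    by_contra! h1
    obtain ⟨η, hη, hη1⟩ := exists_between h1
    have h2 := ((continuousOn_integral_slice hGc).continuousAt (Ici_mem_nhds hs)).eventually_const_lt
      hη1
    obtain ⟨d, hd, h3⟩ := Metric.nhds_basis_closedBall.mem_iff.1 h2
    -- If the integral of G exceeded η near s, every regularized increment over [s, s + d] would be
    -- at least ηd, contradicting the limit 0.
    have h4 : ∀ᶠ σ : ℝ in 𝓝[>] 0,
        η * (s + d - s) ≤ contactReg N a (σ ^ 2) (s + d) - contactReg N a (σ ^ 2) s := by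
      filter_upwards [hpos, hlt] with σ hσ hσ1
      have hε : 0 < σ ^ 2 := by positivity
      have hε1 : σ ^ 2 ≤ 1 := by nlinarith
      have hdv : ∀ s' ∈ Icc s (s + d), HasDerivAt (contactReg N a (σ ^ 2))
          (∫ t in (0 : ℝ)..1, contactRegDensity ρ N a b Q S (σ ^ 2) (s', t)) s' := fun s' hs' =>
        hS.hasDerivAt_contactReg hh hε hε1 (hs.trans_le hs'.1)
      refine (convex_Icc s (s + d)).mul_sub_le_image_sub_of_le_deriv
        (fun s' hs' => (hdv s' hs').continuousAt.continuousWithinAt)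
        (fun s' hs' => (hdv s' (interior_subset hs')).differentiableAt.differentiableWithinAt) ?_
        s ⟨le_rfl, by linarith⟩ (s + d) ⟨by linarith, le_rfl⟩ (by linarith)
      intro s' hs'
      have hs'' := interior_subset hs'
      have hs0 : 0 ≤ s' := hs.le.trans hs''.1
      rw [(hdv s' hs'').deriv]
      have h5 : s' ∈ Metric.closedBall s d := by
        rw [Real.closedBall_eq_Icc]
        exact ⟨by linarith [hs''.1], hs''.2⟩
      refine (le_of_lt (h3 h5)).trans (intervalIntegral.integral_mono_on zero_le_one
        ((continuous_slice (I := Ici 0) hGc hs0).intervalIntegrable _ _)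
        ((continuous_slice (I := Ici 0) (hS.continuousOn_density hρ hε) hs0).intervalIntegrable _ _)
        fun t _ => hS.density_ge hρ hε hε1 _)
    have h5 := ge_of_tendsto ((hS.tendsto_contactReg_of_eq hρ hh hN hr heq (by linarith : 0 < s + d)).sub
      (hS.tendsto_contactReg_of_eq hρ hh hN hr heq hs)) h4
    nlinarith
  have h1 := eq_zero_of_integral_eq_zero (f := fun t => G (s, t))
    (continuous_slice (I := Ici 0) hGc hs.le) (fun t => hG0 _) (fun t => ?_) key t
  · have h2 := (mul_eq_zero.1 h1).resolve_left (hρ.pos _ (Real.sqrt_nonneg _)).ne'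
    have h3 := (mul_eq_zero.1 h2).resolve_left (hmax _).ne'
    have h4 := hS.a_sq_le (s, t)
    have h5 := hS.b_sq_le (s, t)
    constructor <;> linarith
  · have h2 := hS.periodic_Q_add_S hρ hs.le (t := t)
    have h3 : ∀ z, G z = ρ √(N z) * ((√(max (N z) 1) ^ 3)⁻¹ *
      (N z * (Q z + S z) - a z ^ 2 - b z ^ 2)) := fun z => by
        simp only [G]
        ring
    simp only [h3, h2, hS.periodic_N s t hs.le, hS.periodic_a s t hs.le, hS.periodic_b s t hs.le]

end IsFloerScalars

section SmoothSign

/-- A smooth approximation of the sign. -/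
def smoothSign (ν x : ℝ) : ℝ := x / √(x ^ 2 + ν ^ 2)

variable {ν : ℝ}

theorem sqrt_sq_add_pos (hν : 0 < ν) (x : ℝ) : 0 < √(x ^ 2 + ν ^ 2) :=
  Real.sqrt_pos.2 (by positivity)

theorem hasDerivAt_sqrt_sq_add (hν : 0 < ν) (x : ℝ) :
    HasDerivAt (fun x => √(x ^ 2 + ν ^ 2)) (smoothSign ν x) x := by
  have h1 : HasDerivAt (fun x : ℝ => x ^ 2 + ν ^ 2) (2 * x) x := by
    simpa using (hasDerivAt_pow 2 x).add_const (ν ^ 2)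
  refine (h1.sqrt (by positivity)).congr_deriv ?_
  have := sqrt_sq_add_pos hν x
  rw [smoothSign]
  field_simp

theorem contDiff_sqrt_sq_add (hν : 0 < ν) : ContDiff ℝ ∞ fun x : ℝ => √(x ^ 2 + ν ^ 2) := by
  refine ContDiff.sqrt (by fun_prop) fun x => ?_
  positivity

theorem contDiff_smoothSign (hν : 0 < ν) : ContDiff ℝ ∞ (smoothSign ν) :=
  contDiff_id.div (contDiff_sqrt_sq_add hν) fun x => (sqrt_sq_add_pos hν x).ne'

theorem hasDerivAt_smoothSign (hν : 0 < ν) (x : ℝ) :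
    HasDerivAt (smoothSign ν) (ν ^ 2 / √(x ^ 2 + ν ^ 2) ^ 3) x := by
  have h0 := sqrt_sq_add_pos hν x
  refine ((hasDerivAt_id x).div (hasDerivAt_sqrt_sq_add hν x) h0.ne').congr_deriv ?_
  have h1 : √(x ^ 2 + ν ^ 2) ^ 2 = x ^ 2 + ν ^ 2 := Real.sq_sqrt (by positivity)
  rw [smoothSign, id]
  field_simp
  linear_combination h1

theorem abs_le_sqrt_sq_add (ν x : ℝ) : |x| ≤ √(x ^ 2 + ν ^ 2) :=
  Real.abs_le_sqrt (by nlinarith [sq_nonneg ν])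

theorem sqrt_sq_add_le (hν : 0 < ν) (x : ℝ) : √(x ^ 2 + ν ^ 2) ≤ |x| + ν := by
  rw [Real.sqrt_le_left (by positivity), ← sq_abs x]
  nlinarith [abs_nonneg x]

theorem abs_smoothSign_le (hν : 0 < ν) (x : ℝ) : |smoothSign ν x| ≤ 1 := by
  have h0 := sqrt_sq_add_pos hν x
  rw [smoothSign, abs_div, abs_of_pos h0, div_le_one h0]
  exact abs_le_sqrt_sq_add ν x

/-- The error of smoothing the sign: its derivative concentrates near x = 0, where the factor x²
compensates. -/
theorem deriv_smoothSign_mul_sq_le (hν : 0 < ν) (x : ℝ) :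
    ν ^ 2 / √(x ^ 2 + ν ^ 2) ^ 3 * x ^ 2 ≤ ν := by
  have h0 := sqrt_sq_add_pos hν x
  have h1 : √(x ^ 2 + ν ^ 2) ^ 2 = x ^ 2 + ν ^ 2 := Real.sq_sqrt (by positivity)
  have h2 : ν ≤ √(x ^ 2 + ν ^ 2) := Real.le_sqrt_of_sq_le (by nlinarith [sq_nonneg x])
  rw [div_mul_eq_mul_div, div_le_iff₀ (by positivity)]
  have h3 : ν ^ 2 * x ^ 2 ≤ ν ^ 2 * √(x ^ 2 + ν ^ 2) ^ 2 := by
    rw [h1]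
    nlinarith [sq_nonneg ν, sq_nonneg (ν ^ 2)]
  have h4 : ν ^ 2 * √(x ^ 2 + ν ^ 2) ^ 2 ≤ ν * √(x ^ 2 + ν ^ 2) * √(x ^ 2 + ν ^ 2) ^ 2 := by
    refine mul_le_mul_of_nonneg_right ?_ (by positivity)
    nlinarith
  linarith

theorem smoothSign_mul_nonneg (hν : 0 < ν) {x k : ℝ} (hk : 0 ≤ x * k) :
    0 ≤ smoothSign ν x * k := by
  rw [smoothSign, div_mul_eq_mul_div]
  exact div_nonneg hk (sqrt_sq_add_pos hν x).le

end SmoothSign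

end

/-! ### Comparison of two solutions: evolution of the smoothed L¹-distance of heights. -/

section

namespace IsFloerScalars

section

variable {ρ h : ℝ → ℝ} {μ δ ε ν s t r : ℝ} {N a b Q S N' a' b' Q' S' : ℝ × ℝ → ℝ}

/-- The integrand is ∂_s(wa) - ∂_t(wb) for C¹ functions wa and wb, so the factors w₁, w₂, Q, S need
not be inspected. -/
theorem continuous_weight_integrand (hS : IsFloerScalars ρ h N a b Q S) {w : ℝ × ℝ → ℝ}
    {w₁ w₂ : ℝ → ℝ} (hw : ContDiffOn ℝ 1 w (Ioi (0 : ℝ) ×ˢ univ)) (hs : 0 < s)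
    (hw₁ : ∀ t, HasDerivAt (fun s => w (s, t)) (w₁ t) s)
    (hw₂ : ∀ t, HasDerivAt (fun t => w (s, t)) (w₂ t) t) :
    Continuous fun t => w₁ t * a (s, t) - w₂ t * b (s, t) + w (s, t) * (ρ √(N (s, t)) *
      (Q (s, t) - deriv h √(N (s, t)) / √(N (s, t)) * a (s, t) + S (s, t))) := by
  have h1 := continuous_deriv_fst isOpen_Ioi (hw.mul hS.contDiffOn_a) hs
    (fun t => (hw₁ t).mul (hasDerivAt_fst hS.smooth_a hs))
  have h2 := continuous_deriv_snd isOpen_Ioi (hw.mul hS.contDiffOn_b) hs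
    (fun t => (hw₂ t).mul (hasDerivAt_snd hS.smooth_b hs.le))
  refine (h1.sub h2).congr fun t => ?_
  simp only [Pi.sub_apply, ← hS.curl (s, t) (mem_halfStrip.2 hs.le)]
  ring

/-- The difference of the regularized heights of two half-cylinders. -/
def heightDiff (ρ : ℝ → ℝ) (ε : ℝ) (N₁ N₂ : ℝ × ℝ → ℝ) (z : ℝ × ℝ) : ℝ :=
  heightReg ρ ε (N₁ z) - heightReg ρ ε (N₂ z)

/-- The integral of `p dq / |p|`, weighted by the smoothed sign of the height difference. -/
def signedContact (ρ : ℝ → ℝ) (ε ν : ℝ) (N N' K a : ℝ × ℝ → ℝ) (s : ℝ) : ℝ :=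
  ∫ t in (0 : ℝ)..1,
    smoothSign ν (heightDiff ρ ε N N' (s, t)) * invSqrtReg ε (K (s, t)) * a (s, t)

theorem contDiffOn_heightDiff (hS : IsFloerScalars ρ h N a b Q S)
    (hS' : IsFloerScalars ρ h N' a' b' Q' S') (hρ : IsCylindricalProfile ρ) (hε : 0 < ε) :
    ContDiffOn ℝ 1 (heightDiff ρ ε N N') (Ioi (0 : ℝ) ×ˢ univ) :=
  (hS.contDiffOn_height hρ hε).sub (hS'.contDiffOn_height hρ hε)

theorem hasDerivAt_heightDiff_fst (hS : IsFloerScalars ρ h N a b Q S)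
    (hS' : IsFloerScalars ρ h N' a' b' Q' S') (hρ : IsCylindricalProfile ρ)
    (hh : IsLinearProfile μ δ h) (hε : 0 < ε) (hε1 : ε ≤ 1) (hs : 0 < s) :
    HasDerivAt (fun s => heightDiff ρ ε N N' (s, t))
      ((invSqrtReg ε (N (s, t)) * a (s, t) - deriv h √(N (s, t))) -
        (invSqrtReg ε (N' (s, t)) * a' (s, t) - deriv h √(N' (s, t)))) s :=
  (hS.hasDerivAt_height_fst hρ hh hε hε1 hs).sub (hS'.hasDerivAt_height_fst hρ hh hε hε1 hs)

theorem hasDerivAt_heightDiff_snd (hS : IsFloerScalars ρ h N a b Q S)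
    (hS' : IsFloerScalars ρ h N' a' b' Q' S') (hρ : IsCylindricalProfile ρ)
    (hε : 0 < ε) (hs : 0 ≤ s) :
    HasDerivAt (fun t => heightDiff ρ ε N N' (s, t))
      (-(invSqrtReg ε (N (s, t)) * b (s, t)) - -(invSqrtReg ε (N' (s, t)) * b' (s, t))) t :=
  (hS.hasDerivAt_height_snd hρ hε hs).sub (hS'.hasDerivAt_height_snd hρ hε hs)

/-- The density of the derivative of `signedContact`. -/
def signedDensity (ρ h : ℝ → ℝ) (ε ν : ℝ) (N N' a a' b b' K aK bK QK SK : ℝ × ℝ → ℝ)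
    (z : ℝ × ℝ) : ℝ :=
  smoothSign ν (heightDiff ρ ε N N' z) * contactRegDensity ρ K aK bK QK SK ε z +
    ν ^ 2 / √(heightDiff ρ ε N N' z ^ 2 + ν ^ 2) ^ 3 *
    (((invSqrtReg ε (N z) * a z - deriv h √(N z)) - (invSqrtReg ε (N' z) * a' z - deriv h √(N' z))) *
      (invSqrtReg ε (K z) * aK z) -
    (-(invSqrtReg ε (N z) * b z) - -(invSqrtReg ε (N' z) * b' z)) * (invSqrtReg ε (K z) * bK z))

theorem hasDerivAt_signedContact (hS : IsFloerScalars ρ h N a b Q S)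
    (hS' : IsFloerScalars ρ h N' a' b' Q' S') {K aK bK QK SK : ℝ × ℝ → ℝ}
    (hK : IsFloerScalars ρ h K aK bK QK SK) (hρ : IsCylindricalProfile ρ)
    (hh : IsLinearProfile μ δ h) (hε : 0 < ε) (hε1 : ε ≤ 1) (hν : 0 < ν) (hs : 0 < s) :
    HasDerivAt (signedContact ρ ε ν N N' K aK)
      (∫ t in (0 : ℝ)..1, signedDensity ρ h ε ν N N' a a' b b' K aK bK QK SK (s, t)) s ∧
    Continuous fun t => signedDensity ρ h ε ν N N' a a' b b' K aK bK QK SK (s, t) := by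
  have hKp : K (s, 1) = K (s, 0) := by simpa using hK.periodic_N s 0 hs.le
  have hNp : N (s, 1) = N (s, 0) := by simpa using hS.periodic_N s 0 hs.le
  have hNp' : N' (s, 1) = N' (s, 0) := by simpa using hS'.periodic_N s 0 hs.le
  have hw : ContDiffOn ℝ 1 (fun z => smoothSign ν (heightDiff ρ ε N N' z) * invSqrtReg ε (K z))
      (Ioi (0 : ℝ) ×ˢ univ) :=
    (((contDiff_smoothSign hν).of_le (by simp)).comp_contDiffOn
      (hS.contDiffOn_heightDiff hS' hρ hε)).mul (hK.contDiffOn_reg hε)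
  have hw₁ := fun t => ((hasDerivAt_smoothSign hν _).comp s
      (hS.hasDerivAt_heightDiff_fst hS' hρ hh hε hε1 hs (t := t))).mul
      ((hasDerivAt_invSqrtReg hε _).comp s (hK.hasDerivAt_N_fst hs (t := t)))
  have hw₂ := fun t => ((hasDerivAt_smoothSign hν _).comp t
      (hS.hasDerivAt_heightDiff_snd hS' hρ hε hs.le (t := t))).mul
      ((hasDerivAt_invSqrtReg hε _).comp t (hK.hasDerivAt_N_snd hs.le (t := t)))
  have h1 := hK.hasDerivAt_integral_weight hw hs
    (by simp only [heightDiff, hKp, hNp, hNp']) hw₁ hw₂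
  have h2 := hK.continuous_weight_integrand hw hs hw₁ hw₂
  -- As for `contactReg`, this cancels the h' terms produced by the weight g(K).
  have h3 := fun t => deriv_mul_reg_eq_zero hh hε hε1 (y := K (s, t))
  refine ⟨h1.congr_deriv (intervalIntegral.integral_congr fun t _ => ?_), h2.congr fun t => ?_⟩
  all_goals
    simp only [signedDensity, contactRegDensity, Function.comp_apply]
    linear_combination (-(smoothSign ν (heightDiff ρ ε N N' (s, t)) * ρ √(K (s, t)) * aK (s, t) /
      √(K (s, t)))) * h3 t

/-- The lower bound for the derivative of the signed contact integrals. -/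
theorem signedDensity_sub_ge (hS : IsFloerScalars ρ h N a b Q S)
    (hS' : IsFloerScalars ρ h N' a' b' Q' S') (hρ : IsCylindricalProfile ρ)
    (hh : IsLinearProfile μ δ h) (hε : 0 < ε) (hε1 : ε ≤ 1) (hν : 0 < ν) {C : ℝ} (hC0 : 0 ≤ C)
    (hC : ∀ r, 0 < r → deriv (deriv h) r * ρ r ≤ C) (z : ℝ × ℝ) :
    -(contactRegDensity ρ N a b Q S ε z + contactRegDensity ρ N' a' b' Q' S' ε z + C ^ 2 * ν / 4) ≤
      signedDensity ρ h ε ν N N' a a' b b' N a b Q S z -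
        signedDensity ρ h ε ν N N' a a' b b' N' a' b' Q' S' z := by
  have h1 := hS.density_nonneg hρ hε hε1 z
  have h2 := hS'.density_nonneg hρ hε hε1 z
  have h3 := abs_le.1 (abs_smoothSign_le hν (heightDiff ρ ε N N' z))
  have h4 := deriv_smoothSign_mul_sq_le hν (heightDiff ρ ε N N' z)
  have h5 : 0 ≤ ν ^ 2 / √(heightDiff ρ ε N N' z ^ 2 + ν ^ 2) ^ 3 := by positivity
  -- The Lipschitz bound for h' in terms of the height, with the same constant C.
  have h6 : (deriv h √(N z) - deriv h √(N' z)) ^ 2 ≤ C ^ 2 * heightDiff ρ ε N N' z ^ 2 := by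
    rw [← mul_pow, sq_le_sq]
    have hmono : ∀ y₁ y₂ : ℝ, y₁ ≤ y₂ → |deriv h √y₂ - deriv h √y₁| ≤
        |C * (heightReg ρ ε y₂ - heightReg ρ ε y₁)| := by
      intro y₁ y₂ hy
      rw [abs_of_nonneg (sub_nonneg.2 (hh.monotoneOn_deriv (Real.sqrt_nonneg _)
        (Real.sqrt_nonneg _) (Real.sqrt_le_sqrt hy)))]
      exact (deriv_sqrt_sub_le hρ hh hε hε1 hC0 hC hy).trans (le_abs_self _)
    rcases le_total (N z) (N' z) with hy | hy
    · rw [heightDiff, abs_sub_comm, abs_mul, abs_sub_comm (heightReg ρ ε (N z)), ← abs_mul]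
      exact hmono _ _ hy
    · exact hmono _ _ hy
  simp only [signedDensity]
  generalize contactRegDensity ρ N a b Q S ε z = I₁ at *
  generalize contactRegDensity ρ N' a' b' Q' S' ε z = I₂ at *
  generalize smoothSign ν (heightDiff ρ ε N N' z) = β at *
  generalize ν ^ 2 / √(heightDiff ρ ε N N' z ^ 2 + ν ^ 2) ^ 3 = B at *
  generalize heightDiff ρ ε N N' z = D at *
  generalize invSqrtReg ε (N z) * a z = A₁ at *
  generalize invSqrtReg ε (N' z) * a' z = A₂ at *
  generalize invSqrtReg ε (N z) * b z = B₁ at *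
  generalize invSqrtReg ε (N' z) * b' z = B₂ at *
  generalize deriv h √(N z) = k₁ at *
  generalize deriv h √(N' z) = k₂ at *
  -- The smoothed sign is bounded by 1 and both densities are nonnegative; the loss is the growth of
  -- the two contact integrals.
  have e1 : -(I₁ + I₂) ≤ β * I₁ - β * I₂ := by nlinarith
  have e2 : B * (k₁ - k₂) ^ 2 ≤ C ^ 2 * ν := by
    calc _ ≤ B * (C ^ 2 * D ^ 2) := mul_le_mul_of_nonneg_left h6 h5
      _ = C ^ 2 * (B * D ^ 2) := by ring
      _ ≤ _ := mul_le_mul_of_nonneg_left h4 (sq_nonneg C)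
  -- Completing the square in A₁ - A₂ costs B(k₁ - k₂)²/4, which is at most C²ν/4 by the previous
  -- step.
  have e3 : 0 ≤ B * (((A₁ - A₂) - (k₁ - k₂) / 2) ^ 2 + (B₁ - B₂) ^ 2) :=
    mul_nonneg h5 (by positivity)
  linarith

/-- Monotonicity of the signed contact integral up to the variation of the contact integrals. -/
theorem monotoneOn_signedContact (hS : IsFloerScalars ρ h N a b Q S)
    (hS' : IsFloerScalars ρ h N' a' b' Q' S') (hρ : IsCylindricalProfile ρ)
    (hh : IsLinearProfile μ δ h) (hε : 0 < ε) (hε1 : ε ≤ 1) (hν : 0 < ν) {C : ℝ} (hC0 : 0 ≤ C)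
    (hC : ∀ r, 0 < r → deriv (deriv h) r * ρ r ≤ C) :
    MonotoneOn (fun s => (signedContact ρ ε ν N N' N a s - signedContact ρ ε ν N N' N' a' s) +
      (contactReg N a ε s + contactReg N' a' ε s + C ^ 2 * ν / 4 * s)) (Ioi 0) := by
  have hd : ∀ s : ℝ, 0 < s → HasDerivAt (fun s => (signedContact ρ ε ν N N' N a s -
      signedContact ρ ε ν N N' N' a' s) +
      (contactReg N a ε s + contactReg N' a' ε s + C ^ 2 * ν / 4 * s)) _ s := fun s hs =>
    ((hS.hasDerivAt_signedContact hS' hS hρ hh hε hε1 hν hs).1.sub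
      (hS.hasDerivAt_signedContact hS' hS' hρ hh hε hε1 hν hs).1).add
    (((hS.hasDerivAt_contactReg hh hε hε1 hs).add (hS'.hasDerivAt_contactReg hh hε hε1 hs)).add
      ((hasDerivAt_id s).const_mul (C ^ 2 * ν / 4)))
  refine monotoneOn_of_deriv_nonneg (convex_Ioi 0)
    (fun s hs => (hd s hs).continuousAt.continuousWithinAt) ?_ ?_
  · rw [interior_Ioi]
    exact fun s hs => (hd s hs).differentiableAt.differentiableWithinAt
  · rw [interior_Ioi]
    intro s hs
    rw [(hd s hs).deriv]
    have c1 := (hS.hasDerivAt_signedContact hS' hS hρ hh hε hε1 hν hs).2.intervalIntegrable 0 1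
      (μ := MeasureTheory.volume)
    have c2 := (hS.hasDerivAt_signedContact hS' hS' hρ hh hε hε1 hν hs).2.intervalIntegrable 0 1
      (μ := MeasureTheory.volume)
    have c3 := (continuous_slice (I := Ici 0) (hS.continuousOn_density hρ hε)
      (mem_Ici.2 (le_of_lt hs))).intervalIntegrable 0 1 (μ := MeasureTheory.volume)
    have c4 := (continuous_slice (I := Ici 0) (hS'.continuousOn_density hρ hε)
      (mem_Ici.2 (le_of_lt hs))).intervalIntegrable 0 1 (μ := MeasureTheory.volume)
    have h1 : C ^ 2 * ν / 4 * 1 = ∫ t in (0 : ℝ)..1, C ^ 2 * ν / 4 := by simp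
    rw [h1, ← intervalIntegral.integral_sub c1 c2, ← intervalIntegral.integral_add c3 c4,
      ← intervalIntegral.integral_add (c3.add c4) intervalIntegrable_const,
      ← intervalIntegral.integral_add (c1.sub c2) ((c3.add c4).add intervalIntegrable_const)]
    refine intervalIntegral.integral_nonneg zero_le_one fun t _ => ?_
    have := signedDensity_sub_ge hS hS' hρ hh hε hε1 hν hC0 hC (s, t)
    linarith

/-- The derivative of the smoothed `L¹`-norm of the height difference. -/
theorem hasDerivAt_integral_heightDiff (hS : IsFloerScalars ρ h N a b Q S)
    (hS' : IsFloerScalars ρ h N' a' b' Q' S') (hρ : IsCylindricalProfile ρ)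
    (hh : IsLinearProfile μ δ h) (hε : 0 < ε) (hε1 : ε ≤ 1) (hν : 0 < ν) (hs : 0 < s) :
    HasDerivAt (fun s => ∫ t in (0 : ℝ)..1, √(heightDiff ρ ε N N' (s, t) ^ 2 + ν ^ 2))
      ((signedContact ρ ε ν N N' N a s - signedContact ρ ε ν N N' N' a' s) -
        ∫ t in (0 : ℝ)..1, smoothSign ν (heightDiff ρ ε N N' (s, t)) *
          (deriv h √(N (s, t)) - deriv h √(N' (s, t)))) s := by
  have h1 := hasDerivAt_integral_strip isOpen_Ioi (F := fun z => √(heightDiff ρ ε N N' z ^ 2 + ν ^ 2))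
    (((contDiff_sqrt_sq_add hν).of_le (by simp)).comp_contDiffOn
      (hS.contDiffOn_heightDiff hS' hρ hε)) hs
    (fun t => (hasDerivAt_sqrt_sq_add hν _).comp s
      (hS.hasDerivAt_heightDiff_fst hS' hρ hh hε hε1 hs (t := t)))
  refine h1.congr_deriv ?_
  have cN := hS.continuous_N_slice hs.le
  have cN' := hS'.continuous_N_slice hs.le
  have cD : Continuous fun t => smoothSign ν (heightDiff ρ ε N N' (s, t)) :=
    (contDiff_smoothSign hν).continuous.comp
      (((contDiff_heightReg hρ hε).continuous.comp cN).sub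
        ((contDiff_heightReg hρ hε).continuous.comp cN'))
  have cg := (contDiff_invSqrtReg hε).continuous
  have c1 := ((cD.mul (cg.comp cN)).mul (hS.continuous_a_slice hs.le)).intervalIntegrable 0 1
    (μ := MeasureTheory.volume)
  have c2 := ((cD.mul (cg.comp cN')).mul (hS'.continuous_a_slice hs.le)).intervalIntegrable 0 1
    (μ := MeasureTheory.volume)
  have c3 := (cD.mul ((hh.continuous_deriv_sqrt.comp cN).sub
    (hh.continuous_deriv_sqrt.comp cN'))).intervalIntegrable 0 1 (μ := MeasureTheory.volume)
  have e1 := intervalIntegral.integral_sub c1 c2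
  have e2 := intervalIntegral.integral_sub (c1.sub c2) c3
  refine Eq.trans (intervalIntegral.integral_congr fun t _ => ?_)
    (e2.trans (congrArg (· - _) e1))
  simp only [Pi.mul_apply, Pi.sub_apply, Function.comp_apply]
  ring

end

end IsFloerScalars

end

/-! ### Comparison of two solutions: equality forces equal heights, and rigidity. -/

section

namespace IsFloerScalars

section

variable {ρ h : ℝ → ℝ} {μ δ ε ν s t r : ℝ} {N a b Q S N' a' b' Q' S' : ℝ × ℝ → ℝ}

theorem continuous_heightDiff_slice (hS : IsFloerScalars ρ h N a b Q S)
    (hS' : IsFloerScalars ρ h N' a' b' Q' S') (hρ : IsCylindricalProfile ρ) (hε : 0 < ε)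
    (hs : 0 ≤ s) : Continuous fun t => heightDiff ρ ε N N' (s, t) :=
  ((contDiff_heightReg hρ hε).continuous.comp (hS.continuous_N_slice hs)).sub
    ((contDiff_heightReg hρ hε).continuous.comp (hS'.continuous_N_slice hs))

theorem abs_heightDiff_le (hS : IsFloerScalars ρ h N a b Q S)
    (hS' : IsFloerScalars ρ h N' a' b' Q' S') (hρ : IsCylindricalProfile ρ) (hε : 0 < ε) {R : ℝ}
    (hR : ∀ s t, 0 ≤ s → N (s, t) ≤ R) (hR' : ∀ s t, 0 ≤ s → N' (s, t) ≤ R) (hs : 0 ≤ s) :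
    |heightDiff ρ ε N N' (s, t)| ≤ √R := by
  have h1 := hS.height_mem hρ hε hR hs (t := t)
  have h2 := hS'.height_mem hρ hε hR' hs (t := t)
  rw [heightDiff, abs_le]
  constructor <;> linarith [h1.1, h1.2, h2.1, h2.2]

/-- The smoothed L¹-distance Φ of heights has derivative W - k, with k ≥ 0 since h' and the height
are monotone in |p|. Up to controlled errors W is nondecreasing, and it is small at some time in (T,
2T) because Φ is bounded. Hence W is bounded above on [σ, s], and Φ grows little from σ to s. -/
theorem integral_heightDiff_le (hS : IsFloerScalars ρ h N a b Q S)
    (hS' : IsFloerScalars ρ h N' a' b' Q' S') (hρ : IsCylindricalProfile ρ)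
    (hh : IsLinearProfile μ δ h) (hN : TendsToRadius N r) (hN' : TendsToRadius N' r) (hr : 0 < r)
    (hε : 0 < ε) (hε1 : ε ≤ 1) (hν : 0 < ν) {R C σ T η : ℝ}
    (hR : ∀ s t, 0 ≤ s → N (s, t) ≤ R) (hR' : ∀ s t, 0 ≤ s → N' (s, t) ≤ R) (hC0 : 0 ≤ C)
    (hC : ∀ r, 0 < r → deriv (deriv h) r * ρ r ≤ C) (hσ : 0 < σ) (hσs : σ ≤ s) (hsT : s ≤ T)
    (hT : ∀ s ≥ T, ∀ t, |deriv h √(N (s, t)) - deriv h √(N' (s, t))| ≤ η) :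
    ∫ t in (0 : ℝ)..1, |heightDiff ρ ε N N' (s, t)| ≤
      ν + (∫ t in (0 : ℝ)..1, |heightDiff ρ ε N N' (σ, t)|) +
      (s - σ) * (√R / T + η + ((deriv h r - contactReg N a ε σ) +
        (deriv h r - contactReg N' a' ε σ)) + C ^ 2 * ν / 4 * (2 * T)) := by
  have hT0 : 0 < T := by linarith
  set W : ℝ → ℝ := fun s => signedContact ρ ε ν N N' N a s - signedContact ρ ε ν N N' N' a' s with hW
  set Φ : ℝ → ℝ := fun s => ∫ t in (0 : ℝ)..1, √(heightDiff ρ ε N N' (s, t) ^ 2 + ν ^ 2) with hΦ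
  set k : ℝ → ℝ := fun s => ∫ t in (0 : ℝ)..1, smoothSign ν (heightDiff ρ ε N N' (s, t)) *
          (deriv h √(N (s, t)) - deriv h √(N' (s, t))) with hk
  have hd : ∀ s, 0 < s → HasDerivAt Φ (W s - k s) s := fun s hs =>
    hS.hasDerivAt_integral_heightDiff hS' hρ hh hε hε1 hν hs
  have hk0 : ∀ s, 0 ≤ k s := by
    refine fun s => intervalIntegral.integral_nonneg zero_le_one fun t _ =>
      smoothSign_mul_nonneg hν ?_
    rcases le_total (N (s, t)) (N' (s, t)) with hy | hy
    · exact mul_nonneg_of_nonpos_of_nonpos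
        (sub_nonpos.2 ((strictMono_heightReg hρ hε).monotone hy))
        (sub_nonpos.2 (hh.monotoneOn_deriv (Real.sqrt_nonneg _)
          (Real.sqrt_nonneg _) (Real.sqrt_le_sqrt hy)))
    · exact mul_nonneg
        (sub_nonneg.2 ((strictMono_heightReg hρ hε).monotone hy))
        (sub_nonneg.2 (hh.monotoneOn_deriv (Real.sqrt_nonneg _)
          (Real.sqrt_nonneg _) (Real.sqrt_le_sqrt hy)))
  have hkη : ∀ s ≥ T, k s ≤ η := by
    intro s hs
    have h1 : ‖k s‖ ≤ η * |1 - 0| := by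
      refine intervalIntegral.norm_integral_le_of_norm_le_const fun t _ => ?_
      rw [Real.norm_eq_abs, abs_mul]
      calc _ ≤ 1 * η := mul_le_mul (abs_smoothSign_le hν _) (hT s hs t) (abs_nonneg _) zero_le_one
        _ = η := one_mul η
    rw [sub_zero, abs_one, mul_one] at h1
    exact (le_abs_self _).trans h1
  have hcD := fun s (hs : 0 ≤ s) => hS.continuous_heightDiff_slice hS' hρ hε hs
  have hcq : ∀ s, 0 ≤ s → IntervalIntegrable (fun t => √(heightDiff ρ ε N N' (s, t) ^ 2 + ν ^ 2))
      MeasureTheory.volume 0 1 := fun s hs =>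
    ((contDiff_sqrt_sq_add hν).continuous.comp (hcD s hs)).intervalIntegrable 0 1
  have hca : ∀ s, 0 ≤ s → IntervalIntegrable (fun t => |heightDiff ρ ε N N' (s, t)|)
      MeasureTheory.volume 0 1 := fun s hs => (hcD s hs).abs.intervalIntegrable 0 1
  have hΦlow : ∀ s, 0 ≤ s → ∫ t in (0 : ℝ)..1, |heightDiff ρ ε N N' (s, t)| ≤ Φ s := fun s hs =>
    intervalIntegral.integral_mono_on zero_le_one (hca s hs) (hcq s hs)
      fun t _ => abs_le_sqrt_sq_add ν _
  have hΦup : ∀ s, 0 ≤ s → Φ s ≤ ν + ∫ t in (0 : ℝ)..1, |heightDiff ρ ε N N' (s, t)| := by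
    intro s hs
    calc Φ s ≤ ∫ t in (0 : ℝ)..1, (ν + |heightDiff ρ ε N N' (s, t)|) :=
          intervalIntegral.integral_mono_on zero_le_one (hcq s hs)
            (intervalIntegrable_const.add (hca s hs))
            fun t _ => (sqrt_sq_add_le hν _).trans_eq (add_comm _ _)
      _ = _ := by
          rw [intervalIntegral.integral_add intervalIntegrable_const (hca s hs)]
          simp
  have hΦν : ∀ s, 0 ≤ s → ν ≤ Φ s := by
    intro s hs
    calc ν = ∫ t in (0 : ℝ)..1, ν := by simp
      _ ≤ Φ s := intervalIntegral.integral_mono_on zero_le_one intervalIntegrable_const (hcq s hs)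
          fun t _ => Real.le_sqrt_of_sq_le (by nlinarith [sq_nonneg (heightDiff ρ ε N N' (s, t))])
  have hΦR : ∀ s, 0 ≤ s → Φ s ≤ ν + √R := by
    intro s hs
    refine (hΦup s hs).trans (add_le_add_right ?_ ν)
    calc _ ≤ ∫ t in (0 : ℝ)..1, √R := intervalIntegral.integral_mono_on zero_le_one (hca s hs)
          intervalIntegrable_const fun t _ => hS.abs_heightDiff_le hS' hρ hε hR hR' hs
      _ = √R := by simp
  obtain ⟨s', hs', h1⟩ := exists_hasDerivAt_eq_slope Φ _ (by linarith : T < 2 * T)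
    (fun s hs => (hd s (lt_of_lt_of_le hT0 hs.1)).continuousAt.continuousWithinAt)
    (fun s hs => hd s (hT0.trans hs.1))
  have hs'0 : 0 < s' := hT0.trans hs'.1
  -- By boundedness of Φ its mean slope on [T, 2T] is at most √R/T; adding k, at most η beyond T,
  -- bounds W.
  have h2 : W s' ≤ √R / T + η := by
    have h3 : (Φ (2 * T) - Φ T) / (2 * T - T) ≤ √R / T := by
      rw [show 2 * T - T = T by ring]
      gcongr
      linarith [hΦR (2 * T) (by linarith), hΦν T hT0.le]
    linarith [hkη s' hs'.1.le]
  -- Propagation backwards from s': the contact integrals grow by at most their deficits at σ, and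
  -- s' - ξ is less than 2T.
  have hWle : ∀ ξ, σ ≤ ξ → ξ ≤ s → W ξ ≤ √R / T + η + ((deriv h r - contactReg N a ε σ) +
        (deriv h r - contactReg N' a' ε σ)) + C ^ 2 * ν / 4 * (2 * T) := by
    intro ξ h3 h4
    have h5 := hS.monotoneOn_signedContact hS' hρ hh hε hε1 hν hC0 hC
      (mem_Ioi.2 (hσ.trans_le h3)) (mem_Ioi.2 hs'0) (h4.trans (hsT.trans hs'.1.le))
    simp only at h5
    have h6 := hS.contactReg_le hρ hh hN hr hε hε1 hs'0
    have h7 := hS'.contactReg_le hρ hh hN' hr hε hε1 hs'0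
    have h8 := hS.monotoneOn_contactReg hρ hh hε hε1 hσ (hσ.trans_le h3) h3
    have h9 := hS'.monotoneOn_contactReg hρ hh hε hε1 hσ (hσ.trans_le h3) h3
    have h10 : C ^ 2 * ν / 4 * (s' - ξ) ≤ C ^ 2 * ν / 4 * (2 * T) :=
      mul_le_mul_of_nonneg_left (by linarith [hs'.2, hσ.trans_le h3]) (by positivity)
    simp only [hW] at h2 ⊢
    linarith
  have h3 := (convex_Icc σ s).image_sub_le_mul_sub_of_deriv_le (f := Φ)
    (fun ξ hξ => (hd ξ (hσ.trans_le hξ.1)).continuousAt.continuousWithinAt)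
    (fun ξ hξ => (hd ξ (hσ.trans_le
      (interior_subset hξ).1)).differentiableAt.differentiableWithinAt)
    (C := √R / T + η + ((deriv h r - contactReg N a ε σ) +
        (deriv h r - contactReg N' a' ε σ)) + C ^ 2 * ν / 4 * (2 * T)) (fun ξ hξ => by
      have h4 := interior_subset hξ
      rw [(hd ξ (hσ.trans_le h4.1)).deriv]
      linarith [hWle ξ h4.1 h4.2, hk0 ξ])
    σ ⟨le_rfl, hσs⟩ s ⟨hσs, le_rfl⟩ hσs
  have h4 := hΦlow s (hσ.le.trans hσs)
  have h5 := hΦup σ hσ.le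
  linarith

/-- Two solutions of minimal contact area over the same radius have the same height. -/
theorem N_eq_of_integral_eq (hS : IsFloerScalars ρ h N a b Q S)
    (hS' : IsFloerScalars ρ h N' a' b' Q' S') (hρ : IsCylindricalProfile ρ)
    (hh : IsLinearProfile μ δ h) (hN : TendsToRadius N r) (hN' : TendsToRadius N' r) (hr : 0 < r)
    (heq : ∫ t in (0 : ℝ)..1, √(Q (0, t)) = deriv h r)
    (heq' : ∫ t in (0 : ℝ)..1, √(Q' (0, t)) = deriv h r) (hs : 0 < s) (t : ℝ) :
    N (s, t) = N' (s, t) := by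
  obtain ⟨R₁, hR₁1, hR₁⟩ := hS.exists_N_le hN
  obtain ⟨R₂, hR₂1, hR₂⟩ := hS'.exists_N_le hN'
  set R := max R₁ R₂ with hRdef
  have hR1 : 1 ≤ R := hR₁1.trans (le_max_left _ _)
  have hR : ∀ s t, 0 ≤ s → N (s, t) ≤ R := fun s t hs => (hR₁ s t hs).trans (le_max_left _ _)
  have hR' : ∀ s t, 0 ≤ s → N' (s, t) ≤ R := fun s t hs => (hR₂ s t hs).trans (le_max_right _ _)
  obtain ⟨C, hC0, hC⟩ := hh.exists_bound hρ
  set c₀ := (√R)⁻¹ / (2 * ρ √R) with hc₀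
  have hsR : 0 < √R := Real.sqrt_pos.2 (by linarith)
  have hc₀pos : 0 < c₀ := div_pos (inv_pos.2 hsR) (mul_pos two_pos (hρ.pos _ hsR.le))
  have hcN := hS.continuous_N_slice hs.le
  have hcN' := hS'.continuous_N_slice hs.le
  have hpos : ∀ᶠ s : ℝ in 𝓝[>] 0, 0 < s := self_mem_nhdsWithin
  have hlt : ∀ᶠ s : ℝ in 𝓝[>] 0, s < 1 := nhdsWithin_le_nhds (Iio_mem_nhds one_pos)
  have hlts : ∀ᶠ σ : ℝ in 𝓝[>] 0, σ < s := nhdsWithin_le_nhds (Iio_mem_nhds hs)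
  set X := ∫ t in (0 : ℝ)..1, |N (s, t) - N' (s, t)| with hX
  set d : ℝ → ℝ := fun σ => ∫ t in (0 : ℝ)..1, (√(N (σ, t)) + √(N' (σ, t))) with hd
  -- The constant c₀ is independent of ε, so the final bound can be read on |p|² itself.
  have hXle : ∀ ε, 0 < ε → ε ≤ 1 → c₀ * X ≤ ∫ t in (0 : ℝ)..1, |heightDiff ρ ε N N' (s, t)| := by
    intro ε hε hε1
    rw [hX, ← intervalIntegral.integral_const_mul]
    refine intervalIntegral.integral_mono_on zero_le_one
      ((continuous_const.mul (hcN.sub hcN').abs).intervalIntegrable _ _)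
      ((hS.continuous_heightDiff_slice hS' hρ hε hs.le).abs.intervalIntegrable _ _) fun t _ => ?_
    rcases le_total (N (s, t)) (N' (s, t)) with hy | hy
    · rw [abs_sub_comm, heightDiff, abs_sub_comm (heightReg _ _ _), abs_of_nonneg (sub_nonneg.2 hy)]
      exact (heightReg_sub_ge hρ hε hε1 hy hR1 (hR' s t hs.le)).trans (le_abs_self _)
    · rw [heightDiff, abs_of_nonneg (sub_nonneg.2 hy)]
      exact (heightReg_sub_ge hρ hε hε1 hy hR1 (hR s t hs.le)).trans (le_abs_self _)
  have hdle : ∀ ε σ, 0 < ε → 0 < σ →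
      ∫ t in (0 : ℝ)..1, |heightDiff ρ ε N N' (σ, t)| ≤ d σ := by
    intro ε σ hε hσ
    refine intervalIntegral.integral_mono_on zero_le_one
      ((hS.continuous_heightDiff_slice hS' hρ hε hσ.le).abs.intervalIntegrable _ _)
      (((Real.continuous_sqrt.comp (hS.continuous_N_slice hσ.le)).add
        (Real.continuous_sqrt.comp (hS'.continuous_N_slice hσ.le))).intervalIntegrable _ _)
      fun t _ => ?_
    have h1 := hS.height_mem hρ hε hR hσ.le (t := t)
    have h2 := hS'.height_mem hρ hε hR' hσ.le (t := t)
    have h3 := heightReg_le_sqrt hρ hε (hS.N_nonneg (σ, t))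
    have h4 := heightReg_le_sqrt hρ hε (hS'.N_nonneg (σ, t))
    rw [heightDiff, abs_le]
    constructor <;> linarith [h1.1, h2.1]
  have hd0 : Tendsto d (𝓝[>] 0) (𝓝 0) := by
    have h1 := (continuousOn_integral_slice (F := fun z => √(N z) + √(N' z))
      ((Real.continuous_sqrt.comp_continuousOn hS.smooth_N.continuousOn).add
        (Real.continuous_sqrt.comp_continuousOn hS'.smooth_N.continuousOn)) 0 (mem_Ici.2 le_rfl))
    have h2 : d 0 = 0 := by simp [hd, hS.N_zero, hS'.N_zero]
    have h3 : Tendsto d (𝓝[≥] 0) (𝓝 (d 0)) := h1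
    rw [h2] at h3
    exact h3.mono_left (nhdsWithin_mono _ Ioi_subset_Ici_self)
  -- The limits are ordered: T is chosen from η', then ε and ν tend to 0 with σ and T fixed, then η
  -- tends to 0, and only afterwards σ, where both heights vanish.
  have key : ∀ σ, 0 < σ → σ < s → c₀ * X ≤ d σ := by
    intro σ hσ hσs
    refine le_of_forall_pos_le_add fun η hη => ?_
    -- There are two errors of size η', namely √R/T and the tail of h', over an interval of length
    -- at most s.
    set η' := η / (2 * s) with hη'
    have hη'pos : 0 < η' := by positivity
    obtain ⟨T₁, hT₁⟩ := exists_deriv_sub_lt hh hN hr (half_pos hη'pos)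
    obtain ⟨T₂, hT₂⟩ := exists_deriv_sub_lt hh hN' hr (half_pos hη'pos)
    set T := max (max T₁ T₂) (max s (√R / η')) with hT
    have hTη : ∀ s ≥ T, ∀ t, |deriv h √(N (s, t)) - deriv h √(N' (s, t))| ≤ η' := by
      intro s hs t
      have h1 := abs_lt.1 (hT₁ s (((le_max_left _ _).trans (le_max_left _ _)).trans hs) t)
      have h2 := abs_lt.1 (hT₂ s (((le_max_right _ _).trans (le_max_left _ _)).trans hs) t)
      rw [abs_le]
      constructor <;> linarith [h1.1, h1.2, h2.1, h2.2]
    have hsT : s ≤ T := (le_max_left _ _).trans (le_max_right _ _)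
    have hT0 : 0 < T := hs.trans_le hsT
    have hRT : √R / T ≤ η' := by
      have h1 : √R / η' ≤ T := (le_max_right _ _).trans (le_max_right _ _)
      rw [div_le_iff₀ hη'pos] at h1
      rw [div_le_iff₀ hT0]
      linarith
    -- A single parameter governs both regularizations: ε = τ² and ν = τ.
    have h1 : ∀ᶠ τ : ℝ in 𝓝[>] 0, c₀ * X ≤ τ + d σ + (s - σ) * (√R / T + η' +
        ((deriv h r - contactReg N a (τ ^ 2) σ) + (deriv h r - contactReg N' a' (τ ^ 2) σ)) +
        C ^ 2 * τ / 4 * (2 * T)) := by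
      filter_upwards [hpos, hlt] with τ h1 h2
      have hε : 0 < τ ^ 2 := by positivity
      have hε1 : τ ^ 2 ≤ 1 := by nlinarith
      refine (hXle _ hε hε1).trans ((hS.integral_heightDiff_le hS' hρ hh hN hN' hr hε hε1 h1 hR hR'
        hC0 hC hσ hσs.le hsT hTη).trans ?_)
      linarith [hdle _ σ hε hσ]
    have htau : Tendsto (fun τ : ℝ => τ) (𝓝[>] 0) (𝓝 0) := nhdsWithin_le_nhds
    have h2 := ge_of_tendsto ((htau.add_const (d σ)).add (((tendsto_const_nhds (x := √R / T + η')).add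
      (((tendsto_const_nhds (x := deriv h r)).sub
        (hS.tendsto_contactReg_of_eq hρ hh hN hr heq hσ)).add
      ((tendsto_const_nhds (x := deriv h r)).sub
        (hS'.tendsto_contactReg_of_eq hρ hh hN' hr heq' hσ)))).add
      (((htau.const_mul (C ^ 2)).div_const 4).mul_const (2 * T)) |>.const_mul (s - σ))) h1
    have h3 : (s - σ) * (√R / T + η') ≤ η := by
      calc _ ≤ s * (η' + η') := mul_le_mul (by linarith) (by linarith)
            (add_nonneg (div_nonneg hsR.le hT0.le) hη'pos.le) hs.le
        _ = η := by
            rw [hη']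
            field_simp
            ring
    simp only [sub_self, add_zero, mul_zero, zero_div, zero_mul, zero_add] at h2
    linarith
  have hX0 : c₀ * X ≤ 0 := by
    refine ge_of_tendsto hd0 ?_
    filter_upwards [hpos, hlts] with σ h1 h2 using key σ h1 h2
  have hX1 : X ≤ 0 := by nlinarith
  have h1 := eq_zero_of_integral_eq_zero (f := fun t => |N (s, t) - N' (s, t)|) (hcN.sub hcN').abs
    (fun t => abs_nonneg _)
    (fun t => by simp only [hS.periodic_N s t hs.le, hS'.periodic_N s t hs.le]) hX1 t
  exact sub_eq_zero.1 (abs_eq_zero.1 h1)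

/-- The rotated solution has the same limit radius and the same boundary length, so the comparison
applies to it. -/
theorem N_eq_shift (hS : IsFloerScalars ρ h N a b Q S) (hρ : IsCylindricalProfile ρ)
    (hh : IsLinearProfile μ δ h) (hN : TendsToRadius N r) (hr : 0 < r)
    (heq : ∫ t in (0 : ℝ)..1, √(Q (0, t)) = deriv h r) (hs : 0 < s) (c : ℝ) :
    N (s, t) = N (s, t + c) := by
  have h1 := hS.N_eq_of_integral_eq (hS.shift c) hρ hh hN
    (fun η hη => by
      obtain ⟨T, hT⟩ := hN η hη
      refine ⟨T, fun s hs t => ?_⟩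
      simpa using hT s hs (t + c)) hr heq ?_ hs t
  · simpa using h1
  · have h2 : Function.Periodic (fun t => √(Q (0, t))) 1 := fun t => by
      have h3 := hS.periodic_Q_add_S hρ (s := 0) (t := t) le_rfl
      rw [hS.S_zero, hS.S_zero, add_zero, add_zero] at h3
      simp only [h3]
    have h3 := h2.intervalIntegral_add_eq c 0
    have h4 : ∫ t in (0 : ℝ)..1, √(Q ((0, t) + (0, c))) = ∫ t in c..c + 1, √(Q (0, t)) := by
      have h5 := intervalIntegral.integral_comp_add_right (a := 0) (b := 1)
        (fun t => √(Q (0, t))) c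
      simp only [zero_add, add_comm 1 c] at h5
      simpa using h5
    rw [h4, h3, zero_add, heq]

/-- The structure of solutions of minimal contact area. -/
theorem rigidity (hS : IsFloerScalars ρ h N a b Q S) (hρ : IsCylindricalProfile ρ)
    (hh : IsLinearProfile μ δ h) (hN : TendsToRadius N r) (hr : 0 < r) (hL : 0 < deriv h r)
    (heq : ∫ t in (0 : ℝ)..1, √(Q (0, t)) = deriv h r) (hs : 0 < s) (t : ℝ) :
    0 < N (s, t) ∧ b (s, t) = 0 ∧ S (s, t) = 0 ∧ a (s, t) = deriv h r * √(N (s, t)) ∧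
      N (s, t) * Q (s, t) = a (s, t) ^ 2 := by
  have hNt : ∀ {s : ℝ}, 0 < s → ∀ t, N (s, t) = N (s, 0) := by
    intro s hs t
    simpa using (hS.N_eq_shift hρ hh hN hr heq hs (t := 0) t).symm
  have hdef := hS.defect_eq_zero hρ hh hN hr heq hs
  have hlim := hS.tendsto_contactReg_of_eq hρ hh hN hr heq hs
  -- A zero of N would spread over the whole circle, making a and every regularized contact integral
  -- zero there, against their limit h'(r) > 0.
  have hpos : 0 < N (s, 0) := by
    refine lt_of_le_of_ne (hS.N_nonneg _) fun h0 => ?_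
    have h1 : ∀ t, a (s, t) = 0 := fun t => by
      have h2 := hS.a_sq_le (s, t)
      rw [hNt hs, ← h0, zero_mul] at h2
      exact pow_eq_zero_iff two_ne_zero |>.1 (le_antisymm h2 (sq_nonneg _))
    have h2 : ∀ ε, contactReg N a ε s = 0 := fun ε => by simp [contactReg, h1]
    simp only [h2] at hlim
    exact hL.ne (tendsto_nhds_unique tendsto_const_nhds hlim)
  have hb : b (s, t) = 0 := by
    have h1 := hS.hasDerivAt_N_snd hs.le (t := t)
    rw [show (fun t => N (s, t)) = fun _ => N (s, 0) from funext fun t => hNt hs t] at h1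
    have h2 := h1.unique (hasDerivAt_const t (N (s, 0)))
    have h3 := hρ.pos _ (Real.sqrt_nonneg (N (s, t)))
    rw [neg_eq_zero] at h2
    exact (mul_eq_zero.1 h2).resolve_left (by positivity)
  -- Since N does not depend on t, neither does ∂_s N, which determines a.
  have hat : ∀ t, a (s, t) = a (s, 0) := by
    intro t
    have h1 := hS.hasDerivAt_N_fst hs (t := t)
    have h2 : (fun s => N (s, t)) =ᶠ[𝓝 s] fun s => N (s, 0) := by
      filter_upwards [Ioi_mem_nhds hs] with s' hs' using hNt hs' t
    have h3 := h1.unique ((hS.hasDerivAt_N_fst hs (t := 0)).congr_of_eventuallyEq h2)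
    rw [hNt hs t] at h3
    have h4 := hρ.pos _ (Real.sqrt_nonneg (N (s, 0)))
    have h5 := mul_left_cancel₀ (by positivity) h3
    linarith
  have hsq := Real.sqrt_pos.2 hpos
  -- Once ε is below √N the regularized contact integral is exactly a/√N, and its limit is h'(r).
  have ha : a (s, 0) = deriv h r * √(N (s, 0)) := by
    have h1 : ∀ᶠ τ : ℝ in 𝓝[>] 0, contactReg N a (τ ^ 2) s = (√(N (s, 0)))⁻¹ * a (s, 0) := by
      have h2 : Tendsto (fun τ : ℝ => (τ ^ 2) ^ 2) (𝓝[>] 0) (𝓝 0) := by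
        have : Continuous fun s : ℝ => (s ^ 2) ^ 2 := by fun_prop
        exact (by simpa using this.tendsto 0 :
          Tendsto (fun s : ℝ => (s ^ 2) ^ 2) (𝓝 0) (𝓝 0)).mono_left nhdsWithin_le_nhds
      have h3 : ∀ᶠ s : ℝ in 𝓝[>] 0, 0 < s := self_mem_nhdsWithin
      filter_upwards [h3, h2.eventually_lt_const hpos] with τ h4 h5
      have h6 : ∀ t, invSqrtReg (τ ^ 2) (N (s, t)) * a (s, t) = (√(N (s, 0)))⁻¹ * a (s, 0) :=
        fun t => by rw [hNt hs, hat, invSqrtReg_of_le (by positivity) h5.le]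
      simp [contactReg, h6]
    have h2 := tendsto_nhds_unique (tendsto_const_nhds.congr' (EventuallyEq.symm h1)) hlim
    rw [← h2]
    field_simp
  refine ⟨by rwa [hNt hs], hb, ?_, by rw [hat, ha, hNt hs t], (hdef t).1⟩
  have h1 := (hdef t).2
  rw [hb, hNt hs] at h1
  exact (mul_eq_zero.1 (h1.trans (by norm_num))).resolve_left hpos.ne'

end

end IsFloerScalars

end

/-! ### Unique continuation for a perturbed Cauchy-Riemann system. -/

section

section UniqueContinuation

variable {A B : ℝ × ℝ → ℝ} {σ C s : ℝ}

theorem contDiffOn_fderiv_strip {I : Set ℝ} (hI : IsOpen I) (hA : ContDiffOn ℝ 2 A (I ×ˢ univ))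
    (e : ℝ × ℝ) : ContDiffOn ℝ 1 (fun z => fderiv ℝ A z e) (I ×ˢ univ) :=
  (hA.fderiv_of_isOpen (m := 1) (hI.prod isOpen_univ) (by norm_num)).clm_apply contDiffOn_const

theorem fderiv_fderiv_comm {I : Set ℝ} (hI : IsOpen I) (hA : ContDiffOn ℝ 2 A (I ×ˢ univ))
    (hs : s ∈ I) (t : ℝ) (e e' : ℝ × ℝ) :
    fderiv ℝ (fun z => fderiv ℝ A z e) (s, t) e' = fderiv ℝ (fun z => fderiv ℝ A z e') (s, t) e := by
  have h0 : ContDiffAt ℝ 2 A (s, t) :=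
    hA.contDiffAt ((hI.prod isOpen_univ).mem_nhds ⟨hs, mem_univ t⟩)
  have h1 : DifferentiableAt ℝ (fderiv ℝ A) (s, t) :=
    (h0.fderiv_right (m := 1) (by norm_num)).differentiableAt one_ne_zero
  have h2 : IsSymmSndFDerivAt ℝ A (s, t) := h0.isSymmSndFDerivAt (by simp)
  have h3 : ∀ v w, fderiv ℝ (fun z => fderiv ℝ A z v) (s, t) w =
      fderiv ℝ (fderiv ℝ A) (s, t) w v := by
    intro v w
    rw [fderiv_clm_apply h1 (differentiableAt_const v)]
    simp
  rw [h3, h3, h2.eq]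

theorem fderiv_strip_periodic {I : Set ℝ} (hI : IsOpen I) (hA : ContDiffOn ℝ 1 A (I ×ˢ univ))
    (hp : ∀ s t, s ∈ I → A (s, t + 1) = A (s, t)) (hs : s ∈ I) :
    fderiv ℝ A (s, 1) (1, 0) = fderiv ℝ A (s, 0) (1, 0) := by
  refine (hasDerivAt_strip_fst hI hA hs 1).unique
    ((hasDerivAt_strip_fst hI hA hs 0).congr_of_eventuallyEq ?_)
  filter_upwards [hI.mem_nhds hs] with y hy
  simpa using hp y 0 hy

/-- The frequency function estimate for a perturbed Cauchy-Riemann system: the derivative of the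
energy. -/
theorem hasDerivAt_energy {I : Set ℝ} (hI : IsOpen I) (hA : ContDiffOn ℝ 2 A (I ×ˢ univ))
    (hB : ContDiffOn ℝ 2 B (I ×ˢ univ)) (hAp : ∀ s t, s ∈ I → A (s, t + 1) = A (s, t))
    (hBp : ∀ s t, s ∈ I → B (s, t + 1) = B (s, t))
    (h1 : ∀ s ∈ I, ∀ t, fderiv ℝ A (s, t) (1, 0) = -fderiv ℝ B (s, t) (0, 1)) (hs : s ∈ I) :
    HasDerivAt (fun s => ∫ t in (0 : ℝ)..1, (A (s, t) ^ 2 + B (s, t) ^ 2))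
      (∫ t in (0 : ℝ)..1, (4 * (B (s, t) * fderiv ℝ A (s, t) (0, 1)) +
        2 * B (s, t) * (fderiv ℝ B (s, t) (1, 0) - fderiv ℝ A (s, t) (0, 1)))) s := by
  have hA1 : ContDiffOn ℝ 1 A (I ×ˢ univ) := hA.of_le (by norm_num)
  have hB1 : ContDiffOn ℝ 1 B (I ×ˢ univ) := hB.of_le (by norm_num)
  have h2 := hasDerivAt_integral_strip_sub hI (F := fun z => A z ^ 2 + B z ^ 2)
    (G := fun z => -(2 * A z * B z)) ((hA1.pow 2).add (hB1.pow 2))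
    ((contDiffOn_const.mul hA1).mul hB1).neg hs
    (by
      have e1 := hAp s 0 hs
      have e2 := hBp s 0 hs
      rw [zero_add] at e1 e2
      simp only [e1, e2])
    (fun t => ((hasDerivAt_strip_fst hI hA1 hs t).pow 2).add ((hasDerivAt_strip_fst hI hB1 hs t).pow 2))
    (fun t => (((hasDerivAt_strip_snd hI hA1 hs t).const_mul 2).mul
      (hasDerivAt_strip_snd hI hB1 hs t)).neg)
  refine h2.congr_deriv (intervalIntegral.integral_congr fun t _ => ?_)
  simp only [h1 s hs t]
  push_cast
  ring

/-- Subtracting ∂_t(2B ∂_s A) removes the mixed second derivative and leaves -2 ∂_t B ∂_s A = 2(∂_t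
B)². -/
theorem hasDerivAt_frequency {I : Set ℝ} (hI : IsOpen I) (hA : ContDiffOn ℝ 2 A (I ×ˢ univ))
    (hB : ContDiffOn ℝ 2 B (I ×ˢ univ)) (hAp : ∀ s t, s ∈ I → A (s, t + 1) = A (s, t))
    (hBp : ∀ s t, s ∈ I → B (s, t + 1) = B (s, t))
    (h1 : ∀ s ∈ I, ∀ t, fderiv ℝ A (s, t) (1, 0) = -fderiv ℝ B (s, t) (0, 1)) (hs : s ∈ I) :
    HasDerivAt (fun s => ∫ t in (0 : ℝ)..1, 2 * B (s, t) * fderiv ℝ A (s, t) (0, 1))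
      (∫ t in (0 : ℝ)..1, (2 * fderiv ℝ A (s, t) (0, 1) ^ 2 + 2 * fderiv ℝ B (s, t) (0, 1) ^ 2 +
        2 * (fderiv ℝ B (s, t) (1, 0) - fderiv ℝ A (s, t) (0, 1)) *
          fderiv ℝ A (s, t) (0, 1))) s := by
  have hA1 : ContDiffOn ℝ 1 A (I ×ˢ univ) := hA.of_le (by norm_num)
  have hB1 : ContDiffOn ℝ 1 B (I ×ˢ univ) := hB.of_le (by norm_num)
  have h2 := hasDerivAt_integral_strip_sub hI (F := fun z => 2 * B z * fderiv ℝ A z (0, 1))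
    (G := fun z => 2 * B z * fderiv ℝ A z (1, 0))
    ((contDiffOn_const.mul hB1).mul (contDiffOn_fderiv_strip hI hA _))
    ((contDiffOn_const.mul hB1).mul (contDiffOn_fderiv_strip hI hA _)) hs
    (by
      have e2 := hBp s 0 hs
      rw [zero_add] at e2
      simp only [e2, fderiv_strip_periodic hI hA1 hAp hs])
    (fun t => ((hasDerivAt_strip_fst hI hB1 hs t).const_mul 2).mul
      (hasDerivAt_strip_fst hI (contDiffOn_fderiv_strip hI hA (0, 1)) hs t))
    (fun t => ((hasDerivAt_strip_snd hI hB1 hs t).const_mul 2).mul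
      (hasDerivAt_strip_snd hI (contDiffOn_fderiv_strip hI hA (1, 0)) hs t))
  refine h2.congr_deriv (intervalIntegral.integral_congr fun t _ => ?_)
  simp only [h1 s hs t, fderiv_fderiv_comm hI hA hs t (0, 1) (1, 0)]
  ring

/-- Unique continuation from the boundary for a perturbed Cauchy-Riemann system. -/
theorem cauchyRiemann_unique_continuation (hA : ContDiffOn ℝ 2 A (Ioo 0 σ ×ˢ univ))
    (hB : ContDiffOn ℝ 2 B (Ioo 0 σ ×ˢ univ))
    (hAp : ∀ s t, s ∈ Ioo 0 σ → A (s, t + 1) = A (s, t))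
    (hBp : ∀ s t, s ∈ Ioo 0 σ → B (s, t + 1) = B (s, t))
    (h1 : ∀ s ∈ Ioo 0 σ, ∀ t, fderiv ℝ A (s, t) (1, 0) = -fderiv ℝ B (s, t) (0, 1))
    (hC0 : 0 ≤ C) (h2 : ∀ s ∈ Ioo 0 σ, ∀ t,
      |fderiv ℝ B (s, t) (1, 0) - fderiv ℝ A (s, t) (0, 1)| ≤ C * |B (s, t)|)
    (hE : Tendsto (fun s => ∫ t in (0 : ℝ)..1, (A (s, t) ^ 2 + B (s, t) ^ 2)) (𝓝[>] 0) (𝓝 0))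
    (hs : s ∈ Ioo 0 σ) (t : ℝ) : A (s, t) = 0 ∧ B (s, t) = 0 := by
  have hI : IsOpen (Ioo 0 σ) := isOpen_Ioo
  have hA1 : ContDiffOn ℝ 1 A (Ioo 0 σ ×ˢ univ) := hA.of_le (by norm_num)
  have hB1 : ContDiffOn ℝ 1 B (Ioo 0 σ ×ˢ univ) := hB.of_le (by norm_num)
  set E : ℝ → ℝ := fun s => ∫ t in (0 : ℝ)..1, (A (s, t) ^ 2 + B (s, t) ^ 2) with hEdef
  set K : ℝ → ℝ := fun s => ∫ t in (0 : ℝ)..1, 2 * B (s, t) * fderiv ℝ A (s, t) (0, 1) with hKdef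
  have cA := fun s (hs : s ∈ Ioo 0 σ) => continuous_slice hA.continuousOn hs
  have cB := fun s (hs : s ∈ Ioo 0 σ) => continuous_slice hB.continuousOn hs
  have cAt := fun s (hs : s ∈ Ioo 0 σ) => continuous_fderiv_slice hI hA1 hs (0, 1)
  have cBt := fun s (hs : s ∈ Ioo 0 σ) => continuous_fderiv_slice hI hB1 hs (0, 1)
  have cBs := fun s (hs : s ∈ Ioo 0 σ) => continuous_fderiv_slice hI hB1 hs (1, 0)
  have hdE := fun s (hs : s ∈ Ioo 0 σ) => hasDerivAt_energy hI hA hB hAp hBp h1 hs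
  have hdK : ∀ s ∈ Ioo 0 σ, HasDerivAt K _ s := fun s hs => hasDerivAt_frequency hI hA hB hAp hBp h1 hs
  have hE0 : ∀ s, 0 ≤ E s := fun s =>
    intervalIntegral.integral_nonneg zero_le_one fun t _ => by positivity
  suffices hmain : E s ≤ 0 by
    have h3 := IsFloerScalars.eq_zero_of_integral_eq_zero (f := fun t => A (s, t) ^ 2 + B (s, t) ^ 2)
      (((cA s hs).pow 2).add ((cB s hs).pow 2)) (fun t => by positivity)
      (fun t => by simp only [hAp s t hs, hBp s t hs]) hmain t
    constructor <;> nlinarith [sq_nonneg (A (s, t)), sq_nonneg (B (s, t))]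
  by_contra! hpos
  -- the last zero of the energy before `s`
  set E' : ℝ → ℝ := fun s => if s ≤ 0 then 0 else E s with hE'def
  have hE'eq : ∀ s, 0 < s → E' s = E s := fun s hs => if_neg (not_le.2 hs)
  have hE'c : ContinuousOn E' (Icc 0 s) := by
    intro y hy
    rcases hy.1.eq_or_lt with rfl | hy0
    · have h3 : Tendsto E' (𝓝[>] 0) (𝓝 0) := by
        refine hE.congr' ?_
        filter_upwards [self_mem_nhdsWithin] with z hz using (hE'eq z hz).symm
      have h4 : E' 0 = 0 := if_pos le_rfl
      have h5 : ContinuousWithinAt E' (Ioi 0) 0 := by rwa [ContinuousWithinAt, h4]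
      have h6 := h5.insert
      rw [Ioi_insert] at h6
      exact h6.mono Icc_subset_Ici_self
    · have h3 := (hdE y ⟨hy0, hy.2.trans_lt hs.2⟩).continuousAt
      refine (h3.congr ?_).continuousWithinAt
      filter_upwards [Ioi_mem_nhds hy0] with z hz using (hE'eq z hz).symm
  have hZ : IsCompact (Icc 0 s ∩ E' ⁻¹' {0}) :=
    isCompact_Icc.of_isClosed_subset (hE'c.preimage_isClosed_of_isClosed isClosed_Icc
      isClosed_singleton) inter_subset_left
  obtain ⟨s₀, hs₀, hmax⟩ := hZ.exists_isGreatest ⟨0, ⟨le_rfl, hs.1.le⟩, if_pos le_rfl⟩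
  have hs₀s : s₀ < s := by
    refine lt_of_le_of_ne hs₀.1.2 fun h3 => ?_
    have h4 : E' s₀ = 0 := hs₀.2
    rw [h3, hE'eq s hs.1] at h4
    exact hpos.ne' h4
  have hmem : ∀ y ∈ Ioc s₀ s, y ∈ Ioo 0 σ := fun y hy =>
    ⟨hs₀.1.1.trans_lt hy.1, hy.2.trans_lt hs.2⟩
  have hEpos : ∀ y ∈ Ioc s₀ s, 0 < E y := by
    intro y hy
    refine lt_of_le_of_ne (hE0 y) fun h3 => ?_
    have h4 : E' y = 0 := by rw [hE'eq y (hmem y hy).1, ← h3]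
    exact absurd (hmax ⟨⟨(hmem y hy).1.le, hy.2⟩, h4⟩) (not_le.2 hy.1)
  have hBw : ∀ y ∈ Ioo 0 σ, (∫ t in (0 : ℝ)..1, 2 * B (y, t) * (fderiv ℝ B (y, t) (1, 0) -
      fderiv ℝ A (y, t) (0, 1))) ≤ 2 * C * E y := by
    intro y hy
    rw [hEdef, ← intervalIntegral.integral_const_mul]
    refine intervalIntegral.integral_mono_on zero_le_one
      (((continuous_const.mul (cB y hy)).mul ((cBs y hy).sub (cAt y hy))).intervalIntegrable _ _)
      ((continuous_const.mul (((cA y hy).pow 2).add ((cB y hy).pow 2))).intervalIntegrable _ _)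
      fun t _ => ?_
    have h3 := mul_le_mul_of_nonneg_left (h2 y hy t) (abs_nonneg (B (y, t)))
    rw [← abs_mul] at h3
    have h4 := (le_abs_self _).trans h3
    have h5 : |B (y, t)| * (C * |B (y, t)|) = C * B (y, t) ^ 2 := by rw [← sq_abs (B (y, t))]; ring
    nlinarith [mul_nonneg hC0 (sq_nonneg (A (y, t)))]
  have hdE' : ∀ y ∈ Ioo 0 σ, HasDerivAt E (2 * K y + ∫ t in (0 : ℝ)..1, 2 * B (y, t) *
      (fderiv ℝ B (y, t) (1, 0) - fderiv ℝ A (y, t) (0, 1))) y := by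
    intro y hy
    refine (hdE y hy).congr_deriv ?_
    rw [hKdef, ← intervalIntegral.integral_const_mul, ← intervalIntegral.integral_add]
    · exact intervalIntegral.integral_congr fun t _ => by ring
    · exact (continuous_const.mul
        ((continuous_const.mul (cB y hy)).mul (cAt y hy))).intervalIntegrable _ _
    · exact ((continuous_const.mul (cB y hy)).mul
        ((cBs y hy).sub (cAt y hy))).intervalIntegrable _ _
  -- The frequency K/E is almost nondecreasing, so going down towards s₀ it stays bounded above and
  -- E cannot decay to zero faster than exponentially.
  have hΛ : ∀ y ∈ Ioc s₀ s, ∃ l, HasDerivAt (fun y => K y / E y) l y ∧ -(C ^ 2 / 2) ≤ l := by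
    intro y hy
    have hyI := hmem y hy
    refine ⟨_, (hdK y hyI).div (hdE' y hyI) (hEpos y hy).ne', ?_⟩
    rw [le_div_iff₀ (by have := hEpos y hy; positivity)]
    set l := K y / E y with hl
    have hK : K y = l * E y := (div_mul_cancel₀ _ (hEpos y hy).ne').symm
    -- With w = ∂_s B - ∂_t A, the integral on the right equals K' - lE'. The lower bound is X² + Xw
    -- ≥ -w²/4 and |w| ≤ C|B|.
    have e1 : -(C ^ 2 / 2) * E y ≤ ∫ t in (0 : ℝ)..1,
        2 * ((fderiv ℝ A (y, t) (0, 1) - l * B (y, t)) ^ 2 +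
        (fderiv ℝ A (y, t) (0, 1) - l * B (y, t)) *
          (fderiv ℝ B (y, t) (1, 0) - fderiv ℝ A (y, t) (0, 1)) +
        (fderiv ℝ B (y, t) (0, 1) + l * A (y, t)) ^ 2) := by
      rw [hEdef, ← intervalIntegral.integral_const_mul]
      refine intervalIntegral.integral_mono_on zero_le_one
        ((continuous_const.mul (((cA y hyI).pow 2).add ((cB y hyI).pow 2))).intervalIntegrable _ _)
        ((continuous_const.mul (((((cAt y hyI).sub (continuous_const.mul (cB y hyI))).pow 2).add
          (((cAt y hyI).sub (continuous_const.mul (cB y hyI))).mul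
            ((cBs y hyI).sub (cAt y hyI)))).add
          (((cBt y hyI).add (continuous_const.mul (cA y hyI))).pow 2))).intervalIntegrable _ _)
        fun t _ => ?_
      have e2 : (fderiv ℝ B (y, t) (1, 0) - fderiv ℝ A (y, t) (0, 1)) ^ 2 ≤ C ^ 2 * B (y, t) ^ 2 := by
        rw [← sq_abs, ← sq_abs (B (y, t)), ← mul_pow]
        exact pow_le_pow_left₀ (abs_nonneg _) (h2 y hyI t) 2
      nlinarith [sq_nonneg (fderiv ℝ A (y, t) (0, 1) - l * B (y, t) +
        (fderiv ℝ B (y, t) (1, 0) - fderiv ℝ A (y, t) (0, 1)) / 2),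
        sq_nonneg (fderiv ℝ B (y, t) (0, 1) + l * A (y, t)),
        mul_nonneg (sq_nonneg C) (sq_nonneg (A (y, t)))]
    -- expansion of the square
    have i1 : IntervalIntegrable (fun t => 2 * fderiv ℝ A (y, t) (0, 1) ^ 2 +
        2 * fderiv ℝ B (y, t) (0, 1) ^ 2 + 2 * (fderiv ℝ B (y, t) (1, 0) -
        fderiv ℝ A (y, t) (0, 1)) * fderiv ℝ A (y, t) (0, 1)) MeasureTheory.volume 0 1 :=
      (((continuous_const.mul ((cAt y hyI).pow 2)).add
        (continuous_const.mul ((cBt y hyI).pow 2))).add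
        ((continuous_const.mul ((cBs y hyI).sub (cAt y hyI))).mul (cAt y hyI))).intervalIntegrable _ _
    have i2 : IntervalIntegrable (fun t => 2 * B (y, t) * fderiv ℝ A (y, t) (0, 1))
        MeasureTheory.volume 0 1 :=
      ((continuous_const.mul (cB y hyI)).mul (cAt y hyI)).intervalIntegrable _ _
    have i3 : IntervalIntegrable (fun t => 2 * B (y, t) * (fderiv ℝ B (y, t) (1, 0) -
        fderiv ℝ A (y, t) (0, 1))) MeasureTheory.volume 0 1 :=
      ((continuous_const.mul (cB y hyI)).mul ((cBs y hyI).sub (cAt y hyI))).intervalIntegrable _ _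
    have i4 : IntervalIntegrable (fun t => A (y, t) ^ 2 + B (y, t) ^ 2) MeasureTheory.volume 0 1 :=
      (((cA y hyI).pow 2).add ((cB y hyI).pow 2)).intervalIntegrable _ _
    have i5 : IntervalIntegrable (fun t => fderiv ℝ A (y, t) (0, 1) * B (y, t) +
        A (y, t) * fderiv ℝ B (y, t) (0, 1)) MeasureTheory.volume 0 1 :=
      (((cAt y hyI).mul (cB y hyI)).add ((cA y hyI).mul (cBt y hyI))).intervalIntegrable _ _
    have e3 : ∫ t in (0 : ℝ)..1, (fderiv ℝ A (y, t) (0, 1) * B (y, t) +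
        A (y, t) * fderiv ℝ B (y, t) (0, 1)) = 0 := by
      rw [intervalIntegral.integral_eq_sub_of_hasDerivAt (f := fun t => A (y, t) * B (y, t))
        (fun t _ => (hasDerivAt_strip_snd hI hA1 hyI t).mul (hasDerivAt_strip_snd hI hB1 hyI t)) i5]
      have e1 := hAp y 0 hyI
      have e2 := hBp y 0 hyI
      rw [zero_add] at e1 e2
      simp only [e1, e2, sub_self]
    have e4 : (∫ t in (0 : ℝ)..1,
        2 * ((fderiv ℝ A (y, t) (0, 1) - l * B (y, t)) ^ 2 +
        (fderiv ℝ A (y, t) (0, 1) - l * B (y, t)) *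
          (fderiv ℝ B (y, t) (1, 0) - fderiv ℝ A (y, t) (0, 1)) +
        (fderiv ℝ B (y, t) (0, 1) + l * A (y, t)) ^ 2)) =
        (∫ t in (0 : ℝ)..1, (2 * fderiv ℝ A (y, t) (0, 1) ^ 2 + 2 * fderiv ℝ B (y, t) (0, 1) ^ 2 +
          2 * (fderiv ℝ B (y, t) (1, 0) - fderiv ℝ A (y, t) (0, 1)) * fderiv ℝ A (y, t) (0, 1))) -
        4 * l * K y - l * (∫ t in (0 : ℝ)..1, 2 * B (y, t) * (fderiv ℝ B (y, t) (1, 0) -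
          fderiv ℝ A (y, t) (0, 1))) + 2 * l ^ 2 * E y + 4 * l * ∫ t in (0 : ℝ)..1,
          (fderiv ℝ A (y, t) (0, 1) * B (y, t) + A (y, t) * fderiv ℝ B (y, t) (0, 1)) := by
      rw [hKdef, hEdef]
      simp only [← intervalIntegral.integral_const_mul]
      rw [← intervalIntegral.integral_sub i1 (i2.const_mul _),
        ← intervalIntegral.integral_sub (i1.sub (i2.const_mul _)) (i3.const_mul _),
        ← intervalIntegral.integral_add ((i1.sub (i2.const_mul _)).sub (i3.const_mul _))
          (i4.const_mul _),
        ← intervalIntegral.integral_add (((i1.sub (i2.const_mul _)).sub (i3.const_mul _)).add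
          (i4.const_mul _)) (i5.const_mul _)]
      exact intervalIntegral.integral_congr fun t _ => by ring
    rw [e4, e3, hK] at e1
    have h3 := mul_le_mul_of_nonneg_right e1 (hEpos y hy).le
    rw [hK]
    linarith
  -- the frequency is bounded above
  set Λ : ℝ → ℝ := fun y => K y / E y with hΛdef
  have hΛle : ∀ y ∈ Ioc s₀ s, Λ y ≤ Λ s + C ^ 2 / 2 * (s - y) := by
    intro y hy
    have hsub : ∀ z ∈ Icc y s, z ∈ Ioc s₀ s := fun z hz => ⟨hy.1.trans_le hz.1, hz.2⟩
    have h3 := (convex_Icc y s).mul_sub_le_image_sub_of_le_deriv (f := Λ) (C := -(C ^ 2 / 2))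
      (fun z hz => by
        obtain ⟨l, hl, -⟩ := hΛ z (hsub z hz)
        exact hl.continuousAt.continuousWithinAt)
      (fun z hz => by
        obtain ⟨l, hl, -⟩ := hΛ z (hsub z (interior_subset hz))
        exact hl.differentiableAt.differentiableWithinAt)
      (fun z hz => by
        obtain ⟨l, hl, h3⟩ := hΛ z (hsub z (interior_subset hz))
        rwa [hl.deriv])
      y ⟨le_rfl, hy.2⟩ s ⟨hy.2, le_rfl⟩ hy.2
    linarith
  -- Chosen so that E' = 2K + ∫ 2Bw ≤ mE on (s₀, s], which makes E(y)exp(-my) nonincreasing.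
  set m := 2 * (Λ s + C ^ 2 / 2 * (s - s₀)) + 2 * C with hm
  have hlow : ∀ y ∈ Ioc s₀ s, E s * Real.exp (-(m * s)) ≤ E y * Real.exp (-(m * y)) := by
    intro y hy
    have hsub : ∀ z ∈ Icc y s, z ∈ Ioc s₀ s := fun z hz => ⟨hy.1.trans_le hz.1, hz.2⟩
    have hd : ∀ z ∈ Ioc s₀ s, HasDerivAt (fun y => E y * Real.exp (-(m * y))) _ z := fun z hz =>
      (hdE' z (hmem z hz)).mul (((hasDerivAt_id z).const_mul m).neg.exp)
    have h3 : AntitoneOn (fun y => E y * Real.exp (-(m * y))) (Icc y s) := by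
      refine antitoneOn_of_deriv_nonpos (convex_Icc y s)
        (fun z hz => (hd z (hsub z hz)).continuousAt.continuousWithinAt)
        (fun z hz => (hd z (hsub z (interior_subset hz))).differentiableAt.differentiableWithinAt)
        fun z hz => ?_
      have hz' := hsub z (interior_subset hz)
      rw [(hd z hz').deriv]
      have e1 := hBw z (hmem z hz')
      have e2 := hΛle z hz'
      have e3 : K z = Λ z * E z := (div_mul_cancel₀ _ (hEpos z hz').ne').symm
      have e4 : 0 ≤ C ^ 2 / 2 * (z - s₀) := mul_nonneg (by positivity) (by linarith [hz'.1])
      have e5 : 2 * Λ z ≤ 2 * (Λ s + C ^ 2 / 2 * (s - s₀)) := by linarith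
      have e6 := mul_le_mul_of_nonneg_right e5 (hEpos z hz').le
      have e7 : (2 * K z + ∫ t in (0 : ℝ)..1, 2 * B (z, t) *
          (fderiv ℝ B (z, t) (1, 0) - fderiv ℝ A (z, t) (0, 1))) - m * E z ≤ 0 := by
        rw [hm, e3]
        linarith
      have e8 := mul_nonpos_of_nonpos_of_nonneg e7 (Real.exp_pos (-(m * z))).le
      simp only [id, mul_one, Pi.neg_apply]
      linarith
    exact h3 ⟨le_rfl, hy.2⟩ ⟨hy.2, le_rfl⟩ hy.2
  have hlim : Tendsto (fun y => E' y * Real.exp (-(m * y))) (𝓝[>] s₀) (𝓝 0) := by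
    have h3 : ContinuousWithinAt (fun y => E' y * Real.exp (-(m * y))) (Icc 0 s) s₀ :=
      (hE'c s₀ hs₀.1).mul (by fun_prop)
    have h4 : E' s₀ = 0 := hs₀.2
    have h5 : Tendsto (fun y => E' y * Real.exp (-(m * y))) (𝓝[Icc 0 s] s₀) (𝓝 0) := by
      have := h3.tendsto
      rwa [h4, zero_mul] at this
    refine h5.mono_left ?_
    rw [← nhdsWithin_Ioc_eq_nhdsGT hs₀s]
    exact nhdsWithin_mono _ fun y hy => ⟨(hmem y hy).1.le, hy.2⟩
  have hfin : E s * Real.exp (-(m * s)) ≤ 0 := by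
    refine ge_of_tendsto hlim ?_
    filter_upwards [Ioc_mem_nhdsGT hs₀s] with y hy
    rw [hE'eq y (hmem y hy).1]
    exact hlow y hy
  exact absurd hfin (not_le.2 (mul_pos hpos (Real.exp_pos _)))

end UniqueContinuation

end

/-! ### The converse for the scalar system: vanishing defects force ℓ = h'(r). -/

section

namespace IsFloerScalars

variable {ρ h : ℝ → ℝ} {μ δ ε s t r σ ℓ C : ℝ} {N a b Q S : ℝ × ℝ → ℝ}

/-- On the boundary a = 0 and ∂_s a = ℓ² > 0; uniform continuity of ∂_s a on a compact strip makes
the positivity uniform in t. -/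
theorem exists_a_pos (hS : IsFloerScalars ρ h N a b Q S) (hρ : IsCylindricalProfile ρ)
    (hℓ : 0 < ℓ) (hQ : ∀ t, Q (0, t) = ℓ ^ 2) :
    ∃ s₁ > 0, ∀ s t, 0 < s → s ≤ s₁ → 0 < a (s, t) := by
  have hc : ContinuousOn (fun z => fderivWithin ℝ a halfStrip z (1, 0)) halfStrip :=
    (hS.smooth_a.continuousOn_fderivWithin uniqueDiffOn_halfStrip (by simp)).clm_apply
      continuousOn_const
  have hK : IsCompact (Icc (0 : ℝ) 1 ×ˢ Icc (0 : ℝ) 1) := isCompact_Icc.prod isCompact_Icc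
  have hu := hK.uniformContinuousOn_of_continuous
    (hc.mono (prod_mono Icc_subset_Ici_self (subset_univ _)))
  obtain ⟨d, hd, h1⟩ := Metric.uniformContinuousOn_iff.1 hu (ℓ ^ 2) (by positivity)
  have h2 : ∀ s t, 0 ≤ s → s ≤ 1 → s < d → 0 < fderivWithin ℝ a halfStrip (s, t) (1, 0) := by
    intro s t hs hs1 hsd
    have hp : Function.Periodic (fun t => fderivWithin ℝ a halfStrip (s, t) (1, 0)) 1 := fun t => by
      simp only [fderivWithin_halfStrip_periodic hS.periodic_a hs]
    obtain ⟨t', ht', h3⟩ := hp.exists_mem_Ico₀ one_pos t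
    have h4 := h1 (s, t') ⟨⟨hs, hs1⟩, ht'.1, ht'.2.le⟩ (0, t')
      ⟨⟨le_rfl, zero_le_one⟩, ht'.1, ht'.2.le⟩ (by
        rw [Prod.dist_eq, dist_self, Real.dist_eq, sub_zero, abs_of_nonneg hs]
        exact max_lt hsd hd)
    rw [hS.fderivWithin_a_zero hρ, hQ, Real.dist_eq] at h4
    have h5 := (abs_lt.1 h4).1
    calc 0 < fderivWithin ℝ a halfStrip (s, t') (1, 0) := by linarith
      _ = _ := h3.symm
  refine ⟨min 1 (d / 2), by positivity, fun s t hs hs1 => ?_⟩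
  have h3 : StrictMonoOn (fun s => a (s, t)) (Icc 0 s) := by
    refine strictMonoOn_of_deriv_pos (convex_Icc 0 s) ?_ fun y hy => ?_
    · exact fun y hy => ((hasDerivWithinAt_fst hS.smooth_a hy.1).continuousWithinAt).mono
        Icc_subset_Ici_self
    · rw [interior_Icc] at hy
      rw [(hasDerivAt_fst hS.smooth_a hy.1).deriv]
      exact h2 y t hy.1.le (hy.2.le.trans (hs1.trans (min_le_left _ _)))
        (by linarith [hy.2, hs1.trans (min_le_right _ _)])
  have h4 := h3 ⟨le_rfl, hs.le⟩ ⟨hs.le, le_rfl⟩ hs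
  simpa [hS.a_zero] using h4

theorem N_pos_of_a_pos (hS : IsFloerScalars ρ h N a b Q S) {z : ℝ × ℝ} (ha : 0 < a z) :
    0 < N z := by
  refine lt_of_le_of_ne (hS.N_nonneg z) fun h0 => ?_
  have h1 := hS.a_sq_le z
  rw [← h0, zero_mul] at h1
  nlinarith

theorem region_subset : Ioo 0 σ ×ˢ (univ : Set ℝ) ⊆ halfStrip :=
  prod_mono (fun _ hs => hs.1.le) subset_rfl

theorem contDiffOn_sqrt_N (hS : IsFloerScalars ρ h N a b Q S)
    (hNpos : ∀ s ∈ Ioo 0 σ, ∀ t, 0 < N (s, t)) :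
    ContDiffOn ℝ ∞ (fun z => √(N z)) (Ioo 0 σ ×ˢ univ) :=
  (hS.smooth_N.mono region_subset).sqrt fun z hz => (hNpos z.1 hz.1 z.2).ne'

theorem contDiffOn_div_sqrt (hS : IsFloerScalars ρ h N a b Q S)
    (hNpos : ∀ s ∈ Ioo 0 σ, ∀ t, 0 < N (s, t))
    {f : ℝ × ℝ → ℝ} (hf : ContDiffOn ℝ ∞ f halfStrip) :
    ContDiffOn ℝ ∞ (fun z => f z / √(N z)) (Ioo 0 σ ×ˢ univ) :=
  (hf.mono region_subset).div (contDiffOn_sqrt_N hS hNpos) fun z hz =>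
    (Real.sqrt_pos.2 (hNpos z.1 hz.1 z.2)).ne'

theorem hasDerivAt_sqrt_fst (hS : IsFloerScalars ρ h N a b Q S)
    (hNpos : ∀ s ∈ Ioo 0 σ, ∀ t, 0 < N (s, t))
    (hs : s ∈ Ioo 0 σ) (t : ℝ) :
    HasDerivAt (fun s => √(N (s, t))) (ρ √(N (s, t)) * (a (s, t) - deriv h √(N (s, t)) *
      √(N (s, t))) / √(N (s, t))) s := by
  have h0 := hNpos s hs t
  refine ((hS.hasDerivAt_N_fst hs.1).sqrt h0.ne').congr_deriv ?_
  have h1 := Real.sqrt_pos.2 h0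
  have h2 := Real.sq_sqrt h0.le
  have h3 : deriv h √(N (s, t)) / √(N (s, t)) * N (s, t) = deriv h √(N (s, t)) * √(N (s, t)) := by
    nth_rewrite 3 [← h2]
    field_simp
  rw [h3]
  field_simp

theorem hasDerivAt_sqrt_snd (hS : IsFloerScalars ρ h N a b Q S)
    (hNpos : ∀ s ∈ Ioo 0 σ, ∀ t, 0 < N (s, t))
    (hs : s ∈ Ioo 0 σ) (t : ℝ) :
    HasDerivAt (fun t => √(N (s, t))) (-(ρ √(N (s, t)) * b (s, t)) / √(N (s, t))) t := by
  have h0 := hNpos s hs t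
  refine ((hS.hasDerivAt_N_snd hs.1.le).sqrt h0.ne').congr_deriv ?_
  have h1 := Real.sqrt_pos.2 h0
  field_simp

/-- The curl identity divided by |p|; its right-hand side cancels exactly because both defects
vanish. -/
theorem cauchyRiemann_fst (hS : IsFloerScalars ρ h N a b Q S)
    (hNpos : ∀ s ∈ Ioo 0 σ, ∀ t, 0 < N (s, t))
    (hdef : ∀ s ∈ Ioo 0 σ, ∀ t,
      N (s, t) * Q (s, t) = a (s, t) ^ 2 ∧ N (s, t) * S (s, t) = b (s, t) ^ 2)
    (ℓ : ℝ) (hs : s ∈ Ioo 0 σ) (t : ℝ) :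
    fderiv ℝ (fun z => a z / √(N z) - ℓ) (s, t) (1, 0) =
      -fderiv ℝ (fun z => -(b z / √(N z))) (s, t) (0, 1) := by
  have h0 := Real.sqrt_pos.2 (hNpos s hs t)
  have hA := ((contDiffOn_div_sqrt hS hNpos hS.smooth_a).sub
    (contDiffOn_const (c := ℓ))).of_le (m := 1) (by simp)
  have hB := (contDiffOn_div_sqrt hS hNpos hS.smooth_b).neg.of_le (m := 1) (by simp)
  have e1 := (hasDerivAt_strip_fst isOpen_Ioo hA hs t).unique
    (((hasDerivAt_fst hS.smooth_a hs.1).div (hasDerivAt_sqrt_fst hS hNpos hs t) h0.ne').sub_const ℓ)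
  have e2 := (hasDerivAt_strip_snd isOpen_Ioo hB hs t).unique
    (((hasDerivAt_snd hS.smooth_b hs.1.le).div (hasDerivAt_sqrt_snd hS hNpos hs t) h0.ne').neg)
  rw [e1, e2, neg_neg]
  have h1 := hS.curl (s, t) (mem_halfStrip.2 hs.1.le)
  obtain ⟨d1, d2⟩ := hdef s hs t
  have h2 := Real.sq_sqrt (hNpos s hs t).le
  rw [← h2] at d1 d2
  generalize √(N (s, t)) = P at *
  rw [div_eq_div_iff (by positivity) (by positivity)]
  congr 1
  field_simp at h1 ⊢
  linear_combination P * h1 + ρ P * d1 + ρ P * d2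

/-- Equality of the mixed second derivatives of N, each computed from the first-order formulas for
∂_s N and ∂_t N. The derivative of ρ cancels, and h'' is what remains. -/
theorem cauchyRiemann_snd (hS : IsFloerScalars ρ h N a b Q S)
    (hNpos : ∀ s ∈ Ioo 0 σ, ∀ t, 0 < N (s, t))
    (hρ : IsCylindricalProfile ρ) (hh : IsLinearProfile μ δ h)
    (ℓ : ℝ) (hs : s ∈ Ioo 0 σ) (t : ℝ) :
    fderiv ℝ (fun z => -(b z / √(N z))) (s, t) (1, 0) -
      fderiv ℝ (fun z => a z / √(N z) - ℓ) (s, t) (0, 1) =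
      deriv (deriv h) √(N (s, t)) * ρ √(N (s, t)) * (b (s, t) / √(N (s, t))) := by
  have h0 := Real.sqrt_pos.2 (hNpos s hs t)
  have hA := ((contDiffOn_div_sqrt hS hNpos hS.smooth_a).sub
    (contDiffOn_const (c := ℓ))).of_le (m := 1) (by simp)
  have hB := (contDiffOn_div_sqrt hS hNpos hS.smooth_b).neg.of_le (m := 1) (by simp)
  have ha₂ := hasDerivAt_snd hS.smooth_a hs.1.le (t := t)
  have hb₁ := hasDerivAt_fst hS.smooth_b hs.1 (t := t)
  have hP₁ := hasDerivAt_sqrt_fst hS hNpos hs t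
  have hP₂ := hasDerivAt_sqrt_snd hS hNpos hs t
  have e1 := (hasDerivAt_strip_snd isOpen_Ioo hA hs t).unique
    ((ha₂.div hP₂ h0.ne').sub_const ℓ)
  have e2 := (hasDerivAt_strip_fst isOpen_Ioo hB hs t).unique ((hb₁.div hP₁ h0.ne').neg)
  have hN2 : ContDiffOn ℝ 2 N (Ioo 0 σ ×ˢ univ) :=
    (hS.smooth_N.mono region_subset).of_le (by exact_mod_cast ENat.LEInfty.out)
  have hN1 : ContDiffOn ℝ 1 N (Ioo 0 σ ×ˢ univ) := hN2.of_le (by norm_num)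
  have hsymm := fderiv_fderiv_comm isOpen_Ioo hN2 hs t (0, 1) (1, 0)
  have hρd : HasDerivAt ρ (deriv ρ √(N (s, t))) √(N (s, t)) :=
    ((hρ.smooth.contDiffAt (Ici_mem_nhds h0)).differentiableAt (by simp)).hasDerivAt
  have hhd : HasDerivAt (deriv h) (deriv (deriv h) √(N (s, t))) √(N (s, t)) :=
    ((hh.contDiffAt_deriv h0).differentiableAt (by simp)).hasDerivAt
  have f1 : HasDerivAt (fun s => fderiv ℝ N (s, t) (0, 1)) _ s :=
    (((hρd.comp s hP₁).const_mul 2).mul hb₁).neg.congr_of_eventuallyEq (by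
      filter_upwards [isOpen_Ioo.mem_nhds hs] with y hy
      exact (hasDerivAt_strip_snd isOpen_Ioo hN1 hy t).unique (hS.hasDerivAt_N_snd hy.1.le))
  have f2 : HasDerivAt (fun t => fderiv ℝ N (s, t) (1, 0)) _ t :=
    (((hρd.comp t hP₂).const_mul 2).mul
      (ha₂.sub ((hhd.comp t hP₂).mul hP₂))).congr_of_eventuallyEq (by
      refine Eventually.of_forall fun y => ?_
      have h1 := (hasDerivAt_strip_fst isOpen_Ioo hN1 hs y).unique (hS.hasDerivAt_N_fst hs.1)
      refine h1.trans ?_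
      have h2 := Real.sq_sqrt (hNpos s hs y).le
      have h4 := Real.sqrt_pos.2 (hNpos s hs y)
      have h3 : deriv h √(N (s, y)) / √(N (s, y)) * N (s, y) =
          deriv h √(N (s, y)) * √(N (s, y)) := by
        nth_rewrite 3 [← h2]
        field_simp
      rw [h3]
      rfl)
  rw [(hasDerivAt_strip_fst isOpen_Ioo (contDiffOn_fderiv_strip isOpen_Ioo hN2 _) hs t).unique f1,
    (hasDerivAt_strip_snd isOpen_Ioo (contDiffOn_fderiv_strip isOpen_Ioo hN2 _) hs t).unique f2]
    at hsymm
  rw [e1, e2]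
  have hρ0 := hρ.pos _ h0.le
  simp only [Function.comp_apply, Pi.sub_apply, Pi.mul_apply] at hsymm
  generalize √(N (s, t)) = P at *
  generalize deriv ρ P = ρ₁ at *
  generalize deriv (deriv h) P = k₁ at *
  generalize deriv h P = k₀ at *
  generalize ρ P = ρ₀ at *
  generalize fderivWithin ℝ a halfStrip (s, t) (0, 1) = a₂ at *
  generalize fderivWithin ℝ b halfStrip (s, t) (1, 0) = b₁ at *
  generalize a (s, t) = a₀ at *
  generalize b (s, t) = b₀ at *
  have g1 : b₁ + a₂ = -((k₁ * P + k₀) * (ρ₀ * b₀) / P) := by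
    have g2 : ρ₀ * P * (b₁ + a₂) = ρ₀ * P * -((k₁ * P + k₀) * (ρ₀ * b₀) / P) := by
      field_simp at hsymm ⊢
      linear_combination -hsymm
    exact mul_left_cancel₀ (by positivity) g2
  have g3 : a₂ = -((k₁ * P + k₀) * (ρ₀ * b₀) / P) - b₁ := by linarith
  rw [g3]
  field_simp
  ring

theorem abs_cauchyRiemann_snd_le (hS : IsFloerScalars ρ h N a b Q S)
    (hNpos : ∀ s ∈ Ioo 0 σ, ∀ t, 0 < N (s, t)) (hρ : IsCylindricalProfile ρ)
    (hh : IsLinearProfile μ δ h) (hC : ∀ r, 0 < r → deriv (deriv h) r * ρ r ≤ C)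
    (ℓ : ℝ) (hs : s ∈ Ioo 0 σ) (t : ℝ) :
    |fderiv ℝ (fun z => -(b z / √(N z))) (s, t) (1, 0) -
      fderiv ℝ (fun z => a z / √(N z) - ℓ) (s, t) (0, 1)| ≤ C * |-(b (s, t) / √(N (s, t)))| := by
  have h0 := Real.sqrt_pos.2 (hNpos s hs t)
  rw [cauchyRiemann_snd hS hNpos hρ hh ℓ hs t, abs_mul, abs_neg,
    abs_of_nonneg (mul_nonneg (hh.deriv_deriv_nonneg h0) (hρ.pos _ h0.le).le)]
  exact mul_le_mul_of_nonneg_right (hC _ h0) (abs_nonneg _)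

/-- The quotients are undefined at s = 0. For small s > 0, positivity of a and the vanishing defects
turn the integrand into (√Q - ℓ)² + S, which is continuous up to the boundary and zero there. -/
theorem tendsto_energy (hS : IsFloerScalars ρ h N a b Q S) (hρ : IsCylindricalProfile ρ)
    (hℓ : 0 < ℓ) (hQ : ∀ t, Q (0, t) = ℓ ^ 2) (hdef : ∀ s t, 0 < s → 0 < N (s, t) →
      N (s, t) * Q (s, t) = a (s, t) ^ 2 ∧ N (s, t) * S (s, t) = b (s, t) ^ 2) :
    Tendsto (fun s => ∫ t in (0 : ℝ)..1, ((a (s, t) / √(N (s, t)) - ℓ) ^ 2 +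
      (-(b (s, t) / √(N (s, t)))) ^ 2)) (𝓝[>] 0) (𝓝 0) := by
  obtain ⟨s₁, hs₁, hpos⟩ := hS.exists_a_pos hρ hℓ hQ
  have h1 : ContinuousOn (fun z => (√(Q z) - ℓ) ^ 2 + S z) halfStrip :=
    (((Real.continuous_sqrt.comp_continuousOn hS.cont_Q).sub continuousOn_const).pow 2).add hS.cont_S
  have h2 := (continuousOn_integral_slice h1 0 (mem_Ici.2 le_rfl)).tendsto
  simp only [hQ, hS.S_zero, Real.sqrt_sq hℓ.le, sub_self, ne_eq, OfNat.ofNat_ne_zero,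
    not_false_eq_true, zero_pow, add_zero, intervalIntegral.integral_zero] at h2
  refine (h2.mono_left (nhdsWithin_mono _ Ioi_subset_Ici_self)).congr' ?_
  have h3 : ∀ᶠ s : ℝ in 𝓝[>] 0, s < s₁ := nhdsWithin_le_nhds (Iio_mem_nhds hs₁)
  filter_upwards [self_mem_nhdsWithin, h3] with s hs hss
  refine intervalIntegral.integral_congr fun t _ => ?_
  have ha := hpos s t hs hss.le
  have hN := hS.N_pos_of_a_pos ha
  obtain ⟨d1, d2⟩ := hdef s t hs hN
  have h4 : √(Q (s, t)) = a (s, t) / √(N (s, t)) := by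
    rw [eq_div_iff (Real.sqrt_pos.2 hN).ne', ← Real.sqrt_mul (hS.Q_nonneg _), mul_comm, d1,
      Real.sqrt_sq ha.le]
  have h5 : S (s, t) = (-(b (s, t) / √(N (s, t)))) ^ 2 := by
    rw [neg_sq, div_pow, Real.sq_sqrt hN.le, eq_div_iff hN.ne', mul_comm, d2]
  simp only [h4, h5]

/-- Unique continuation for A = a/√N - ℓ and B = -b/√N, valid as long as N has no zero. -/
theorem region_rigidity (hS : IsFloerScalars ρ h N a b Q S)
    (hNpos : ∀ s ∈ Ioo 0 σ, ∀ t, 0 < N (s, t)) (hρ : IsCylindricalProfile ρ)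
    (hh : IsLinearProfile μ δ h) (hℓ : 0 < ℓ) (hQ : ∀ t, Q (0, t) = ℓ ^ 2)
    (hdef : ∀ s t, 0 < s → 0 < N (s, t) →
      N (s, t) * Q (s, t) = a (s, t) ^ 2 ∧ N (s, t) * S (s, t) = b (s, t) ^ 2)
    (hs : s ∈ Ioo 0 σ) (t : ℝ) : a (s, t) = ℓ * √(N (s, t)) ∧ b (s, t) = 0 := by
  obtain ⟨C, hC0, hC⟩ := hh.exists_bound hρ
  have hdef' : ∀ s ∈ Ioo 0 σ, ∀ t,
      N (s, t) * Q (s, t) = a (s, t) ^ 2 ∧ N (s, t) * S (s, t) = b (s, t) ^ 2 :=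
    fun s hs t => hdef s t hs.1 (hNpos s hs t)
  have h2 : (2 : WithTop ℕ∞) ≤ ∞ := by exact_mod_cast ENat.LEInfty.out
  have h1 := cauchyRiemann_unique_continuation
    (((contDiffOn_div_sqrt hS hNpos hS.smooth_a).sub (contDiffOn_const (c := ℓ))).of_le h2)
    ((contDiffOn_div_sqrt hS hNpos hS.smooth_b).neg.of_le h2)
    (fun s t hs => by simp only [hS.periodic_N s t hs.1.le, hS.periodic_a s t hs.1.le])
    (fun s t hs => by simp only [hS.periodic_N s t hs.1.le, hS.periodic_b s t hs.1.le])
    (fun s hs t => cauchyRiemann_fst hS hNpos hdef' ℓ hs t) hC0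
    (fun s hs t => abs_cauchyRiemann_snd_le hS hNpos hρ hh hC ℓ hs t)
    (hS.tendsto_energy hρ hℓ hQ hdef) hs t
  have h0 := Real.sqrt_pos.2 (hNpos s hs t)
  constructor
  · have h3 := sub_eq_zero.1 h1.1
    rwa [div_eq_iff h0.ne'] at h3
  · have h3 := neg_eq_zero.1 h1.2
    exact (div_eq_zero_iff.1 h3).resolve_right h0.ne'

/-- Before a first zero one has a = ℓ√N. Just before it N < 1, so h' = 0 and ∂_s N = 2ρℓ√N ≥ 0: N
cannot decrease to zero. -/
theorem N_pos_of_defect (hS : IsFloerScalars ρ h N a b Q S) (hρ : IsCylindricalProfile ρ)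
    (hh : IsLinearProfile μ δ h) (hℓ : 0 < ℓ) (hQ : ∀ t, Q (0, t) = ℓ ^ 2)
    (hdef : ∀ s t, 0 < s → 0 < N (s, t) →
      N (s, t) * Q (s, t) = a (s, t) ^ 2 ∧ N (s, t) * S (s, t) = b (s, t) ^ 2)
    (hs : 0 < s) (t : ℝ) : 0 < N (s, t) := by
  obtain ⟨s₁, hs₁, hpos⟩ := hS.exists_a_pos hρ hℓ hQ
  refine lt_of_le_of_ne (hS.N_nonneg _) fun hzero => ?_
  have hs₁s : s₁ < s := by
    by_contra! h1
    exact (hS.N_pos_of_a_pos (hpos s t hs h1)).ne hzero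
  have hNc : ContinuousOn N (Icc s₁ s ×ˢ Icc 0 1) :=
    hS.smooth_N.continuousOn.mono (prod_mono (fun y hy => hs₁.le.trans hy.1) (subset_univ _))
  have hK : IsCompact ((Icc s₁ s ×ˢ Icc 0 1) ∩ N ⁻¹' {0}) :=
    (isCompact_Icc.prod isCompact_Icc).of_isClosed_subset
      (hNc.preimage_isClosed_of_isClosed (isClosed_Icc.prod isClosed_Icc) isClosed_singleton)
      inter_subset_left
  have hper : ∀ y, 0 ≤ y → ∀ t, ∃ t' ∈ Icc (0 : ℝ) 1, N (y, t) = N (y, t') := by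
    intro y hy t
    have hp : Function.Periodic (fun t => N (y, t)) 1 := fun t => hS.periodic_N y t hy
    obtain ⟨t', ht', h2⟩ := hp.exists_mem_Ico₀ one_pos t
    exact ⟨t', ⟨ht'.1, ht'.2.le⟩, h2⟩
  obtain ⟨t', ht', h2⟩ := hper s hs.le t
  -- A first zero over all t exists by compactness, after reducing t to [0, 1]; times up to s₁ are
  -- excluded by positivity of a.
  obtain ⟨s₀, ⟨z, hz, rfl⟩, hleast⟩ := (hK.image continuous_fst).exists_isLeast
    ⟨s, (s, t'), ⟨⟨⟨hs₁s.le, le_rfl⟩, ht'⟩, (hzero.trans h2).symm⟩, rfl⟩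
  have hz0 : 0 < z.1 := hs₁.trans_le hz.1.1.1
  have hNz : N (z.1, z.2) = 0 := hz.2
  have hNpos : ∀ y ∈ Ioo 0 z.1, ∀ t, 0 < N (y, t) := by
    intro y hy t
    rcases le_total y s₁ with h3 | h3
    · exact hS.N_pos_of_a_pos (hpos y t hy.1 h3)
    · refine lt_of_le_of_ne (hS.N_nonneg _) fun h4 => ?_
      obtain ⟨t'', ht'', h5⟩ := hper y hy.1.le t
      exact absurd (hleast ⟨(y, t''), ⟨⟨⟨h3, hy.2.le.trans hz.1.1.2⟩, ht''⟩,
        (h4.trans h5).symm⟩, rfl⟩) (not_le.2 hy.2)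
  have hc : ContinuousAt (fun y => N (y, z.2)) z.1 := (hS.hasDerivAt_N_fst hz0).continuousAt
  have h3 : ∀ᶠ y in 𝓝 z.1, N (y, z.2) < 1 := hc.eventually_lt_const (by simp [hNz])
  obtain ⟨d, hd, h4⟩ := Metric.nhds_basis_closedBall.mem_iff.1 h3
  set y₀ := max (z.1 - d) (z.1 / 2) with hy₀
  have hy₀pos : 0 < y₀ := lt_of_lt_of_le (by positivity) (le_max_right _ _)
  have hy₀lt : y₀ < z.1 := max_lt (by linarith) (by linarith)
  have hmono : MonotoneOn (fun y => N (y, z.2)) (Icc y₀ z.1) := by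
    refine monotoneOn_of_deriv_nonneg (convex_Icc _ _)
      (fun y hy => (hS.hasDerivAt_N_fst (hy₀pos.trans_le hy.1)).continuousAt.continuousWithinAt)
      (fun y hy => (hS.hasDerivAt_N_fst (hy₀pos.trans_le
        (interior_subset hy).1)).differentiableAt.differentiableWithinAt) fun y hy => ?_
    rw [interior_Icc] at hy
    have hy0 : 0 < y := hy₀pos.trans hy.1
    have h5 : N (y, z.2) < 1 := h4 (by
      rw [Real.closedBall_eq_Icc]
      exact ⟨by linarith [hy.1, le_max_left (z.1 - d) (z.1 / 2)], by linarith [hy.2]⟩)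
    have h6 := (region_rigidity hS hNpos hρ hh hℓ hQ hdef ⟨hy0, hy.2⟩ z.2).1
    rw [(hS.hasDerivAt_N_fst hy0).deriv, h6,
      hh.deriv_eq_zero (Real.sqrt_nonneg _) (Real.sqrt_le_one.2 h5.le)]
    have h7 := hρ.pos _ (Real.sqrt_nonneg (N (y, z.2)))
    have h8 := Real.sqrt_nonneg (N (y, z.2))
    rw [zero_div, zero_mul, sub_zero]
    positivity
  have h5 := hmono ⟨le_rfl, hy₀lt.le⟩ ⟨hy₀lt.le, le_rfl⟩ hy₀lt.le
  simp only [hNz] at h5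
  exact absurd h5 (not_le.2 (hNpos y₀ ⟨hy₀pos, hy₀lt⟩ z.2))

/-- Now a/√N = ℓ everywhere. Since r > 1, for large s the regularization with ε = 1 is inactive, so
`contactReg` equals ℓ there while coming arbitrarily close to h'(r). -/
theorem deriv_eq_of_defect (hS : IsFloerScalars ρ h N a b Q S) (hρ : IsCylindricalProfile ρ)
    (hh : IsLinearProfile μ δ h) (hN : TendsToRadius N r) (hr : 1 < r) (hℓ : 0 < ℓ)
    (hQ : ∀ t, Q (0, t) = ℓ ^ 2) (hdef : ∀ s t, 0 < s → 0 < N (s, t) →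
      N (s, t) * Q (s, t) = a (s, t) ^ 2 ∧ N (s, t) * S (s, t) = b (s, t) ^ 2) :
    ℓ = deriv h r := by
  have hNpos : ∀ s t, 0 < s → 0 < N (s, t) := fun s t hs =>
    hS.N_pos_of_defect hρ hh hℓ hQ hdef hs t
  have ha : ∀ s t, 0 < s → a (s, t) = ℓ * √(N (s, t)) := fun s t hs =>
    (region_rigidity (σ := s + 1) hS (fun y hy t => hNpos y t hy.1) hρ hh hℓ hQ hdef
      ⟨hs, by linarith⟩ t).1
  obtain ⟨T, hT⟩ := hN (r - 1) (by linarith)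
  refine eq_of_abs_sub_le_all fun η hη => ?_
  obtain ⟨T₀, h1⟩ := hS.exists_contactReg_near hρ hh hN (by linarith) one_pos le_rfl hη
  obtain ⟨s, hs, h2⟩ := h1 (max T₀ (max T 0)) (le_max_left _ _)
  have hs0 : 0 < s := ((le_max_right _ _).trans (le_max_right _ _)).trans_lt hs
  have hsT : T ≤ s := (((le_max_left _ _).trans (le_max_right _ _)).trans_lt hs).le
  have h3 : contactReg N a 1 s = ℓ := by
    have h4 : ∀ t, invSqrtReg 1 (N (s, t)) * a (s, t) = ℓ := by
      intro t
      have h5 := (abs_lt.1 (hT s hsT t)).1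
      have h6 : 1 < √(N (s, t)) := by linarith
      have h7 : 1 ≤ N (s, t) := by
        rw [← Real.sq_sqrt (hS.N_nonneg (s, t))]
        nlinarith
      rw [invSqrtReg_of_le one_pos (by simpa using h7), ha s t hs0]
      field_simp
    simp [contactReg, h4]
  rwa [h3] at h2

end IsFloerScalars

end

/-! ### The limit orbit: its radius, contact integral and action. -/

section

section Curves

variable {E H X : Type*} [NormedAddCommGroup E] [NormedSpace ℝ E] [TopologicalSpace H]
  {I : ModelWithCorners ℝ E H} [TopologicalSpace X] [ChartedSpace H X] [IsManifold I 1 X]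

/-- A curve in a manifold whose derivative vanishes identically is constant. -/
theorem eq_of_hasMFDerivAt_zero {c : ℝ → X} (hc : ∀ t, HasMFDerivAt 𝓘(ℝ, ℝ) I c t 0) (t t' : ℝ) :
    c t = c t' := by
  refine IsLocallyConstant.apply_eq_of_preconnectedSpace
    ((IsLocallyConstant.iff_eventually_eq c).2 fun t => ?_) t t'
  have h1 : ∀ᶠ t' in 𝓝 t, c t' ∈ (chartAt H (c t)).source :=
    (hc t).continuousAt.eventually (chart_source_mem_nhds H (c t))
  obtain ⟨ε, hε, h2⟩ := Metric.eventually_nhds_iff_ball.1 h1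
  have h3 : ∀ y ∈ Metric.ball t ε, HasFDerivAt (fun y => extChartAt I (c t) (c y)) (0 : ℝ →L[ℝ] E) y := by
    intro y hy
    have h4 := (mdifferentiableAt_extChartAt (I := I) (h2 y hy)).hasMFDerivAt.comp y (hc y)
    rw [ContinuousLinearMap.comp_zero] at h4
    exact h4.hasFDerivAt
  filter_upwards [Metric.ball_mem_nhds t hε] with y hy
  have h5 := Metric.isOpen_ball.is_const_of_fderiv_eq_zero (𝕜 := ℝ)
    (convex_ball t ε).isPreconnected
    (fun y hy => (h3 y hy).differentiableAt.differentiableWithinAt)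
    (fun y hy => (h3 y hy).fderiv) hy (Metric.mem_ball_self hε)
  refine (extChartAt I (c t)).injOn ?_ (mem_extChartAt_source (c t)) h5
  rw [extChartAt_source]
  exact h2 y hy

end Curves

open Bundle


variable {n : ℕ} {M : Type*} [TopologicalSpace M] [ChartedSpace (Model n) M]
  [IsManifold (𝓡 n) ∞ M]
  [RiemannianBundle (fun q : M => TangentSpace (𝓡 n) q)]


theorem tangent_eq_zero {z : Cotangent n M} {V : TangentSpace (cotModel n) z} (hq : qPart V = 0)
    (hc : connector V = 0) : V = 0 := by
  have h1 : christoffelCovector z (0 : TangentSpace (𝓡 n) z.1) = 0 := by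
    have h2 := christoffelFirst_smul (chartMetric z.1) (extChartAt (𝓡 n) z.1 z.1) (sharp z.2) 0 0
    rw [smul_zero, zero_smul] at h2
    exact h2
  have h3 : pPart V = 0 := by
    rw [connector, hq, h1, sub_zero] at hc
    exact hc
  exact Prod.ext hq h3

theorem liouville_mfderiv {c : ℝ → Cotangent n M} {t : ℝ}
    (hc : MDifferentiableAt 𝓘(ℝ, ℝ) (cotModel n) c t) :
    liouville (c t) (mfderiv 𝓘(ℝ, ℝ) (cotModel n) c t (1 : ℝ)) =
      (c t).2 (qPart (mfderiv 𝓘(ℝ, ℝ) (cotModel n) c t (1 : ℝ))) := by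
  have h1 : MDifferentiableAt (cotModel n) (𝓡 n) (fun w : Cotangent n M => w.1) (c t) :=
    (contMDiff_proj (n := (1 : WithTop ℕ∞)) (IB := 𝓡 n) (F := DualModel n)
      (fun q : M => TangentSpace (𝓡 n) q →L[ℝ] Bundle.Trivial M ℝ q)).mdifferentiableAt (by simp)
  have h2 := mfderiv_comp t h1 hc
  have h3 := qPart_mfderivWithin (mdifferentiableWithinAt_univ.2 hc) uniqueDiffWithinAt_univ (1 : ℝ)
  simp only [mfderivWithin_univ] at h3
  have h4 : mfderiv (cotModel n) (𝓡 n) (fun w : Cotangent n M => w.1) (c t)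
      (mfderiv 𝓘(ℝ, ℝ) (cotModel n) c t (1 : ℝ)) = qPart (mfderiv 𝓘(ℝ, ℝ) (cotModel n) c t (1 : ℝ)) :=
    (DFunLike.congr_fun h2 (1 : ℝ)).symm.trans h3.symm
  exact congrArg (c t).2 h4

variable [IsContMDiffRiemannianBundle (𝓡 n) ∞ (Model n) (fun q : M => TangentSpace (𝓡 n) q)]
variable {ρ h : ℝ → ℝ} {μ δ : ℝ} {x : ℝ → Cotangent n M} {u : ℝ × ℝ → Cotangent n M}

theorem hasDerivAt_normSq_comp {c : ℝ → Cotangent n M} {t : ℝ}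
    (hc : MDifferentiableAt 𝓘(ℝ, ℝ) (cotModel n) c t) :
    HasDerivAt (fun t => ‖(c t).2‖ ^ 2)
      (2 * connector (mfderiv 𝓘(ℝ, ℝ) (cotModel n) c t (1 : ℝ)) (sharp (c t).2)) t := by
  have h1 : HasFDerivAt (fun t => ‖(c t).2‖ ^ 2)
      ((normSqDeriv (c t)).comp (show ℝ →L[ℝ] Model n × DualModel n from
        mfderiv 𝓘(ℝ, ℝ) (cotModel n) c t)) t :=
    ((hasMFDerivAt_normSq (c t)).comp t hc.hasMFDerivAt).hasFDerivAt
  exact (normSqDeriv_apply (c t) (mfderiv 𝓘(ℝ, ℝ) (cotModel n) c t (1 : ℝ))) ▸ h1.hasDerivAt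

/-- The norm of the momentum is constant along a curve of covectors that is parallel in the
direction of its momentum. -/
theorem norm_eq_of_connector_eq_zero {c : ℝ → Cotangent n M}
    (hc : ∀ t, MDifferentiableAt 𝓘(ℝ, ℝ) (cotModel n) c t)
    (h0 : ∀ t, connector (mfderiv 𝓘(ℝ, ℝ) (cotModel n) c t (1 : ℝ)) = 0) (t t' : ℝ) :
    ‖(c t).2‖ = ‖(c t').2‖ := by
  have h1 : ∀ t, HasDerivAt (fun t => ‖(c t).2‖ ^ 2) 0 t := by
    intro t
    have h2 := hasDerivAt_normSq_comp (hc t)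
    have h3 : connector (mfderiv 𝓘(ℝ, ℝ) (cotModel n) c t (1 : ℝ)) (sharp (c t).2) = 0 :=
      DFunLike.congr_fun (h0 t) _
    rwa [h3, mul_zero] at h2
  have h4 := is_const_of_deriv_eq_zero (fun t => (h1 t).differentiableAt) (fun t => (h1 t).deriv) t t'
  exact (pow_left_inj₀ (norm_nonneg (c t).2) (norm_nonneg (c t').2) two_ne_zero).1 h4

theorem IsNonconstantOrbit.mfderiv_eq {H : Cotangent n M → ℝ} (hx : IsNonconstantOrbit H x) (t : ℝ) :
    mfderiv 𝓘(ℝ, ℝ) (cotModel n) x t (1 : ℝ) = hamiltonianVectorField H (x t) := by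
  rw [(hx.integral t).mfderiv]
  exact one_smul ℝ (hamiltonianVectorField H (x t))

theorem IsNonconstantOrbit.norm_eq (hh : IsLinearProfile μ δ h)
    (hx : IsNonconstantOrbit (radialHamiltonian h) x) (t : ℝ) : ‖(x t).2‖ = ‖(x 0).2‖ :=
  norm_eq_of_connector_eq_zero (fun t => (hx.integral t).mdifferentiableAt)
    (fun t => by rw [hx.mfderiv_eq, connector_hamiltonianVectorField hh]) t 0

/-- Otherwise X_H would vanish along the orbit, whose momentum has constant norm, and the orbit
would be constant. It follows that the radius exceeds 1. -/
theorem IsNonconstantOrbit.deriv_ne_zero (hh : IsLinearProfile μ δ h)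
    (hx : IsNonconstantOrbit (radialHamiltonian h) x) : deriv h ‖(x 0).2‖ ≠ 0 := by
  intro h0
  obtain ⟨t, t', hne⟩ := hx.nonconstant
  refine hne (eq_of_hasMFDerivAt_zero (I := cotModel n) (fun t => ?_) t t')
  have h1 := hx.integral t
  have h2 : hamiltonianVectorField (radialHamiltonian h) (x t) = 0 := by
    refine tangent_eq_zero ?_ (connector_hamiltonianVectorField hh _)
    rw [qPart_hamiltonianVectorField hh, hx.norm_eq hh, h0, zero_div, zero_smul]
  have h3 : ((1 : ℝ →L[ℝ] ℝ).smulRight (hamiltonianVectorField (radialHamiltonian h) (x t))) = 0 := by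
    rw [h2]
    exact ContinuousLinearMap.ext fun a => smul_zero a
  rw [h3] at h1
  exact h1

theorem IsNonconstantOrbit.one_lt_norm (hh : IsLinearProfile μ δ h)
    (hx : IsNonconstantOrbit (radialHamiltonian h) x) : 1 < ‖(x 0).2‖ := by
  by_contra hle
  exact hx.deriv_ne_zero hh (hh.deriv_eq_zero (norm_nonneg (x 0).2) (not_lt.1 hle))

theorem IsNonconstantOrbit.deriv_pos (hh : IsLinearProfile μ δ h)
    (hx : IsNonconstantOrbit (radialHamiltonian h) x) : 0 < deriv h ‖(x 0).2‖ :=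
  (hh.deriv_nonneg (norm_nonneg (x 0).2)).lt_of_ne' (hx.deriv_ne_zero hh)

theorem IsNonconstantOrbit.liouville_eq (hh : IsLinearProfile μ δ h)
    (hx : IsNonconstantOrbit (radialHamiltonian h) x) (t : ℝ) :
    liouville (x t) (mfderiv 𝓘(ℝ, ℝ) (cotModel n) x t (1 : ℝ)) =
      ‖(x 0).2‖ * deriv h ‖(x 0).2‖ := by
  have hr : ‖(x 0).2‖ ≠ 0 := (zero_lt_one.trans (hx.one_lt_norm hh)).ne'
  have h1 : (x t).2 (sharp (x t).2) = ‖(x t).2‖ ^ 2 := by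
    have h2 := inner_sharp (x t).2 (sharp (x t).2)
    rw [real_inner_self_eq_norm_sq] at h2
    exact h2.symm.trans (congrArg (· ^ 2) (norm_sharp (x t).2))
  have h3 : (x t).2 ((deriv h ‖(x t).2‖ / ‖(x t).2‖) • sharp (x t).2) =
      (deriv h ‖(x t).2‖ / ‖(x t).2‖) * (x t).2 (sharp (x t).2) := map_smul (x t).2 _ _
  rw [liouville_mfderiv (hx.integral t).mdifferentiableAt, hx.mfderiv_eq,
    qPart_hamiltonianVectorField hh]
  refine h3.trans ?_
  rw [h1, hx.norm_eq hh]
  field_simp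

theorem IsNonconstantOrbit.contactAction_eq (hh : IsLinearProfile μ δ h)
    (hx : IsNonconstantOrbit (radialHamiltonian h) x) : contactAction x = deriv h ‖(x 0).2‖ := by
  have hr : ‖(x 0).2‖ ≠ 0 := (zero_lt_one.trans (hx.one_lt_norm hh)).ne'
  simp_rw [contactAction, hx.liouville_eq hh, hx.norm_eq hh, mul_div_cancel_left₀ _ hr]
  simp

theorem IsNonconstantOrbit.hamiltonianAction_eq (hh : IsLinearProfile μ δ h)
    (hx : IsNonconstantOrbit (radialHamiltonian h) x) :
    hamiltonianAction (radialHamiltonian h) x =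
      ‖(x 0).2‖ * deriv h ‖(x 0).2‖ - h ‖(x 0).2‖ := by
  simp_rw [hamiltonianAction, hx.liouville_eq hh, radialHamiltonian, hx.norm_eq hh]
  simp

theorem IsNonconstantOrbit.contactAction_le (hh : IsLinearProfile μ δ h)
    (hx : IsNonconstantOrbit (radialHamiltonian h) x) :
    contactAction x ≤ hamiltonianAction (radialHamiltonian h) x := by
  rw [hx.contactAction_eq hh, hx.hamiltonianAction_eq hh]
  linarith [hh.le_sub_one_mul_deriv (hx.one_lt_norm hh)]

/-- The norm of the momentum of a Floer half-cylinder converges uniformly to that of its limit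
orbit. -/
theorem IsFloerHalfCylinder.tendsToRadius (hh : IsLinearProfile μ δ h)
    (hx : IsNonconstantOrbit (radialHamiltonian h) x)
    (hu : IsFloerHalfCylinder ρ (radialHamiltonian h) x u) :
    TendsToRadius (normSqAlong u) ‖(x 0).2‖ := by
  intro η hη
  have hsqrt : ∀ z, √(normSqAlong u z) = ‖(u z).2‖ := fun z => Real.sqrt_sq (norm_nonneg (u z).2)
  have h1 : ∀ t₀, Tendsto (fun z => √(normSqAlong u z)) (atTop ×ˢ 𝓝 t₀) (𝓝 ‖(x 0).2‖) := by
    intro t₀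
    have h2 := ((contMDiff_normSq (n := n) (M := M)).continuous.tendsto (x t₀)).comp (hu.asymptotic t₀)
    have h3 := (Real.continuous_sqrt.tendsto _).comp h2
    have h4 : √(‖(x t₀).2‖ ^ 2) = ‖(x 0).2‖ :=
      (Real.sqrt_sq (norm_nonneg (x t₀).2)).trans (hx.norm_eq hh t₀)
    rw [h4] at h3
    exact h3
  -- Local uniformity near each t₀ becomes uniformity on [0, 1] by compactness, and on the whole
  -- line by periodicity.
  have h2 := (isCompact_Icc (a := (0 : ℝ)) (b := 1)).mem_prod_nhdsSet_of_forall (l := atTop)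
    (s := {z : ℝ × ℝ | |√(normSqAlong u z) - ‖(x 0).2‖| < η}) fun t₀ _ => by
      have := (h1 t₀).eventually (Metric.ball_mem_nhds _ hη)
      filter_upwards [this] with z hz
      exact hz
  obtain ⟨A, hA, B, hB, hAB⟩ := Filter.mem_prod_iff.1 h2
  obtain ⟨T, hT⟩ := Filter.mem_atTop_sets.1 hA
  refine ⟨max T 0, fun s hs t => ?_⟩
  have h3 : normSqAlong u (s, t) = normSqAlong u (s, Int.fract t) := by
    have h4 : Function.Periodic (fun t => normSqAlong u (s, t)) 1 := fun t => by
      show normSqAlong u (s, t + 1) = normSqAlong u (s, t)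
      rw [normSqAlong, hu.periodic s t ((le_max_right _ _).trans hs)]
      rfl
    have h5 := h4.sub_int_mul_eq ⌊t⌋ (x := t)
    rw [mul_one] at h5
    exact h5.symm
  rw [h3]
  exact hAB (mk_mem_prod (hT s ((le_max_left _ _).trans hs))
    (subset_of_mem_nhdsSet hB ⟨Int.fract_nonneg t, (Int.fract_lt_one t).le⟩))

end

/-! ### Slices of the half-cylinder and the Leibniz rule for rescaled covectors. -/

section

open Bundle

variable {n : ℕ} {M : Type*} [TopologicalSpace M] [ChartedSpace (Model n) M]
  [IsManifold (𝓡 n) ∞ M]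
  [RiemannianBundle (fun q : M => TangentSpace (𝓡 n) q)]


section Slices

variable {u : ℝ × ℝ → Cotangent n M}

theorem contMDiff_slice (hu : ContMDiffOn 𝓘(ℝ, ℝ × ℝ) (cotModel n) ∞ u halfStrip) {s : ℝ}
    (hs : 0 ≤ s) : ContMDiff 𝓘(ℝ, ℝ) (cotModel n) ∞ fun t => u (s, t) := by
  have h1 : ContMDiff 𝓘(ℝ, ℝ) 𝓘(ℝ, ℝ × ℝ) ∞ fun t : ℝ => (s, t) :=
    (contDiff_const.prodMk contDiff_id).contMDiff
  exact contMDiffOn_univ.1 (hu.comp h1.contMDiffOn fun t _ => mem_halfStrip.2 hs)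

theorem mfderiv_slice (hu : ContMDiffOn 𝓘(ℝ, ℝ × ℝ) (cotModel n) ∞ u halfStrip) {s : ℝ}
    (hs : 0 ≤ s) (t : ℝ) :
    mfderiv 𝓘(ℝ, ℝ) (cotModel n) (fun t => u (s, t)) t (1 : ℝ) = dT u (s, t) := by
  have h1 : HasFDerivAt (fun t : ℝ => (s, t)) (ContinuousLinearMap.inr ℝ ℝ ℝ) t :=
    hasFDerivAt_prodMk_right s t
  have h2 := ((hu (s, t) (mem_halfStrip.2 hs)).mdifferentiableWithinAt (by simp)).hasMFDerivWithinAt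
  have h3 := h2.comp (s := univ) t h1.hasMFDerivAt.hasMFDerivWithinAt
    (fun t' _ => mem_halfStrip.2 hs)
  have h4 := (hasMFDerivWithinAt_univ.1 h3).mfderiv
  exact DFunLike.congr_fun h4 (1 : ℝ)

theorem qPart_mfderiv {c : ℝ → Cotangent n M} {t : ℝ}
    (hc : MDifferentiableAt 𝓘(ℝ, ℝ) (cotModel n) c t) :
    qPart (mfderiv 𝓘(ℝ, ℝ) (cotModel n) c t (1 : ℝ)) = velocity (fun t => (c t).1) t := by
  have h3 := qPart_mfderivWithin (mdifferentiableWithinAt_univ.2 hc) uniqueDiffWithinAt_univ (1 : ℝ)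
  simp only [mfderivWithin_univ] at h3
  exact h3

theorem velocity_slice (hu : ContMDiffOn 𝓘(ℝ, ℝ × ℝ) (cotModel n) ∞ u halfStrip) {s : ℝ}
    (hs : 0 ≤ s) (t : ℝ) :
    velocity (fun t => (u (s, t)).1) t = qPart (dT u (s, t)) := by
  rw [← mfderiv_slice hu hs]
  exact (qPart_mfderiv (c := fun t => u (s, t))
    ((contMDiff_slice hu hs).mdifferentiableAt (by simp))).symm

theorem norm_velocity_slice (hu : ContMDiffOn 𝓘(ℝ, ℝ × ℝ) (cotModel n) ∞ u halfStrip) {s : ℝ}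
    (hs : 0 ≤ s) (t : ℝ) :
    ‖velocity (n := n) (fun t => (u (s, t)).1) t‖ = √(speedSqAlong u (0, 1) (s, t)) := by
  rw [velocity_slice hu hs, speedSqAlong, Real.sqrt_sq (norm_nonneg _)]
  rfl

theorem contMDiff_base_slice (hu : ContMDiffOn 𝓘(ℝ, ℝ × ℝ) (cotModel n) ∞ u halfStrip) {s : ℝ}
    (hs : 0 ≤ s) : ContMDiff 𝓘(ℝ, ℝ) (𝓡 n) ∞ fun t => (u (s, t)).1 := fun t =>
  contMDiffWithinAt_base (contMDiff_slice hu hs t)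

/-- If `∂_s q = 0`, then `q(s, ·)` does not depend on `s`. -/
theorem base_slice_eq (hu : ContMDiffOn 𝓘(ℝ, ℝ × ℝ) (cotModel n) ∞ u halfStrip)
    (h0 : ∀ s t, 0 ≤ s → qPart (dS u (s, t)) = 0) {s : ℝ} (hs : 0 ≤ s) (t : ℝ) :
    (u (s, t)).1 = (u (0, t)).1 := by
  -- The substitution s = σ² gives a curve on the whole line that stays in the closed half-strip, so
  -- the boundary needs no separate treatment.
  have h1 : ∀ σ, HasMFDerivAt 𝓘(ℝ, ℝ) (𝓡 n) (fun σ : ℝ => (u (σ ^ 2, t)).1) σ 0 := by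
    intro σ
    have hz : (σ ^ 2, t) ∈ halfStrip := mem_halfStrip.2 (sq_nonneg σ)
    have hd := (hu _ hz).mdifferentiableWithinAt (by simp)
    have h2 : HasFDerivAt (fun σ : ℝ => (σ ^ 2, t))
        ((ContinuousLinearMap.toSpanSingleton ℝ (2 * σ)).prod 0) σ := by
      have h3 : HasDerivAt (fun σ : ℝ => σ ^ 2) (2 * σ) σ := by simpa using hasDerivAt_pow 2 σ
      exact h3.hasFDerivAt.prodMk (hasFDerivAt_const t σ)
    have h4 := ((contMDiffWithinAt_base (hu _ hz)).mdifferentiableWithinAt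
      (by simp)).hasMFDerivWithinAt.comp (s := univ) σ h2.hasMFDerivAt.hasMFDerivWithinAt
      (fun σ' _ => mem_halfStrip.2 (sq_nonneg σ'))
    refine (hasMFDerivWithinAt_univ.1 h4).congr_mfderiv ?_
    refine ContinuousLinearMap.ext fun (a : ℝ) => ?_
    have h5 := (qPart_mfderivWithin hd (uniqueDiffOn_halfStrip _ hz) ((1, 0) : ℝ × ℝ)).symm.trans
      (h0 (σ ^ 2) t (sq_nonneg σ))
    have h6 : ((ContinuousLinearMap.toSpanSingleton ℝ (2 * σ)).prod (0 : ℝ →L[ℝ] ℝ)) a =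
        (a * (2 * σ)) • ((1, 0) : ℝ × ℝ) := by
      simp
    have h7 := ContinuousLinearMap.map_smul (mfderivWithin 𝓘(ℝ, ℝ × ℝ) (𝓡 n) (fun w => (u w).1) halfStrip (σ ^ 2, t))
      (a * (2 * σ)) ((1, 0) : ℝ × ℝ)
    rw [h5, smul_zero] at h7
    exact (congrArg _ h6).trans h7
  have h8 := eq_of_hasMFDerivAt_zero h1 (√s) 0
  simpa [Real.sq_sqrt hs] using h8

end Slices

section Scaling

variable {c : ℝ → Cotangent n M} {κ : ℝ → ℝ} {κ' t : ℝ}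

theorem mdifferentiableAt_smul (hc : MDifferentiableAt 𝓘(ℝ, ℝ) (cotModel n) c t)
    (hκ : DifferentiableAt ℝ κ t) :
    MDifferentiableAt 𝓘(ℝ, ℝ) (cotModel n)
      (fun t => (⟨(c t).1, κ t • (c t).2⟩ : Cotangent n M)) t := by
  obtain ⟨h1, h2⟩ := mdifferentiableWithinAt_cotangent_iff.1 (mdifferentiableWithinAt_univ.2 hc)
  exact mdifferentiableWithinAt_univ.1 (mdifferentiableWithinAt_cotangent_iff.2
    ⟨h1, hκ.differentiableWithinAt.smul h2⟩)

/-- The Leibniz rule `∇_t (κ p) = κ' p + κ ∇_t p`. -/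
theorem connector_mfderiv_smul (hc : MDifferentiableAt 𝓘(ℝ, ℝ) (cotModel n) c t)
    (hκ : HasDerivAt κ κ' t) :
    connector (mfderiv 𝓘(ℝ, ℝ) (cotModel n)
      (fun t => (⟨(c t).1, κ t • (c t).2⟩ : Cotangent n M)) t (1 : ℝ)) =
    κ' • (show TangentSpace (𝓡 n) (c t).1 →L[ℝ] ℝ from (c t).2) +
      κ t • connector (mfderiv 𝓘(ℝ, ℝ) (cotModel n) c t (1 : ℝ)) := by
  have hd := mdifferentiableAt_smul hc hκ.differentiableAt
  have hU : UniqueDiffWithinAt ℝ univ t := uniqueDiffWithinAt_univ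
  have h1 := pPart_mfderivWithin (mdifferentiableWithinAt_univ.2 hd) hU (1 : ℝ)
  have h2 := pPart_mfderivWithin (mdifferentiableWithinAt_univ.2 hc) hU (1 : ℝ)
  have h3 := qPart_mfderiv hd
  have h4 := qPart_mfderiv hc
  simp only [mfderivWithin_univ, fderivWithin_univ] at h1 h2
  have h5 := (mdifferentiableWithinAt_cotangent_iff.1 (mdifferentiableWithinAt_univ.2 hc)).2
  rw [differentiableWithinAt_univ] at h5
  have h6 : fderiv ℝ (fun t' => κ t' • fibreCoord (c t).1 (c t')) t 1 =
      κ' • fibreCoord (c t).1 (c t) + κ t • fderiv ℝ (fun t' => fibreCoord (c t).1 (c t')) t 1 := by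
    have h7 := (hκ.smul h5.hasFDerivAt.hasDerivAt).hasFDerivAt.fderiv
    have h8 := DFunLike.congr_fun h7 (1 : ℝ)
    refine h8.trans ?_
    simp [add_comm]
  rw [fibreCoord_self] at h6
  have h9 : christoffelCovector (⟨(c t).1, κ t • (c t).2⟩ : Cotangent n M)
      (velocity (fun t => (c t).1) t) =
      κ t • christoffelCovector (c t) (velocity (fun t => (c t).1) t) := by
    rw [christoffelCovector, sharp_smul]
    exact christoffelFirst_smul_left _ _ _ _ _
  rw [connector, connector, h1, h2, h3, h4]
  have h10 : ∀ P X Y : DualModel n, κ' • P + κ t • X - κ t • Y = κ' • P + κ t • (X - Y) :=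
    fun P X Y => (add_sub_assoc _ _ _).trans (congrArg (κ' • P + ·) (smul_sub _ _ _).symm)
  exact (congrArg₂ (fun A B : DualModel n => A - B) h6 h9).trans (h10 _ _ _)

end Scaling

end

/-! ### Geometric consequences of equality. -/

section

open Bundle

variable {n : ℕ} {M : Type*} [TopologicalSpace M] [ChartedSpace (Model n) M]
  [IsManifold (𝓡 n) ∞ M]
  [RiemannianBundle (fun q : M => TangentSpace (𝓡 n) q)]


theorem flat_smul {q : M} (c : ℝ) (v : TangentSpace (𝓡 n) q) : flat (c • v) = c • flat v := by
  ext w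
  exact real_inner_smul_left v w c

theorem apply_sharp {q : M} (p : TangentSpace (𝓡 n) q →L[ℝ] ℝ) : p (sharp p) = ‖p‖ ^ 2 := by
  rw [← norm_sharp p, ← real_inner_self_eq_norm_sq, inner_sharp]

/-- The equality case of the Cauchy-Schwarz inequality for a covector and a vector. -/
theorem eq_smul_sharp {q : M} {p : TangentSpace (𝓡 n) q →L[ℝ] ℝ} {v : TangentSpace (𝓡 n) q}
    (hp : 0 < ‖p‖ ^ 2) (hpv : ‖p‖ ^ 2 * ‖v‖ ^ 2 = p v ^ 2) : v = (p v / ‖p‖ ^ 2) • sharp p := by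
  have h1 : ‖v - (p v / ‖p‖ ^ 2) • sharp p‖ ^ 2 = 0 := by
    rw [norm_sub_sq_real, real_inner_smul_right, real_inner_comm, inner_sharp, norm_smul, mul_pow,
      norm_sharp, Real.norm_eq_abs, sq_abs]
    have hK := hp.ne'
    generalize ‖p‖ ^ 2 = K at hpv hK ⊢
    field_simp
    linarith
  exact sub_eq_zero.1 (norm_eq_zero.1 (pow_eq_zero_iff two_ne_zero |>.1 h1))

/-- Uniqueness of limits is taken first in M, then for the components of the covector in one chart.
-/
theorem eq_of_tendsto_cotangent [T2Space M] {ι : Type*} {l : Filter ι} [l.NeBot]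
    {f : ι → Cotangent n M} {z w : Cotangent n M} (hz : Tendsto f l (𝓝 z))
    (hw : Tendsto f l (𝓝 w)) : z = w := by
  have hπ : Continuous fun v : Cotangent n M => v.1 := FiberBundle.continuous_proj _ _
  have h1 : z.1 = w.1 := tendsto_nhds_unique ((hπ.tendsto z).comp hz) ((hπ.tendsto w).comp hw)
  obtain ⟨q, p⟩ := z
  obtain ⟨q', p'⟩ := w
  obtain rfl : q = q' := h1
  have h2 : ∀ p : TangentSpace (𝓡 n) q →L[ℝ] ℝ, Tendsto f l (𝓝 (⟨q, p⟩ : Cotangent n M)) →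
      Tendsto (fun i => (extChartAt (𝓡 n) q (f i).1, fibreCoord q (f i))) l
        (𝓝 (extChartAt (𝓡 n) q q, (show DualModel n from p))) := by
    intro p hp
    have h3 := (continuousAt_extChartAt (I := cotModel n) (⟨q, p⟩ : Cotangent n M)).tendsto.comp hp
    have h4 : extChartAt (cotModel n) (⟨q, p⟩ : Cotangent n M) ⟨q, p⟩ =
        (extChartAt (𝓡 n) q q, (show DualModel n from p)) :=
      (extChartAt_cotangent _ _).trans (congrArg (Prod.mk _) (fibreCoord_self _))
    rw [h4] at h3
    refine h3.congr fun i => ?_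
    exact extChartAt_cotangent _ _
  have h5 := tendsto_nhds_unique (h2 p hz) (h2 p' hw)
  exact congrArg (TotalSpace.mk q) (congrArg Prod.snd h5)

theorem continuous_smul_covector (q : M) (p : TangentSpace (𝓡 n) q →L[ℝ] ℝ) :
    Continuous fun κ : ℝ => (⟨q, κ • p⟩ : Cotangent n M) := by
  have h1 : ContMDiff 𝓘(ℝ, ℝ) (cotModel n) 0 fun κ : ℝ => (⟨q, κ • p⟩ : Cotangent n M) := by
    intro κ
    refine contMDiffWithinAt_cotangent_iff.2 ⟨contMDiffWithinAt_const, ?_⟩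
    exact contDiffWithinAt_id.smul (contDiffWithinAt_const (c := p.comp (frame q q)))
  exact h1.continuous

variable [IsContMDiffRiemannianBundle (𝓡 n) ∞ (Model n) (fun q : M => TangentSpace (𝓡 n) q)]
variable {ρ h : ℝ → ℝ} {μ δ : ℝ} {x : ℝ → Cotangent n M} {u : ℝ × ℝ → Cotangent n M}

namespace IsFloerHalfCylinder

theorem loopLength_eq {H : Cotangent n M → ℝ} (hu : IsFloerHalfCylinder ρ H x u) :
    loopLength (n := n) (boundaryLoop u) =
      ∫ t in (0 : ℝ)..1, √(speedSqAlong u (0, 1) (0, t)) :=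
  intervalIntegral.integral_congr fun t _ => norm_velocity_slice hu.smooth le_rfl t

theorem loopLength_le (hρ : IsCylindricalProfile ρ) (hh : IsLinearProfile μ δ h)
    (hx : IsNonconstantOrbit (radialHamiltonian h) x)
    (hu : IsFloerHalfCylinder ρ (radialHamiltonian h) x u) :
    loopLength (n := n) (boundaryLoop u) ≤ contactAction x := by
  rw [hu.loopLength_eq, hx.contactAction_eq hh]
  exact (hu.isFloerScalars hρ hh).integral_sqrt_le hρ hh (hu.tendsToRadius hh hx)
    (zero_lt_one.trans (hx.one_lt_norm hh))

theorem integral_eq (hh : IsLinearProfile μ δ h)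
    (hx : IsNonconstantOrbit (radialHamiltonian h) x)
    (hu : IsFloerHalfCylinder ρ (radialHamiltonian h) x u)
    (heq : loopLength (n := n) (boundaryLoop u) = contactAction x) :
    ∫ t in (0 : ℝ)..1, √(speedSqAlong u (0, 1) (0, t)) = deriv h ‖(x 0).2‖ := by
  rw [← hu.loopLength_eq, heq, hx.contactAction_eq hh]

theorem qPart_dS_eq_zero (hρ : IsCylindricalProfile ρ) (hh : IsLinearProfile μ δ h)
    (hx : IsNonconstantOrbit (radialHamiltonian h) x)
    (hu : IsFloerHalfCylinder ρ (radialHamiltonian h) x u)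
    (heq : loopLength (n := n) (boundaryLoop u) = contactAction x) (s t : ℝ) (hs : 0 ≤ s) :
    qPart (dS u (s, t)) = 0 := by
  have h1 : speedSqAlong u (1, 0) (s, t) = 0 := by
    rcases hs.eq_or_lt with rfl | hs
    · exact (hu.isFloerScalars hρ hh).S_zero t
    · exact ((hu.isFloerScalars hρ hh).rigidity hρ hh (hu.tendsToRadius hh hx)
        (zero_lt_one.trans (hx.one_lt_norm hh)) (hx.deriv_pos hh) (hu.integral_eq hh hx heq)
        hs t).2.2.1
  exact norm_eq_zero.1 ((pow_eq_zero_iff two_ne_zero).1 h1)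

/-- By the horizontal half of the Floer equation, ∂_s q = 0 says exactly that p is parallel along
q(s, ·). -/
theorem connector_dT_eq_zero (hρ : IsCylindricalProfile ρ) (hh : IsLinearProfile μ δ h)
    (hx : IsNonconstantOrbit (radialHamiltonian h) x)
    (hu : IsFloerHalfCylinder ρ (radialHamiltonian h) x u)
    (heq : loopLength (n := n) (boundaryLoop u) = contactAction x) (s t : ℝ) (hs : 0 ≤ s) :
    connector (dT u (s, t)) = 0 := by
  have h1 := hu.qPart_dS hh (mem_halfStrip.2 hs : (s, t) ∈ halfStrip)
  rw [hu.qPart_dS_eq_zero hρ hh hx heq s t hs] at h1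
  have h2 := (smul_eq_zero.1 (neg_eq_zero.1 h1.symm)).resolve_left
    (inv_ne_zero (hρ.pos _ (norm_nonneg (u (s, t)).2)).ne')
  rw [← flat_sharp (connector (dT u (s, t))), h2]
  ext v
  exact inner_zero_left v

theorem base_slice_eq_boundaryLoop (hρ : IsCylindricalProfile ρ) (hh : IsLinearProfile μ δ h)
    (hx : IsNonconstantOrbit (radialHamiltonian h) x)
    (hu : IsFloerHalfCylinder ρ (radialHamiltonian h) x u)
    (heq : loopLength (n := n) (boundaryLoop u) = contactAction x) {s : ℝ} (hs : 0 ≤ s) :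
    (fun t => (u (s, t)).1) = boundaryLoop u :=
  funext fun t => base_slice_eq hu.smooth (hu.qPart_dS_eq_zero hρ hh hx heq) hs t

theorem norm_pos (hρ : IsCylindricalProfile ρ) (hh : IsLinearProfile μ δ h)
    (hx : IsNonconstantOrbit (radialHamiltonian h) x)
    (hu : IsFloerHalfCylinder ρ (radialHamiltonian h) x u)
    (heq : loopLength (n := n) (boundaryLoop u) = contactAction x) {s : ℝ} (hs : 0 < s) (t : ℝ) :
    0 < ‖(u (s, t)).2‖ := by
  have h1 : 0 < ‖(u (s, t)).2‖ ^ 2 := ((hu.isFloerScalars hρ hh).rigidity hρ hh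
    (hu.tendsToRadius hh hx) (zero_lt_one.trans (hx.one_lt_norm hh)) (hx.deriv_pos hh)
    (hu.integral_eq hh hx heq) hs t).1
  exact (norm_nonneg (u (s, t)).2).lt_of_ne' fun h0 => by simp [h0] at h1

/-- Equality in Cauchy-Schwarz makes ∂_t q proportional to p^♯, and a = h'(r)|p| fixes the factor.
-/
theorem flat_velocity_slice (hρ : IsCylindricalProfile ρ) (hh : IsLinearProfile μ δ h)
    (hx : IsNonconstantOrbit (radialHamiltonian h) x)
    (hu : IsFloerHalfCylinder ρ (radialHamiltonian h) x u)
    (heq : loopLength (n := n) (boundaryLoop u) = contactAction x) {s : ℝ} (hs : 0 < s) (t : ℝ) :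
    flat (velocity (fun t => (u (s, t)).1) t) =
      (deriv h ‖(x 0).2‖ / ‖(u (s, t)).2‖) •
        (show TangentSpace (𝓡 n) (u (s, t)).1 →L[ℝ] ℝ from (u (s, t)).2) := by
  obtain ⟨h1, -, -, h2, h3⟩ := (hu.isFloerScalars hρ hh).rigidity hρ hh
    (hu.tendsToRadius hh hx) (zero_lt_one.trans (hx.one_lt_norm hh)) (hx.deriv_pos hh)
    (hu.integral_eq hh hx heq) hs t
  have h4 := hu.norm_pos hρ hh hx heq hs t
  have hsqrt : √(normSqAlong u (s, t)) = ‖(u (s, t)).2‖ := Real.sqrt_sq (norm_nonneg (u (s, t)).2)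
  rw [hsqrt] at h2
  have h5 : qPart (dT u (s, t)) = ((u (s, t)).2 (qPart (dT u (s, t))) / ‖(u (s, t)).2‖ ^ 2) •
      sharp (u (s, t)).2 := eq_smul_sharp h1 h3
  have h6 : (u (s, t)).2 (qPart (dT u (s, t))) / ‖(u (s, t)).2‖ ^ 2 =
      deriv h ‖(x 0).2‖ / ‖(u (s, t)).2‖ := by
    refine (congrArg (· / ‖(u (s, t)).2‖ ^ 2) h2).trans ?_
    field_simp
  rw [h6] at h5
  rw [velocity_slice hu.smooth hs.le, h5, flat_smul, flat_sharp]

theorem eq_lift (hρ : IsCylindricalProfile ρ) (hh : IsLinearProfile μ δ h)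
    (hx : IsNonconstantOrbit (radialHamiltonian h) x)
    (hu : IsFloerHalfCylinder ρ (radialHamiltonian h) x u)
    (heq : loopLength (n := n) (boundaryLoop u) = contactAction x) {s : ℝ} (hs : 0 < s) (t : ℝ) :
    u (s, t) = ⟨boundaryLoop u t, (‖(u (s, t)).2‖ / deriv h ‖(x 0).2‖) •
      flat (velocity (n := n) (boundaryLoop u) t)⟩ := by
  have hL := hx.deriv_pos hh
  have hp := hu.norm_pos hρ hh hx heq hs t
  -- Generalizing over the base curve lets the equality with `boundaryLoop u` be substituted without
  -- transport between fibres.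
  have key : ∀ f : ℝ → M, (fun t => (u (s, t)).1) = f → u (s, t) =
      ⟨f t, (‖(u (s, t)).2‖ / deriv h ‖(x 0).2‖) • flat (velocity (n := n) f t)⟩ := by
    rintro f rfl
    refine congrArg (TotalSpace.mk (u (s, t)).1) ?_
    rw [hu.flat_velocity_slice hρ hh hx heq hs t, smul_smul, div_mul_div_cancel₀ hL.ne',
      div_self hp.ne', one_smul]
  exact key _ (hu.base_slice_eq_boundaryLoop hρ hh hx heq hs.le)

theorem mem_halfCylinderOver (hρ : IsCylindricalProfile ρ) (hh : IsLinearProfile μ δ h)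
    (hx : IsNonconstantOrbit (radialHamiltonian h) x)
    (hu : IsFloerHalfCylinder ρ (radialHamiltonian h) x u)
    (heq : loopLength (n := n) (boundaryLoop u) = contactAction x) (s t : ℝ) (hs : 0 ≤ s) :
    u (s, t) ∈ halfCylinderOver (n := n) (boundaryLoop u) := by
  rcases hs.eq_or_lt with rfl | hs
  · refine ⟨t, 0, le_rfl, ?_⟩
    refine congrArg (TotalSpace.mk (u (0, t)).1) ?_
    rw [zero_smul]
    exact hu.boundary t
  · exact ⟨t, _, div_nonneg (norm_nonneg (u (s, t)).2) (hx.deriv_pos hh).le,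
      hu.eq_lift hρ hh hx heq hs t⟩

theorem isClosedGeodesic (hρ : IsCylindricalProfile ρ) (hh : IsLinearProfile μ δ h)
    (hx : IsNonconstantOrbit (radialHamiltonian h) x)
    (hu : IsFloerHalfCylinder ρ (radialHamiltonian h) x u)
    (heq : loopLength (n := n) (boundaryLoop u) = contactAction x) :
    IsClosedGeodesic (n := n) (boundaryLoop u) where
  smooth := contMDiff_base_slice hu.smooth le_rfl
  periodic t := congrArg TotalSpace.proj (hu.periodic 0 t le_rfl)
  nonconstant := by
    by_contra! hconst
    have h1 : boundaryLoop u = fun _ => boundaryLoop u 0 := funext fun t => hconst t 0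
    have h2 : loopLength (n := n) (boundaryLoop u) = 0 := by
      have h3 : ∀ t, ‖velocity (n := n) (fun _ : ℝ => boundaryLoop u 0) t‖ = 0 := fun t => by
        rw [velocity, mfderiv_const]
        exact norm_zero
      rw [h1, loopLength]
      simp [h3]
    rw [h2, hx.contactAction_eq hh] at heq
    exact (hx.deriv_pos hh).ne heq
  geodesic t := by
    -- Any positive s would do in place of 1: on that slice q̇^♭ is a constant multiple of p, which
    -- is parallel.
    have hN : ∀ t, ‖(u (1, t)).2‖ = ‖(u (1, 0)).2‖ := by
      intro t
      have h1 := (hu.isFloerScalars hρ hh).N_eq_shift hρ hh (hu.tendsToRadius hh hx)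
        (zero_lt_one.trans (hx.one_lt_norm hh)) (hu.integral_eq hh hx heq) one_pos (t := 0) t
      rw [zero_add] at h1
      exact ((pow_left_inj₀ (norm_nonneg (u (1, 0)).2) (norm_nonneg (u (1, t)).2) two_ne_zero).1
        h1).symm
    have hlift : velocityLift (n := n) (boundaryLoop u) = fun t => (⟨(u (1, t)).1,
        (deriv h ‖(x 0).2‖ / ‖(u (1, 0)).2‖) • (u (1, t)).2⟩ : Cotangent n M) := by
      rw [← hu.base_slice_eq_boundaryLoop hρ hh hx heq zero_le_one]
      funext t
      refine congrArg (TotalSpace.mk (u (1, t)).1) ?_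
      have h1 := hu.flat_velocity_slice hρ hh hx heq one_pos t
      rwa [hN t] at h1
    have key : ∀ g : ℝ → Cotangent n M, g = (fun t => (⟨(u (1, t)).1,
        (deriv h ‖(x 0).2‖ / ‖(u (1, 0)).2‖) • (u (1, t)).2⟩ : Cotangent n M)) →
        connector (mfderiv 𝓘(ℝ, ℝ) (cotModel n) g t (1 : ℝ)) = 0 := by
      rintro g rfl
      have h1 := connector_mfderiv_smul (c := fun t => u (1, t)) (t := t)
        ((contMDiff_slice hu.smooth zero_le_one).mdifferentiableAt (by simp))
        (hasDerivAt_const t (deriv h ‖(x 0).2‖ / ‖(u (1, 0)).2‖))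
      rw [mfderiv_slice hu.smooth zero_le_one, hu.connector_dT_eq_zero hρ hh hx heq 1 t zero_le_one,
        zero_smul, smul_zero, add_zero] at h1
      exact h1
    exact key _ hlift

/-- The limit of `eq_lift` as s tends to infinity: the base point is fixed and the norm of the
momentum tends to that of x. -/
theorem orbit_eq_lift [T2Space M] (hρ : IsCylindricalProfile ρ) (hh : IsLinearProfile μ δ h)
    (hx : IsNonconstantOrbit (radialHamiltonian h) x)
    (hu : IsFloerHalfCylinder ρ (radialHamiltonian h) x u)
    (heq : loopLength (n := n) (boundaryLoop u) = contactAction x) (t : ℝ) :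
    x t = ⟨boundaryLoop u t, (‖(x 0).2‖ / deriv h ‖(x 0).2‖) •
      flat (velocity (n := n) (boundaryLoop u) t)⟩ := by
  have h1 : Tendsto (fun s => u (s, t)) atTop (𝓝 (x t)) :=
    (hu.asymptotic t).comp (tendsto_id.prodMk tendsto_const_nhds)
  have h2 : Tendsto (fun s => ‖(u (s, t)).2‖) atTop (𝓝 ‖(x 0).2‖) := by
    rw [Metric.tendsto_atTop]
    intro η hη
    obtain ⟨T, hT⟩ := hu.tendsToRadius hh hx η hη
    refine ⟨T, fun s hs => ?_⟩
    have h3 := hT s hs t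
    have hsqrt : √(normSqAlong u (s, t)) = ‖(u (s, t)).2‖ := Real.sqrt_sq (norm_nonneg (u (s, t)).2)
    rwa [hsqrt] at h3
  have h4 := ((continuous_smul_covector (boundaryLoop u t)
    (flat (velocity (n := n) (boundaryLoop u) t))).tendsto _).comp
      (h2.div_const (deriv h ‖(x 0).2‖))
  refine eq_of_tendsto_cotangent h1 (h4.congr' ?_)
  filter_upwards [eventually_gt_atTop 0] with s hs
  exact (hu.eq_lift hρ hh hx heq hs t).symm

end IsFloerHalfCylinder

end

/-! ### The converse: half-cylinders over closed geodesics. -/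

section

section Tangency

variable {F : Type*} [NormedAddCommGroup F] [NormedSpace ℝ F]

/-- If a curve `f` meets the image of an immersed curve `g` along a sequence of parameters
converging to `t`, then its derivative at `t` is tangent to `g`. -/
theorem exists_eq_smul_of_seq {f g : ℝ → F} {f' g' : F} {t τ : ℝ} (hf : HasDerivAt f f' t)
    (hg : HasDerivAt g g' τ) (hg' : g' ≠ 0) {σ θ : ℕ → ℝ} (hσ : Tendsto σ atTop (𝓝[≠] t))
    (hθ : Tendsto θ atTop (𝓝 τ)) (h0 : f t = g τ) (h : ∀ᶠ k in atTop, f (σ k) = g (θ k)) :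
    ∃ m : ℝ, f' = m • g' := by
  have h1 : Tendsto (fun k => slope f t (σ k)) atTop (𝓝 f') := (hasDerivAt_iff_tendsto_slope.1 hf).comp hσ
  have h2 : Tendsto (fun k => dslope g τ (θ k)) atTop (𝓝 g') := by
    have h3 := (continuousAt_dslope_same.2 hg.differentiableAt).tendsto.comp hθ
    rwa [dslope_same, hg.deriv] at h3
  -- The ratio of parameter increments. It converges because a functional equal to 1 on g' recovers
  -- it from the difference quotients of f.
  set m : ℕ → ℝ := fun k => (σ k - t)⁻¹ * (θ k - τ) with hm
  have h4 : Tendsto (fun k => m k • dslope g τ (θ k)) atTop (𝓝 f') := by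
    refine h1.congr' ?_
    filter_upwards [h] with k hk
    rw [slope, vsub_eq_sub, hk, h0, ← sub_smul_dslope, smul_smul]
  obtain ⟨φ, hφ⟩ := SeparatingDual.exists_eq_one (R := ℝ) hg'
  have h5 : Tendsto (fun k => φ (dslope g τ (θ k))) atTop (𝓝 1) := by
    rw [← hφ]
    exact (φ.continuous.tendsto g').comp h2
  have h6 : Tendsto m atTop (𝓝 (φ f')) := by
    have h7 := ((φ.continuous.tendsto f').comp h4).div h5 one_ne_zero
    rw [div_one] at h7
    refine h7.congr' ?_
    filter_upwards [h5.eventually_ne one_ne_zero] with k hk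
    simp only [Function.comp_apply, Pi.div_apply, map_smul, smul_eq_mul]
    exact mul_div_cancel_right₀ _ hk
  exact ⟨φ f', tendsto_nhds_unique h4 (h6.smul h2)⟩

theorem differentiableAt_metric_velocity {n : ℕ} {g : Model n → Model n →L[ℝ] Model n →L[ℝ] ℝ}
    {Y : ℝ → Model n} {t : ℝ} (hg : ContDiffAt ℝ ∞ g (Y t)) (hY : ContDiffAt ℝ ∞ Y t) :
    DifferentiableAt ℝ (fun t' => g (Y t') (fderiv ℝ Y t' 1)) t := by
  have h1 : DifferentiableAt ℝ (fderiv ℝ Y) t :=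
    (hY.fderiv_right (m := 1) (by norm_num; exact ENat.LEInfty.out)).differentiableAt (by simp)
  have h2 : DifferentiableAt ℝ g (Y t) := hg.differentiableAt (by simp)
  exact (h2.comp t (hY.differentiableAt (by simp))).clm_apply
    (h1.clm_apply (differentiableAt_const 1))

end Tangency

open Bundle


variable {n : ℕ} {M : Type*} [TopologicalSpace M] [ChartedSpace (Model n) M]
  [IsManifold (𝓡 n) ∞ M]
  [RiemannianBundle (fun q : M => TangentSpace (𝓡 n) q)]


/-- A tangent vector of `T^*M` at `(q, p)` which is a multiple of the horizontal lift of `p^♯`. -/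
def IsGeodesicDirection (z : Cotangent n M) (V : TangentSpace (cotModel n) z) : Prop :=
  connector V = 0 ∧ ∃ m : ℝ, qPart V = m • sharp z.2

theorem IsGeodesicDirection.smul {z : Cotangent n M} {V : TangentSpace (cotModel n) z}
    (hV : IsGeodesicDirection z V) (k : ℝ) : IsGeodesicDirection z (k • V) := by
  obtain ⟨h1, m, h2⟩ := hV
  refine ⟨by rw [connector_smul, h1, smul_zero], k * m, ?_⟩
  rw [mul_smul, ← h2]
  rfl

theorem hasDerivAt_extChartAt {c : ℝ → Cotangent n M} {t : ℝ}
    (hc : MDifferentiableAt 𝓘(ℝ, ℝ) (cotModel n) c t) :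
    HasDerivAt (fun t' => extChartAt (cotModel n) (c t) (c t'))
      (show Model n × DualModel n from mfderiv 𝓘(ℝ, ℝ) (cotModel n) c t (1 : ℝ)) t := by
  have h1 : HasMFDerivAt (cotModel n) 𝓘(ℝ, Model n × DualModel n) (extChartAt (cotModel n) (c t)) (c t)
      (ContinuousLinearMap.id ℝ (Model n × DualModel n)) := by
    have := (mdifferentiableAt_extChartAt (I := cotModel n) (mem_chart_source _ (c t))).hasMFDerivAt
    rwa [mfderiv_extChartAt_self] at this
  have h2 : HasFDerivAt (fun t' => extChartAt (cotModel n) (c t) (c t'))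
      ((ContinuousLinearMap.id ℝ (Model n × DualModel n)).comp
        (show ℝ →L[ℝ] Model n × DualModel n from mfderiv 𝓘(ℝ, ℝ) (cotModel n) c t)) t :=
    (h1.comp t hc.hasMFDerivAt).hasFDerivAt
  exact h2.hasDerivAt

/-- The tangency statement for curves in a vector space, read in the chart at the common limit
point. -/
theorem isGeodesicDirection_of_seq {c γ : ℝ → Cotangent n M} {t τ : ℝ}
    (hc : MDifferentiableAt 𝓘(ℝ, ℝ) (cotModel n) c t)
    (hγ : MDifferentiableAt 𝓘(ℝ, ℝ) (cotModel n) γ τ)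
    (hne : mfderiv 𝓘(ℝ, ℝ) (cotModel n) γ τ (1 : ℝ) ≠ 0)
    (hdir : IsGeodesicDirection (γ τ) (mfderiv 𝓘(ℝ, ℝ) (cotModel n) γ τ (1 : ℝ)))
    {σ θ : ℕ → ℝ} (hσ : Tendsto σ atTop (𝓝[≠] t)) (hθ : Tendsto θ atTop (𝓝 τ))
    (h0 : γ τ = c t) (h : ∀ᶠ k in atTop, c (σ k) = γ (θ k)) :
    IsGeodesicDirection (c t) (mfderiv 𝓘(ℝ, ℝ) (cotModel n) c t (1 : ℝ)) := by
  have h1 : ∀ z, c t = z → HasDerivAt (fun t' => extChartAt (cotModel n) z (c t'))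
      (show Model n × DualModel n from mfderiv 𝓘(ℝ, ℝ) (cotModel n) c t (1 : ℝ)) t := by
    rintro _ rfl
    exact hasDerivAt_extChartAt hc
  obtain ⟨m, hm⟩ := exists_eq_smul_of_seq (h1 _ h0.symm) (hasDerivAt_extChartAt hγ) hne hσ hθ
    (congrArg _ h0.symm) (h.mono fun k hk => congrArg _ hk)
  have h2 : ∀ z, γ τ = z → IsGeodesicDirection z
      (m • (show Model n × DualModel n from mfderiv 𝓘(ℝ, ℝ) (cotModel n) γ τ (1 : ℝ))) := by
    rintro _ rfl
    exact hdir.smul m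
  have h3 := h2 _ h0
  rw [← hm] at h3
  exact h3

theorem norm_flat {q : M} (v : TangentSpace (𝓡 n) q) : ‖flat v‖ = ‖v‖ := by
  rw [← norm_sharp, sharp_flat]

theorem velocityLift_periodic {q : ℝ → M} (hq : ContMDiff 𝓘(ℝ, ℝ) (𝓡 n) ∞ q)
    (hp : ∀ t, q (t + 1) = q t) : Function.Periodic (velocityLift (n := n) q) 1 := by
  intro t
  have h1 : velocityLift (n := n) (fun t => q (t + 1)) t = velocityLift q (t + 1) := by
    refine congrArg (TotalSpace.mk (q (t + 1))) (congrArg flat ?_)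
    have h2 : HasFDerivAt (fun t : ℝ => t + 1) (ContinuousLinearMap.id ℝ ℝ) t :=
      (hasFDerivAt_id t).add_const 1
    have h3 := ((hq.mdifferentiableAt (x := t + 1) (by simp)).hasMFDerivAt.comp t h2.hasMFDerivAt).mfderiv
    exact DFunLike.congr_fun h3 (1 : ℝ)
  rw [← h1, show (fun t => q (t + 1)) = q from funext hp]

variable [IsContMDiffRiemannianBundle (𝓡 n) ∞ (Model n) (fun q : M => TangentSpace (𝓡 n) q)]

theorem mdifferentiableAt_velocityLift {q : ℝ → M} (hq : ContMDiff 𝓘(ℝ, ℝ) (𝓡 n) ∞ q) (t : ℝ) :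
    MDifferentiableAt 𝓘(ℝ, ℝ) (cotModel n) (velocityLift (n := n) q) t := by
  refine mdifferentiableWithinAt_univ.1 (mdifferentiableWithinAt_cotangent_iff.2
    ⟨(hq.mdifferentiableAt (by simp)).mdifferentiableWithinAt, ?_⟩)
  rw [differentiableWithinAt_univ]
  -- In a chart the components of q̇^♭ are g(Y)(Ẏ), visibly differentiable.
  have h1 : (fun t' => fibreCoord (q t) (velocityLift (n := n) q t')) =ᶠ[𝓝 t] fun t' =>
      chartMetric (q t) (extChartAt (𝓡 n) (q t) (q t'))
        (fderiv ℝ (fun t' => extChartAt (𝓡 n) (q t) (q t')) t' 1) := by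
    filter_upwards [hq.continuous.continuousAt.eventually (chart_source_mem_nhds (Model n) (q t))]
      with t' ht'
    have h2 := mfderivWithin_base (c := q) ht' (hq.mdifferentiableAt
      (by simp)).mdifferentiableWithinAt (uniqueDiffWithinAt_univ (x := t')) (1 : ℝ)
    rw [mfderivWithin_univ, fderivWithin_univ] at h2
    ext w
    rw [chartMetric_apply ht']
    exact congrArg (fun v => inner ℝ v (frame (q t) (q t') w)) h2
  refine DifferentiableAt.congr_of_eventuallyEq ?_ h1
  have h3 : ContDiffAt ℝ ∞ (fun t' => extChartAt (𝓡 n) (q t) (q t')) t :=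
    contDiffWithinAt_extChartAt_comp (s := univ) le_rfl (mem_chart_source (Model n) _) (hq t)
  exact differentiableAt_metric_velocity (contDiffAt_chartMetric (mem_chart_source (Model n) (q t))) h3

namespace IsClosedGeodesic

variable {q : ℝ → M}

theorem norm_velocity (hq : IsClosedGeodesic (n := n) q) (t : ℝ) :
    ‖velocity (n := n) q t‖ = ‖velocity (n := n) q 0‖ := by
  have h1 := norm_eq_of_connector_eq_zero (mdifferentiableAt_velocityLift hq.smooth) hq.geodesic t 0
  exact (norm_flat _).symm.trans (h1.trans (norm_flat _))

theorem norm_velocity_pos (hq : IsClosedGeodesic (n := n) q) : 0 < ‖velocity (n := n) q 0‖ := by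
  refine (norm_nonneg _).lt_of_ne' fun h0 => ?_
  obtain ⟨t, t', hne⟩ := hq.nonconstant
  refine hne (eq_of_hasMFDerivAt_zero (I := 𝓡 n) (fun t => ?_) t t')
  have h1 := (hq.smooth.mdifferentiableAt (x := t) (by simp)).hasMFDerivAt
  refine h1.congr_mfderiv (ContinuousLinearMap.ext fun (a : ℝ) => ?_)
  have h2 : velocity (n := n) q t = 0 := norm_eq_zero.1 ((hq.norm_velocity t).trans h0)
  have h3 := ContinuousLinearMap.map_smul (mfderiv 𝓘(ℝ, ℝ) (𝓡 n) q t) a (1 : ℝ)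
  have h4 : a = a • (1 : ℝ) := (mul_one a).symm
  exact (congrArg (fun b : ℝ => mfderiv 𝓘(ℝ, ℝ) (𝓡 n) q t b) h4).trans <| h3.trans ((congrArg (a • ·) h2).trans (smul_zero a))

theorem loopLength_eq (hq : IsClosedGeodesic (n := n) q) :
    loopLength (n := n) q = ‖velocity (n := n) q 0‖ := by
  rw [loopLength]
  simp [hq.norm_velocity]

theorem isGeodesicDirection (hq : IsClosedGeodesic (n := n) q) (τ : ℝ) :
    IsGeodesicDirection (velocityLift (n := n) q τ)
      (mfderiv 𝓘(ℝ, ℝ) (cotModel n) (velocityLift (n := n) q) τ (1 : ℝ)) := by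
  refine ⟨hq.geodesic τ, 1, ?_⟩
  rw [qPart_mfderiv (mdifferentiableAt_velocityLift hq.smooth τ), one_smul]
  exact (sharp_flat _).symm

theorem mfderiv_velocityLift_ne_zero (hq : IsClosedGeodesic (n := n) q) (τ : ℝ) :
    mfderiv 𝓘(ℝ, ℝ) (cotModel n) (velocityLift (n := n) q) τ (1 : ℝ) ≠ 0 := by
  intro h0
  have h1 := qPart_mfderiv (mdifferentiableAt_velocityLift hq.smooth τ)
  rw [h0] at h1
  have h2 : velocity (n := n) q τ = 0 := h1.symm
  have h3 := hq.norm_velocity τ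
  rw [h2, norm_zero] at h3
  exact hq.norm_velocity_pos.ne h3

/-- Rescaling to the norm of the geodesic's velocity removes the radial parameter. The parameter τ
is kept in [0, 1] so that compactness can be used. -/
theorem exists_normalized_eq (hq : IsClosedGeodesic (n := n) q) {z : Cotangent n M}
    (hz : z ∈ halfCylinderOver (n := n) q) (h0 : ‖z.2‖ ≠ 0) :
    ∃ τ ∈ Icc (0 : ℝ) 1, (⟨z.1, (‖velocity (n := n) q 0‖ / ‖z.2‖) • z.2⟩ : Cotangent n M) =
      velocityLift q τ := by
  obtain ⟨τ, r, hr, rfl⟩ := hz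
  have hp := velocityLift_periodic hq.smooth hq.periodic
  refine ⟨Int.fract τ, ⟨Int.fract_nonneg τ, (Int.fract_lt_one τ).le⟩, ?_⟩
  have h1 := hp.sub_int_mul_eq ⌊τ⌋ (x := τ)
  rw [mul_one] at h1
  refine Eq.trans ?_ h1.symm
  refine congrArg (TotalSpace.mk (q τ)) ?_
  have h2 : ‖r • flat (velocity (n := n) q τ)‖ = r * ‖velocity (n := n) q 0‖ := by
    rw [← norm_sharp, sharp_smul, sharp_flat, norm_smul, hq.norm_velocity, Real.norm_of_nonneg hr]
  have h3 : r * ‖velocity (n := n) q 0‖ ≠ 0 := fun h => h0 (h2.trans h)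
  have h4 : (‖velocity (n := n) q 0‖ / ‖r • flat (velocity (n := n) q τ)‖) •
      r • flat (velocity (n := n) q τ) = flat (velocity (n := n) q τ) := by
    rw [h2, smul_smul]
    have h5 : ‖velocity (n := n) q 0‖ / (r * ‖velocity (n := n) q 0‖) * r = 1 := by
      have := left_ne_zero_of_mul h3
      have := right_ne_zero_of_mul h3
      field_simp
    rw [h5, one_smul]
  exact h4

/-- A curve in the half-cylinder over a closed geodesic is tangent to it. -/
theorem exists_tangent [T2Space M] (hq : IsClosedGeodesic (n := n) q) {c : ℝ → Cotangent n M}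
    (hc : ∀ t, MDifferentiableAt 𝓘(ℝ, ℝ) (cotModel n) c t)
    (hcyl : ∀ t, c t ∈ halfCylinderOver (n := n) q) {t : ℝ} (h0 : ‖(c t).2‖ ≠ 0) :
    ∃ m k : ℝ, qPart (mfderiv 𝓘(ℝ, ℝ) (cotModel n) c t (1 : ℝ)) = m • sharp (c t).2 ∧
      connector (mfderiv 𝓘(ℝ, ℝ) (cotModel n) c t (1 : ℝ)) =
        k • (show TangentSpace (𝓡 n) (c t).1 →L[ℝ] ℝ from (c t).2) := by
  set ℓ := ‖velocity (n := n) q 0‖ with hℓ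
  have hℓ0 : ℓ ≠ 0 := hq.norm_velocity_pos.ne'
  have hsqrt : (fun t => ‖(c t).2‖) = fun t => √(‖(c t).2‖ ^ 2) :=
    funext fun t => (Real.sqrt_sq (norm_nonneg (c t).2)).symm
  have hd : DifferentiableAt ℝ (fun t => ‖(c t).2‖) t := by
    rw [hsqrt]
    exact (hasDerivAt_normSq_comp (hc t)).differentiableAt.sqrt (pow_ne_zero 2 h0)
  -- The rescaled curve takes values, where p ≠ 0, in the image of the velocity lift, an immersed
  -- curve.
  set κ : ℝ → ℝ := fun t => ℓ / ‖(c t).2‖ with hκ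
  have hκd : DifferentiableAt ℝ κ t := (differentiableAt_const ℓ).div hd h0
  have hκ0 : κ t ≠ 0 := div_ne_zero hℓ0 h0
  set c' : ℝ → Cotangent n M := fun t => ⟨(c t).1, κ t • (c t).2⟩ with hc'
  have hc'd : MDifferentiableAt 𝓘(ℝ, ℝ) (cotModel n) c' t := mdifferentiableAt_smul (hc t) hκd
  have hex : ∀ k : ℕ, ∃ τ ∈ Icc (0 : ℝ) 1, ‖(c (t + 1 / ((k : ℝ) + 1))).2‖ ≠ 0 →
      c' (t + 1 / ((k : ℝ) + 1)) = velocityLift q τ := by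
    intro k
    by_cases hk : ‖(c (t + 1 / ((k : ℝ) + 1))).2‖ = 0
    · exact ⟨0, ⟨le_rfl, zero_le_one⟩, fun h => absurd hk h⟩
    · obtain ⟨τ, hτ, h1⟩ := hq.exists_normalized_eq (hcyl _) hk
      exact ⟨τ, hτ, fun _ => h1⟩
  -- The parameters on the geodesic are chosen without continuity; a convergent subsequence is
  -- enough for tangency.
  choose θ hθ hθc using hex
  obtain ⟨τ, -, φ, hφ, hτ⟩ := isCompact_Icc.tendsto_subseq hθ
  have hσ : Tendsto (fun k : ℕ => t + 1 / ((k : ℝ) + 1)) atTop (𝓝[≠] t) := by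
    refine tendsto_nhdsWithin_iff.2 ⟨?_, Eventually.of_forall fun k => ?_⟩
    · simpa using tendsto_const_nhds.add (tendsto_one_div_add_atTop_nhds_zero_nat (𝕜 := ℝ))
    · have : (0 : ℝ) < 1 / ((k : ℝ) + 1) := by positivity
      simp only [mem_compl_iff, mem_singleton_iff]
      linarith
  have hσφ := hσ.comp hφ.tendsto_atTop
  have hev : ∀ᶠ k in atTop, c' (t + 1 / (((φ k : ℕ) : ℝ) + 1)) = velocityLift q (θ (φ k)) := by
    have h1 := (tendsto_nhds_of_tendsto_nhdsWithin hσφ).eventually (hd.continuousAt.eventually_ne h0)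
    filter_upwards [h1] with k hk
    exact hθc (φ k) hk
  have hlim : velocityLift q τ = c' t := by
    have h1 := ((mdifferentiableAt_velocityLift hq.smooth τ).continuousAt.tendsto).comp hτ
    have h2 := hc'd.continuousAt.tendsto.comp (tendsto_nhds_of_tendsto_nhdsWithin hσφ)
    exact eq_of_tendsto_cotangent h1 (h2.congr' hev)
  obtain ⟨h1, m, h2⟩ := isGeodesicDirection_of_seq hc'd (mdifferentiableAt_velocityLift hq.smooth τ)
    (hq.mfderiv_velocityLift_ne_zero τ) (hq.isGeodesicDirection τ) hσφ hτ hlim hev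
  have h3 := connector_mfderiv_smul (hc t) hκd.hasDerivAt
  -- The rescaled curve is parallel at t, so by the Leibniz rule ∇_t p is a multiple of p.
  have h4 : deriv κ t • (show TangentSpace (𝓡 n) (c t).1 →L[ℝ] ℝ from (c t).2) +
      κ t • connector (mfderiv 𝓘(ℝ, ℝ) (cotModel n) c t (1 : ℝ)) = 0 := h3.symm.trans h1
  refine ⟨m * κ t, -(deriv κ t / κ t), ?_, ?_⟩
  · have h5 := qPart_mfderiv hc'd
    have h6 := qPart_mfderiv (hc t)
    refine h6.trans (h5.symm.trans (h2.trans ?_))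
    rw [mul_smul]
    exact congrArg (m • ·) (sharp_smul (κ t) (c t).2)
  · have h7 := eq_neg_of_add_eq_zero_right h4
    have h8 := congrArg ((κ t)⁻¹ • ·) h7
    simp only [smul_smul, inv_mul_cancel₀ hκ0, one_smul] at h8
    have h9 : ∀ P : TangentSpace (𝓡 n) (c t).1 →L[ℝ] ℝ,
        (κ t)⁻¹ • -(deriv κ t • P) = -(deriv κ t / κ t) • P := fun P => by
      ext v
      change (κ t)⁻¹ * -(deriv κ t * P v) = -(deriv κ t / κ t) * P v
      ring
    exact h8.trans (h9 _)

end IsClosedGeodesic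

variable {ρ h : ℝ → ℝ} {μ δ : ℝ} {x : ℝ → Cotangent n M} {u : ℝ × ℝ → Cotangent n M}

theorem normSq_mul_eq_of_eq_smul {q : M} {p : TangentSpace (𝓡 n) q →L[ℝ] ℝ}
    {v : TangentSpace (𝓡 n) q} {m : ℝ} (hv : v = m • sharp p) :
    ‖p‖ ^ 2 * ‖v‖ ^ 2 = p v ^ 2 := by
  rw [hv, map_smul, apply_sharp, norm_smul, norm_sharp, mul_pow, Real.norm_eq_abs, sq_abs,
    smul_eq_mul]
  ring

theorem IsFloerHalfCylinder.loopLength_eq_of_isClosedGeodesic [T2Space M]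
    (hρ : IsCylindricalProfile ρ) (hh : IsLinearProfile μ δ h)
    (hx : IsNonconstantOrbit (radialHamiltonian h) x)
    (hu : IsFloerHalfCylinder ρ (radialHamiltonian h) x u)
    (hq : IsClosedGeodesic (n := n) (boundaryLoop u))
    (hcyl : ∀ s t : ℝ, 0 ≤ s → u (s, t) ∈ halfCylinderOver (n := n) (boundaryLoop u)) :
    loopLength (n := n) (boundaryLoop u) = contactAction x := by
  rw [hq.loopLength_eq, hx.contactAction_eq hh]
  refine (hu.isFloerScalars hρ hh).deriv_eq_of_defect hρ hh (hu.tendsToRadius hh hx)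
    (hx.one_lt_norm hh) hq.norm_velocity_pos (fun t => ?_) fun s t hs hN => ?_
  · rw [← hq.norm_velocity t]
    have h1 := norm_velocity_slice hu.smooth le_rfl t
    have h2 : ‖velocity (n := n) (boundaryLoop u) t‖ = √(speedSqAlong u (0, 1) (0, t)) := h1
    rw [h2, Real.sq_sqrt (show 0 ≤ speedSqAlong u (0, 1) (0, t) from sq_nonneg _)]
  · have h0 : ‖(u (s, t)).2‖ ≠ 0 := fun h0 => by
      have h1 : normSqAlong u (s, t) = 0 := by rw [normSqAlong, h0]; norm_num
      exact hN.ne' h1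
    obtain ⟨m, k, h1, h2⟩ := hq.exists_tangent (c := fun t => u (s, t)) (t := t)
      (fun t => (contMDiff_slice hu.smooth hs.le).mdifferentiableAt (by simp))
      (fun t => hcyl s t hs.le) h0
    rw [mfderiv_slice hu.smooth hs.le] at h1 h2
    have h3 := hu.qPart_dS hh (mem_halfStrip.2 hs.le : (s, t) ∈ halfStrip)
    rw [h2, sharp_smul, smul_smul, ← neg_smul] at h3
    -- The velocity ∂_t q is a multiple of p^♯ by tangency, and so is ∂_s q = -ρ⁻¹(∇_t p)^♯; hence
    -- both defects vanish.
    exact ⟨normSq_mul_eq_of_eq_smul h1, normSq_mul_eq_of_eq_smul h3⟩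

end

end CotangentFloer

end

open CotangentFloer Bundle in
theorem mainTheorem5 {n : ℕ} {M : Type*} [TopologicalSpace M] [T2Space M] [CompactSpace M]
    [ChartedSpace (Model n) M] [IsManifold (𝓡 n) ∞ M]
    [RiemannianBundle (fun q : M => TangentSpace (𝓡 n) q)]
    [IsContMDiffRiemannianBundle (𝓡 n) ∞ (Model n) (fun q : M => TangentSpace (𝓡 n) q)]
    (ρ : ℝ → ℝ) (hρ : IsCylindricalProfile ρ)
    (μ δ : ℝ) (h : ℝ → ℝ) (hh : IsLinearProfile μ δ h)
    (x : ℝ → Cotangent n M) (hx : IsNonconstantOrbit (radialHamiltonian h) x)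
    (u : ℝ × ℝ → Cotangent n M) (hu : IsFloerHalfCylinder ρ (radialHamiltonian h) x u) :
    loopLength (n := n) (boundaryLoop u) ≤ contactAction x ∧
    contactAction x ≤ hamiltonianAction (radialHamiltonian h) x ∧
    (loopLength (n := n) (boundaryLoop u) = contactAction x ↔
      IsClosedGeodesic (n := n) (boundaryLoop u) ∧
        ∀ s t : ℝ, 0 ≤ s → u (s, t) ∈ halfCylinderOver (n := n) (boundaryLoop u)) ∧
    (loopLength (n := n) (boundaryLoop u) = contactAction x →
      ∃ c : ℝ, 0 < c ∧
        ∀ t, x t = ⟨boundaryLoop u t, c • flat (velocity (n := n) (boundaryLoop u) t)⟩) := by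
  refine ⟨hu.loopLength_le hρ hh hx, hx.contactAction_le hh,
    ⟨fun heq => ⟨hu.isClosedGeodesic hρ hh hx heq, hu.mem_halfCylinderOver hρ hh hx heq⟩,
      fun hq => hu.loopLength_eq_of_isClosedGeodesic hρ hh hx hq.1 hq.2⟩,
    fun heq => ⟨_, div_pos (zero_lt_one.trans (hx.one_lt_norm hh)) (hx.deriv_pos hh),
      hu.orbit_eq_lift hρ hh hx heq⟩⟩
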